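/- Let $X$ be a closed connected Riemann surface of genus $g\ge 2$ (that is, $\dim_{\mathbb C}H^0(X,\mathcal K)=g$), let $\mathcal K^{1/2}$ be a holomorphic square root of its canonical bundle $\mathcal K$, and let $t\in H^0(X,\mathcal K^{3/2})$. Consider $\mathcal E=\mathcal K^{1/2}\oplus\mathcal O\oplus\mathcal K^{-1/2}$ with $$\Phi=\begin{pmatrix}0&t&0\\0&0&t\\ \tau&0&0\end{pmatrix},\qquad \Phi_0=\begin{pmatrix}0&0&0\\0&0&0\\ \tau&0&0\end{pmatrix},\qquad B=\begin{pmatrix}0&0&1\\0&1&0\\1&0&0\end{pmatrix},$$ where $\tau$ is the tautological section of $\mathrm{Hom}(\mathcal K^{1/2},\mathcal K^{-1/2})\otimes\mathcal K\simeq\mathcal O$. Let $H$ be a harmonic metric on $(\mathcal E,\Phi,B)$: a smooth Hermitian metric for which the antilinear map $\sigma$ given by $H(\sigma u,v)=B(u,v)$ is an involution, and whose Chern connection $\nabla^H$ satisfies $F_{\nabla^H}+[\Phi,\Phi^{*H}]=0$. Let $h_1$ be the metric induced by $H$ on $\mathcal K^{1/2}$; then $h_1^{-2}$ is a metric on $\mathcal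 K^{-1}=TX$, and $\nabla^X$ denotes its Levi-Civita connection, lifted to the universal cover $p:\widetilde S_g\to X$. Let $\mathbb X=\mathrm{SL}(3,\mathbb R)/\mathrm{SO}(3)$ be the space of scalar products of volume one on $\mathbb R^3$, with its invariant Riemannian metric and Levi-Civita connection $\nabla^{\mathbb X}$. Fix a frame of $p^*\mathcal E$, parallel for $D=\nabla^H+\Phi+\Phi^{*H}$, made of $\sigma$-real sections and of volume one. It identifies the fibres of the real part of $p^*\mathcal E$ with $\mathbb R^3$, so that $H$ defines a map $h:\widetilde S_g\to\mathbb X$. For $v\in T_x\widetilde S_g$ let $V(v)\in T_{h(x)}\mathbb X$ be the vector generated by the element of $\mathfrak{sl}(3,\mathbb R)$ which is, in this frame, the endomorphism $\Phi_0(v)+\Phi_0^{*H}(v)$, where $\Phi_0(v):=\Phi_0(v^{(1,0)})$ and $\Phi_0^{*H}(v)$ is its $H$-adjoint. Then $H=\mathrm{diag}(h_1,1,h_1^{-1})$, the map $h$ takes its values in $\mathbb X$ and is smooth, and $V:T\widetilde S_g\to T\mathbb X$ is an injective real bundle map over $h$. Its image $V(T\widetilde S_g)$ is a parallel distribution of planes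 along $h$ for $\nabla^{\mathbb X}$: if $Y$ is a differentiable section of $T\mathbb X$ along $h$ with values in $V(T\widetilde S_g)$, then $\nabla^{\mathbb X}_uY\in V(T_x\widetilde S_g)$ for all $x\in\widetilde S_g$ and $u\in T_x\widetilde S_g$. More precisely, for every differentiable section $v$ of $T\widetilde S_g$, $$\nabla^{\mathbb X}V(v)=V(\nabla^Xv).$$ Consequently, if $v$ is a parallel section of $T\widetilde S_g$ over a curve $\gamma$ for $\nabla^X$, then $V(v)$ is a parallel section of $T\mathbb X$ over $h\circ\gamma$. -/

import Mathlib

open scoped Manifold ContDiff Matrix ComplexConjugate ComplexOrder Topology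

noncomputable section

namespace HiggsSlice

/-- Real or complex `3 × 3` matrices. -/
abbrev Mat (R : Type*) := Matrix (Fin 3) (Fin 3) R

/-! ### Wirtinger derivatives -/

/-- `∂f/∂z = (∂f/∂x - i ∂f/∂y) / 2`. -/
def dZ (f : ℂ → ℂ) (z : ℂ) : ℂ :=
  (fderiv ℝ f z 1 - Complex.I * fderiv ℝ f z Complex.I) / 2

/-- `∂f/∂z̄ = (∂f/∂x + i ∂f/∂y) / 2`. -/
def dZbar (f : ℂ → ℂ) (z : ℂ) : ℂ :=
  (fderiv ℝ f z 1 + Complex.I * fderiv ℝ f z Complex.I) / 2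

/-- Entrywise `∂/∂z` of a matrix valued function. -/
def matDZ (F : ℂ → Mat ℂ) (z : ℂ) : Mat ℂ := Matrix.of fun a b => dZ (fun w => F w a b) z

/-- Entrywise `∂/∂z̄` of a matrix valued function. -/
def matDZbar (F : ℂ → Mat ℂ) (z : ℂ) : Mat ℂ := Matrix.of fun a b => dZbar (fun w => F w a b) z

/-! ### The square root of the canonical bundle -/

/-- A holomorphic square root `K^{1/2}` of the canonical bundle of the Riemann surface `X`, given
by a cocycle. The `chart i` are holomorphic coordinates `z_i` covering `X`, the line bundle
`K^{1/2}` has the frame `e_i = dz_i^{1/2}` over the domain of `z_i`, and `e_j = (trans i j) e_i` on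
overlaps, so that `(trans i j)² = dz_j / dz_i`. The function `idx` picks one of the
coordinates around each point. -/
structure SqrtCanonical (ι X : Type*) [TopologicalSpace X] [ChartedSpace ℂ X] where
  chart : ι → OpenPartialHomeomorph X ℂ
  chart_mem : ∀ i, chart i ∈ IsManifold.maximalAtlas 𝓘(ℂ) ω X
  idx : X → ι
  mem_source : ∀ x, x ∈ (chart (idx x)).source
  trans : ι → ι → X → ℂ
  trans_holomorphic : ∀ i j, DifferentiableOn ℂ (fun z => trans i j ((chart i).symm z))
    ((chart i).target ∩ (chart i).symm ⁻¹' (chart j).source)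
  trans_cocycle : ∀ i j k x, x ∈ (chart i).source → x ∈ (chart j).source →
    x ∈ (chart k).source → trans i k x = trans i j x * trans j k x
  trans_sq : ∀ i j x, x ∈ (chart i).source → x ∈ (chart j).source →
    trans i j x ^ 2 = deriv (fun z => chart j ((chart i).symm z)) (chart i x)

namespace SqrtCanonical

variable {ι X : Type*} [TopologicalSpace X] [ChartedSpace ℂ X] (θ : SqrtCanonical ι X)

/-- The space `H⁰(X, K^{k/2})` of holomorphic sections: the section is `f i • e_i ^ k` over the
domain of the coordinate `z_i` (and `f i` is `0` outside of that domain). For `k = 2` these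
are the holomorphic one-forms `f i dz_i`. -/
def sections (k : ℤ) : Submodule ℂ (ι → X → ℂ) where
  carrier := {f |
    (∀ i, DifferentiableOn ℂ (fun z => f i ((θ.chart i).symm z)) (θ.chart i).target) ∧
    (∀ i j x, x ∈ (θ.chart i).source → x ∈ (θ.chart j).source →
      f i x = θ.trans i j x ^ k * f j x) ∧
    (∀ i x, x ∉ (θ.chart i).source → f i x = 0)}
  add_mem' := by
    rintro f g ⟨hf₁, hf₂, hf₃⟩ ⟨hg₁, hg₂, hg₃⟩
    refine ⟨fun i => (hf₁ i).add (hg₁ i), fun i j x hi hj => ?_, fun i x hx => ?_⟩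
    · simp only [Pi.add_apply, hf₂ i j x hi hj, hg₂ i j x hi hj]
      ring
    · simp [hf₃ i x hx, hg₃ i x hx]
  zero_mem' := ⟨fun _ => differentiableOn_const 0, fun _ _ _ _ _ => by simp, fun _ _ _ => rfl⟩
  smul_mem' := by
    rintro a f ⟨hf₁, hf₂, hf₃⟩
    refine ⟨fun i => (hf₁ i).const_smul a, fun i j x hi hj => ?_, fun i x hx => ?_⟩
    · simp only [Pi.smul_apply, smul_eq_mul, hf₂ i j x hi hj]
      ring
    · simp [hf₃ i x hx]

/-- The genus of the closed Riemann surface `X`, as the dimension of its space of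
holomorphic one-forms. -/
def genus : ℕ := Module.finrank ℂ (θ.sections 2)

/-- The transition matrix of `E = K^{1/2} ⊕ O ⊕ K^{-1/2}` between the frames
`(e_i, 1, e_i⁻¹)` and `(e_j, 1, e_j⁻¹)`. -/
def gauge (i j : ι) (x : X) : Mat ℂ :=
  Matrix.diagonal ![θ.trans i j x, 1, (θ.trans i j x)⁻¹]

end SqrtCanonical

/-! ### The Higgs bundle and its harmonic metric -/

/-- The matrix of `Φ / dz_i` in the frame `(e_i, 1, e_i⁻¹)` where `t = c e_i³`.
The tautological section `τ` has coefficient `1`. -/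
def higgs (c : ℂ) : Mat ℂ := !![0, c, 0; 0, 0, c; 1, 0, 0]

/-- The matrix of `Φ₀ / dz_i`, the Fuchsian part of the Higgs field. -/
def higgs₀ : Mat ℂ := !![0, 0, 0; 0, 0, 0; 1, 0, 0]

/-- The complex bilinear pairing `B` on `E`. -/
def pairing : Mat ℂ := !![0, 0, 1; 0, 1, 0; 1, 0, 0]

/-- The adjoint of `A` for the Hermitian form `(u, v) ↦ uᴴ H v`. -/
def adj (H A : Mat ℂ) : Mat ℂ := H⁻¹ * Aᴴ * H

section

variable {ι X : Type*} [TopologicalSpace X] [ChartedSpace ℂ X]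

/-- The connection form `H⁻¹ ∂H` (coefficient of `dz_i`) of the Chern connection of the metric with
Gram matrices `H i` in the frames `(e_i, 1, e_i⁻¹)`, at the point of coordinate `z`. -/
def chernForm (θ : SqrtCanonical ι X) (H : ι → X → Mat ℂ) (i : ι) (z : ℂ) : Mat ℂ :=
  (H i ((θ.chart i).symm z))⁻¹ * matDZ (fun w => H i ((θ.chart i).symm w)) z

/-- `H` is a harmonic metric on the `SL(3, ℝ)`-Higgs bundle `(E, Φ, B)` attached to the section `t`
of `K^{3/2}`: a smooth Hermitian metric on `E`, with Gram matrix `H i` in the frame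
`(e_i, 1, e_i⁻¹)`, compatible with `B` (the antilinear map `σ u = H⁻¹ B ū`, which satisfies
`H(σ u, v) = B(u, v)`, is an involution), and such that Hitchin's equation `F + [Φ, Φ*] = 0` holds.
The last field is the coefficient of `dz ∧ dz̄` in this equation. -/
structure IsHarmonicMetric (θ : SqrtCanonical ι X) (t : ι → X → ℂ) (H : ι → X → Mat ℂ) : Prop where
  smooth : ∀ i a b, ContDiffOn ℝ ∞ (fun z => H i ((θ.chart i).symm z) a b) (θ.chart i).target
  posDef : ∀ i x, x ∈ (θ.chart i).source → (H i x).PosDef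
  transition : ∀ i j x, x ∈ (θ.chart i).source → x ∈ (θ.chart j).source →
    H j x = (θ.gauge i j x)ᴴ * H i x * θ.gauge i j x
  compatible : ∀ i x, x ∈ (θ.chart i).source →
    ((H i x)⁻¹ * pairing) * ((H i x)⁻¹ * pairing).map conj = 1
  hitchin : ∀ i x, x ∈ (θ.chart i).source →
    - matDZbar (chernForm θ H i) (θ.chart i x)
      + (higgs (t i x) * adj (H i x) (higgs (t i x))
        - adj (H i x) (higgs (t i x)) * higgs (t i x)) = 0

/-- The metric `h₁` that `H` induces on `K^{1/2}`: the squared norm of `e_i`. -/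
def h₁ (H : ι → X → Mat ℂ) (i : ι) (x : X) : ℝ := (H i x 0 0).re

/-! ### The flat bundle over the universal cover -/

variable {S : Type*} [TopologicalSpace S] [ChartedSpace ℂ S]

/-- Entrywise differential at `y`, in the direction `v`, of a matrix valued function. -/
def matD {R : Type*} [NormedAddCommGroup R] [NormedSpace ℝ R] (F : S → Mat R) (y : S)
    (v : TangentSpace 𝓘(ℝ, ℂ) y) : Mat R :=
  Matrix.of fun a b => mfderiv 𝓘(ℝ, ℂ) 𝓘(ℝ, R) (fun x => F x a b) y v

/-- `dz_i (v)` for a real tangent vector `v` of the cover `p : S → X`; this is also the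
value of `dz_i` on the `(1,0)`-part of `v`. -/
def dz (θ : SqrtCanonical ι X) (p : S → X) (i : ι) (y : S) (v : TangentSpace 𝓘(ℝ, ℂ) y) : ℂ :=
  mfderiv 𝓘(ℝ, ℂ) 𝓘(ℝ, ℂ) (fun x => θ.chart i (p x)) y v

/-- `P` is a global frame over `S`, real and of volume one, of the pull-back of `E` that is parallel
for the flat connection `D = ∇ + Φ + Φ*`. The columns of `P i` are the components of the frame in
`(e_i, 1, e_i⁻¹)`. Real means fixed by the antilinear involution `σ u = H⁻¹ B ū`. -/
structure IsFlatRealFrame (θ : SqrtCanonical ι X) (t : ι → X → ℂ) (H : ι → X → Mat ℂ)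
    (p : S → X) (P : ι → S → Mat ℂ) : Prop where
  smooth : ∀ i a b, ContMDiffOn 𝓘(ℝ, ℂ) 𝓘(ℝ, ℂ) ∞ (fun y => P i y a b)
    (p ⁻¹' (θ.chart i).source)
  transition : ∀ i j y, p y ∈ (θ.chart i).source → p y ∈ (θ.chart j).source →
    P i y = θ.gauge i j (p y) * P j y
  real : ∀ i y, p y ∈ (θ.chart i).source →
    (H i (p y))⁻¹ * pairing * (P i y).map conj = P i y
  volume : ∀ i y, p y ∈ (θ.chart i).source → ‖(P i y).det‖ = 1
  flat : ∀ i y, p y ∈ (θ.chart i).source → ∀ v : TangentSpace 𝓘(ℝ, ℂ) y,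
    matD (P i) y v
      + (dz θ p i y v • (chernForm θ H i (θ.chart i (p y)) + higgs (t i (p y)))
        + conj (dz θ p i y v) • adj (H i (p y)) (higgs (t i (p y)))) * P i y = 0

/-- The metric `h₁⁻²` on `K⁻¹ = TX`, seen as a Riemannian metric on the cover `S` of `X`:
`g(u, v) = h₁⁻² Re(dz_i(u) conj(dz_i(v)))`. -/
def surfaceMetric (θ : SqrtCanonical ι X) (H : ι → X → Mat ℂ) (p : S → X) (y : S)
    (u v : TangentSpace 𝓘(ℝ, ℂ) y) : ℝ :=
  (h₁ H (θ.idx (p y)) (p y) ^ 2)⁻¹ *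
    (dz θ p (θ.idx (p y)) y u * conj (dz θ p (θ.idx (p y)) y v)).re

/-- The map `h` from `S` to the scalar products on `ℝ³`: the Gram matrix of `H` in the
flat real frame `P`. -/
def harmonicMap (θ : SqrtCanonical ι X) (H : ι → X → Mat ℂ) (p : S → X) (P : ι → S → Mat ℂ)
    (y : S) : Mat ℝ :=
  ((P (θ.idx (p y)) y)ᴴ * H (θ.idx (p y)) (p y) * P (θ.idx (p y)) y).map Complex.re

/-- `(Φ₀ + Φ₀*)(v)`, as an endomorphism of `E` in the frame of index `θ.idx (p y)`. -/
def psi₀ (θ : SqrtCanonical ι X) (H : ι → X → Mat ℂ) (p : S → X) (y : S)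
    (v : TangentSpace 𝓘(ℝ, ℂ) y) : Mat ℂ :=
  dz θ p (θ.idx (p y)) y v • higgs₀
    + conj (dz θ p (θ.idx (p y)) y v) • adj (H (θ.idx (p y)) (p y)) higgs₀

/-- The vector at the scalar product `q` generated by `A ∈ sl(3, ℝ)` for the action
`(g · q)(u, v) = q(g⁻¹ u, g⁻¹ v)` of `SL(3, ℝ)`, i.e. the derivative of `exp (sA) · q` at `s = 0`.
On `q`-symmetric traceless `A` this is inverse to the Maurer–Cartan identification
of the tangent space at `q` with a subspace of `sl(3, ℝ)`. -/
def infAction (q A : Mat ℝ) : Mat ℝ := -(Aᵀ * q + q * A)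

/-- The bundle map `V` over `h`: `V(v)` is the tangent vector that corresponds to `(Φ₀ + Φ₀*)(v)`,
which is written as a real matrix in the flat real frame `P`. -/
def bundleMap (θ : SqrtCanonical ι X) (H : ι → X → Mat ℂ) (p : S → X) (P : ι → S → Mat ℂ)
    (y : S) (v : TangentSpace 𝓘(ℝ, ℂ) y) : Mat ℝ :=
  infAction (harmonicMap θ H p P y)
    (((P (θ.idx (p y)) y)⁻¹ * psi₀ θ H p y v * P (θ.idx (p y)) y).map Complex.re)

end

/-! ### The symmetric space of `SL(3, ℝ)` -/

/-- `SL(3, ℝ)/SO(3)`, as the space of scalar products of volume one on `ℝ³`. -/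
def symSpace : Set (Mat ℝ) := {q | q.PosDef ∧ q.det = 1}

/-- The tangent space of `symSpace` at `q`, a subspace of the symmetric matrices. -/
def symTangent (q : Mat ℝ) : Set (Mat ℝ) := {Y | Yᵀ = Y ∧ (q⁻¹ * Y).trace = 0}

/-- The `SL(3, ℝ)`-invariant Riemannian metric of `symSpace`. -/
def symMetric (q Y Z : Mat ℝ) : ℝ := (q⁻¹ * Y * q⁻¹ * Z).trace

/-- Entrywise derivative of a curve of matrices. -/
def curveD (c : ℝ → Mat ℝ) (s : ℝ) : Mat ℝ := Matrix.of fun a b => deriv (fun r => c r a b) s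

/-- Smooth curves of matrices. -/
def SmoothCurve (c : ℝ → Mat ℝ) : Prop := ∀ a b, ContDiff ℝ ∞ fun s => c s a b

/-- The covariant derivative of the field `Y` along the curve `c`, for the connection
`∇_W Y = dY(W) + Γ(W, Y)`. -/
def covCurve (Γ : Mat ℝ → Mat ℝ →ₗ[ℝ] Mat ℝ →ₗ[ℝ] Mat ℝ) (c Y : ℝ → Mat ℝ) (s : ℝ) : Mat ℝ :=
  curveD Y s + Γ (c s) (curveD c s) (Y s)

/-- `∇_W Y = dY(W) + Γ(W, Y)` is the Levi-Civita connection of `symSpace` with the metric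
`symMetric`: it preserves tangency to `symSpace`, is torsion-free and
compatible with the metric. (Only the values of `Γ q` on tangent vectors at `q` matter.) -/
structure IsSymLeviCivita (Γ : Mat ℝ → Mat ℝ →ₗ[ℝ] Mat ℝ →ₗ[ℝ] Mat ℝ) : Prop where
  tangent : ∀ c Y : ℝ → Mat ℝ, SmoothCurve c → SmoothCurve Y → (∀ s, c s ∈ symSpace) →
    (∀ s, Y s ∈ symTangent (c s)) → ∀ s, covCurve Γ c Y s ∈ symTangent (c s)
  torsion_free : ∀ q ∈ symSpace, ∀ Y ∈ symTangent q, ∀ Z ∈ symTangent q, Γ q Y Z = Γ q Z Y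
  metric : ∀ c Y Z : ℝ → Mat ℝ, SmoothCurve c → SmoothCurve Y → SmoothCurve Z →
    (∀ s, c s ∈ symSpace) → (∀ s, Y s ∈ symTangent (c s)) → (∀ s, Z s ∈ symTangent (c s)) →
    ∀ s, deriv (fun r => symMetric (c r) (Y r) (Z r)) s =
      symMetric (c s) (covCurve Γ c Y s) (Z s) + symMetric (c s) (Y s) (covCurve Γ c Z s)

section

variable {S : Type*} [TopologicalSpace S] [ChartedSpace ℂ S]

/-- The pull-back connection: covariant derivative in the direction `u` of a section `Y`
of the tangent bundle of `symSpace` along the map `h`. -/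
def covAlong (Γ : Mat ℝ → Mat ℝ →ₗ[ℝ] Mat ℝ →ₗ[ℝ] Mat ℝ) (h Y : S → Mat ℝ) (y : S)
    (u : TangentSpace 𝓘(ℝ, ℂ) y) : Mat ℝ :=
  matD Y y u + Γ (h y) (matD h y u) (Y y)

/-- Entrywise differentiability of a matrix valued function. -/
def MatDiffAt (F : S → Mat ℝ) (y : S) : Prop :=
  ∀ a b, MDifferentiableAt 𝓘(ℝ, ℂ) 𝓘(ℝ, ℝ) (fun x => F x a b) y

/-! ### Levi-Civita connections on the surface -/

variable [IsManifold 𝓘(ℝ, ℂ) ∞ S]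

/-- The section `v` of the tangent bundle of `S` is differentiable at `y`. -/
def SecDiffAt (v : ∀ y : S, TangentSpace 𝓘(ℝ, ℂ) y) (y : S) : Prop :=
  MDifferentiableAt 𝓘(ℝ, ℂ) (𝓘(ℝ, ℂ).prod 𝓘(ℝ, ℂ))
    (fun x => (Bundle.TotalSpace.mk' ℂ x (v x) : TangentBundle 𝓘(ℝ, ℂ) S)) y

/-- `cov` is the Levi-Civita connection of the Riemannian metric `g` on the surface `S`. -/
structure IsSurfaceLeviCivita
    (g : ∀ y : S, TangentSpace 𝓘(ℝ, ℂ) y → TangentSpace 𝓘(ℝ, ℂ) y → ℝ)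
    (cov : CovariantDerivative 𝓘(ℝ, ℂ) ℂ (TangentSpace 𝓘(ℝ, ℂ) : S → Type _)) : Prop where
  torsion_free : cov.torsion = 0
  metric : ∀ (y : S) (u : TangentSpace 𝓘(ℝ, ℂ) y) (v w : ∀ y : S, TangentSpace 𝓘(ℝ, ℂ) y),
    SecDiffAt v y → SecDiffAt w y →
    mfderiv 𝓘(ℝ, ℂ) 𝓘(ℝ, ℝ) (fun x => g x (v x) (w x)) y u =
      g y (cov v y u) (w y) + g y (v y) (cov w y u)

/-- The section `v` of `TS` over the curve `γ` has covariant derivative `w` at time `s`: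
if `v = ∑ f_k e_k(γ)` near `s`, then `w = ∑ (f_k' e_k + f_k ∇_{γ'} e_k)`. -/
def HasCovDerivAlong (cov : CovariantDerivative 𝓘(ℝ, ℂ) ℂ (TangentSpace 𝓘(ℝ, ℂ) : S → Type _))
    (γ : ℝ → S) (v : ∀ s, TangentSpace 𝓘(ℝ, ℂ) (γ s)) (s : ℝ)
    (w : TangentSpace 𝓘(ℝ, ℂ) (γ s)) : Prop :=
  ∃ (e : Fin 2 → ∀ y : S, TangentSpace 𝓘(ℝ, ℂ) y) (f : Fin 2 → ℝ → ℝ),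
    (∀ k, SecDiffAt (e k) (γ s)) ∧ (∀ k, DifferentiableAt ℝ (f k) s) ∧
    (∀ᶠ r in 𝓝 s, v r = ∑ k, f k r • e k (γ r)) ∧
    w = ∑ k, (deriv (f k) s • e k (γ s)
      + f k s • cov (e k) (γ s) (mfderiv 𝓘(ℝ, ℝ) 𝓘(ℝ, ℂ) γ s (1 : ℝ)))

end

end HiggsSlice

end

/-! The proof rests on one structural fact, that H is diagonal, and on one cancellation.

Diagonality comes from a cyclic symmetry. Conjugation by R = `rotation` = diag(1, ω, ω²), with ω a
primitive cube root of unity, multiplies Φ by a root of unity, so R*HR again solves Hitchin's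
equation. For two solutions, compared by s = H⁻¹R*HR, the Laplacian of tr s is a sum of weighted
squared norms of ∂̄s and of [s, Φ] (`trace_second_variation`). Hence tr s is subharmonic, so
constant on the compact surface X by the strong maximum principle (`eq_of_lap_nonneg`), and s is a
holomorphic endomorphism that commutes with Φ. Its entries below the diagonal are sections of
K^{-1/2} and K⁻¹, which vanish in genus at least two, and commuting with Φ then kills the entries
above (`cyclicRatio_diagonal`). A diagonal s must be the identity, because H and R*HR have the same
diagonal; so H is R-invariant, hence diagonal, and compatibility with B fixes its shape
(`eq_diagonal`).

For the geometry, let P be the flat frame. Then h = P*HP, and after complexification dh(u) = −2P*H(Φ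
+ Φ*)(u)P, while V(v) = −2P*MP with M = H(Φ₀ + Φ₀*)(v). The axioms force the Levi-Civita connection
of the symmetric space to be dY − ½(W q⁻¹ Y + Y q⁻¹ W) (`IsSymLeviCivita.eq`). Differentiating P*MP
through DP = 0 produces Chern terms and terms in Φ + Φ*, and the Christoffel term cancels exactly
the latter, which are the only ones that contain t. So ∇V(v) is the Chern derivative of M. Since H
is diagonal, the Chern form is diag(a, 0, −a) with a = ∂ log h₁; it preserves the shape of M and
acts on the coordinate of v by d − 2a dz, which is the Levi-Civita connection of h₁⁻²
(`formMat_covariant`, `dz_cov`). This is `covAlong_bundleMap`; the statements on planes and on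
parallel sections follow because V is linear and injective. -/

noncomputable section

namespace HiggsSlice

/-! ### Directional derivatives of functions and matrices on manifolds -/

section Calculus

variable {E : Type*} [NormedAddCommGroup E] [NormedSpace ℝ E]
  {M : Type*} [TopologicalSpace M] [ChartedSpace E M]
  {R : Type*} [NormedField R] [NormedAlgebra ℝ R]
  {R' : Type*} [NormedField R'] [NormedAlgebra ℝ R']

/-- The function `f` is differentiable at `y`, with derivative `f'` in the direction `v`. -/
def HasDirDeriv (f : M → R) (y : M) (v : TangentSpace 𝓘(ℝ, E) y) (f' : R) : Prop :=
  MDifferentiableAt 𝓘(ℝ, E) 𝓘(ℝ, R) f y ∧ (mfderiv 𝓘(ℝ, E) 𝓘(ℝ, R) f y v : R) = f'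

/-- Entrywise version of `HasDirDeriv`. -/
def HasMatDeriv (F : M → Mat R) (y : M) (v : TangentSpace 𝓘(ℝ, E) y) (F' : Mat R) : Prop :=
  ∀ a b, HasDirDeriv (fun x => F x a b) y v (F' a b)

variable {f g : M → R} {F G : M → Mat R} {y : M} {v : TangentSpace 𝓘(ℝ, E) y}

theorem hasDirDeriv_of_mdifferentiableAt (hf : MDifferentiableAt 𝓘(ℝ, E) 𝓘(ℝ, R) f y) :
    HasDirDeriv f y v (mfderiv 𝓘(ℝ, E) 𝓘(ℝ, R) f y v : R) := ⟨hf, rfl⟩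

theorem hasDirDeriv_of_hasMFDerivAt {L : E →L[ℝ] R}
    (hf : HasMFDerivAt 𝓘(ℝ, E) 𝓘(ℝ, R) f y L) {f' : R} (h : L v = f') :
    HasDirDeriv f y v f' :=
  ⟨hf.mdifferentiableAt, by rw [hf.mfderiv]; exact h⟩

theorem HasDirDeriv.unique {a b : R} (h : HasDirDeriv f y v a) (h' : HasDirDeriv f y v b) :
    a = b := h.2.symm.trans h'.2

theorem hasDirDeriv_const (c : R) : HasDirDeriv (fun _ : M => c) y v 0 :=
  ⟨mdifferentiableAt_const, by rw [mfderiv_const]; rfl⟩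

theorem HasDirDeriv.add {a b : R} (hf : HasDirDeriv f y v a) (hg : HasDirDeriv g y v b) :
    HasDirDeriv (fun x => f x + g x) y v (a + b) := by
  have := hf.1.hasMFDerivAt.add hg.1.hasMFDerivAt
  refine hasDirDeriv_of_hasMFDerivAt this ?_
  rw [← hf.2, ← hg.2]; rfl

theorem HasDirDeriv.mul {a b : R} (hf : HasDirDeriv f y v a) (hg : HasDirDeriv g y v b) :
    HasDirDeriv (fun x => f x * g x) y v (a * g y + f y * b) := by
  have := HasMFDerivAt.mul hf.1.hasMFDerivAt hg.1.hasMFDerivAt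
  refine hasDirDeriv_of_hasMFDerivAt this ?_
  rw [← hf.2, ← hg.2]
  have key : ∀ p q : R, f y * q + g y * p = p * g y + f y * q := fun p q => by ring
  exact key _ _

theorem HasDirDeriv.const_mul {a : R} (c : R) (hf : HasDirDeriv f y v a) :
    HasDirDeriv (fun x => c * f x) y v (c * a) := by
  simpa using (hasDirDeriv_const c).mul hf

theorem HasDirDeriv.sum {n : ℕ} {f : Fin n → M → R} {f' : Fin n → R}
    (h : ∀ k, HasDirDeriv (f k) y v (f' k)) :
    HasDirDeriv (fun x => ∑ k, f k x) y v (∑ k, f' k) := by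
  induction n with
  | zero => simpa using hasDirDeriv_const 0
  | succ n ih =>
    simp only [Fin.sum_univ_succ]
    exact (h 0).add (ih fun k => h k.succ)

theorem HasDirDeriv.clm_comp (L : R →L[ℝ] R') {a : R} (hf : HasDirDeriv f y v a) :
    HasDirDeriv (fun x => L (f x)) y v (L a) := by
  have h := (L.hasMFDerivAt (x := f y)).comp y hf.1.hasMFDerivAt
  refine hasDirDeriv_of_hasMFDerivAt h ?_
  rw [← hf.2]; rfl

theorem HasDirDeriv.congr {a : R} (hf : HasDirDeriv f y v a) (h : g =ᶠ[𝓝 y] f) :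
    HasDirDeriv g y v a :=
  ⟨hf.1.congr_of_eventuallyEq h, by rw [h.mfderiv_eq]; exact hf.2⟩

/-- Chain rule, for a function of one vector variable. -/
theorem HasDirDeriv.comp_fderiv {E' : Type*} [NormedAddCommGroup E'] [NormedSpace ℝ E']
    {φ : E' → R} {u : M → E'} (hφ : DifferentiableAt ℝ φ (u y))
    (hu : MDifferentiableAt 𝓘(ℝ, E) 𝓘(ℝ, E') u y) :
    HasDirDeriv (fun x => φ (u x)) y v
      (fderiv ℝ φ (u y) (mfderiv 𝓘(ℝ, E) 𝓘(ℝ, E') u y v)) := by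
  have h := hφ.hasFDerivAt.hasMFDerivAt.comp y hu.hasMFDerivAt
  exact hasDirDeriv_of_hasMFDerivAt h rfl

/-- Chain rule along a curve. -/
theorem HasDirDeriv.comp_curve {γ : ℝ → M} {s : ℝ}
    (hγ : MDifferentiableAt 𝓘(ℝ, ℝ) 𝓘(ℝ, E) γ s) {a : R}
    (hf : HasDirDeriv f (γ s) (mfderiv 𝓘(ℝ, ℝ) 𝓘(ℝ, E) γ s (1 : ℝ)) a) :
    HasDerivAt (fun r => f (γ r)) a s := by
  let L : ℝ →L[ℝ] R :=
    (mfderiv 𝓘(ℝ, E) 𝓘(ℝ, R) f (γ s)).comp (mfderiv 𝓘(ℝ, ℝ) 𝓘(ℝ, E) γ s)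
  have h : HasFDerivAt (fun r => f (γ r)) L s :=
    (hf.1.hasMFDerivAt.comp s hγ.hasMFDerivAt).hasFDerivAt
  refine h.hasDerivAt.congr_deriv ?_
  rw [← hf.2]; rfl

theorem HasDirDeriv.inv {a : R} (hf : HasDirDeriv f y v a) (h0 : f y ≠ 0) :
    HasDirDeriv (fun x => (f x)⁻¹) y v (-(a / f y ^ 2)) := by
  have h := (hasFDerivAt_inv' (𝕜 := ℝ) h0).hasMFDerivAt.comp y hf.1.hasMFDerivAt
  refine hasDirDeriv_of_hasMFDerivAt h ?_
  rw [← hf.2]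
  have key : ∀ p : R, -((f y)⁻¹ * p * (f y)⁻¹) = -(p / f y ^ 2) := fun p => by field_simp
  exact key _

theorem HasMatDeriv.unique {A B : Mat R} (h : HasMatDeriv F y v A) (h' : HasMatDeriv F y v B) :
    A = B := by
  ext a b; exact (h a b).unique (h' a b)

theorem hasMatDeriv_const (C : Mat R) : HasMatDeriv (fun _ : M => C) y v 0 :=
  fun _ _ => hasDirDeriv_const _

theorem HasMatDeriv.add {A B : Mat R} (hF : HasMatDeriv F y v A) (hG : HasMatDeriv G y v B) :
    HasMatDeriv (fun x => F x + G x) y v (A + B) := fun a b => (hF a b).add (hG a b)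

theorem HasMatDeriv.mul {A B : Mat R} (hF : HasMatDeriv F y v A) (hG : HasMatDeriv G y v B) :
    HasMatDeriv (fun x => F x * G x) y v (A * G y + F y * B) := by
  intro a b
  simp only [Matrix.mul_apply, Matrix.add_apply, ← Finset.sum_add_distrib]
  exact HasDirDeriv.sum fun k => (hF a k).mul (hG k b)

theorem HasMatDeriv.const_mul (C : Mat R) {A : Mat R} (hF : HasMatDeriv F y v A) :
    HasMatDeriv (fun x => C * F x) y v (C * A) := by
  simpa using (hasMatDeriv_const C).mul hF

theorem HasMatDeriv.mul_const (C : Mat R) {A : Mat R} (hF : HasMatDeriv F y v A) :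
    HasMatDeriv (fun x => F x * C) y v (A * C) := by
  simpa using hF.mul (hasMatDeriv_const C)

theorem HasMatDeriv.const_smul (c : R) {A : Mat R} (hF : HasMatDeriv F y v A) :
    HasMatDeriv (fun x => c • F x) y v (c • A) :=
  fun a b => (hF a b).const_mul c

theorem HasMatDeriv.congr {A : Mat R} (hF : HasMatDeriv F y v A) (h : ∀ᶠ x in 𝓝 y, G x = F x) :
    HasMatDeriv G y v A :=
  fun a b => (hF a b).congr (h.mono fun _ hx => congrFun (congrFun hx a) b)

theorem HasMatDeriv.trace {A : Mat R} (hF : HasMatDeriv F y v A) :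
    HasDirDeriv (fun x => (F x).trace) y v A.trace :=
  HasDirDeriv.sum fun k => hF k k

theorem HasDirDeriv.conj {f : M → ℂ} {a : ℂ} (hf : HasDirDeriv f y v a) :
    HasDirDeriv (fun x => conj (f x)) y v (conj a) :=
  hf.clm_comp (Complex.conjCLE : ℂ →L[ℝ] ℂ)

theorem HasDirDeriv.re {f : M → ℂ} {a : ℂ} (hf : HasDirDeriv f y v a) :
    HasDirDeriv (fun x => (f x).re) y v a.re :=
  hf.clm_comp Complex.reCLM

theorem HasDirDeriv.im {f : M → ℂ} {a : ℂ} (hf : HasDirDeriv f y v a) :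
    HasDirDeriv (fun x => (f x).im) y v a.im :=
  hf.clm_comp Complex.imCLM

theorem HasDirDeriv.ofReal {f : M → ℝ} {a : ℝ} (hf : HasDirDeriv f y v a) :
    HasDirDeriv (fun x => (f x : ℂ)) y v (a : ℂ) :=
  hf.clm_comp Complex.ofRealCLM

theorem HasMatDeriv.conjTranspose {F : M → Mat ℂ} {A : Mat ℂ} (hF : HasMatDeriv F y v A) :
    HasMatDeriv (fun x => (F x)ᴴ) y v Aᴴ :=
  fun a b => (hF b a).conj

theorem HasMatDeriv.re {F : M → Mat ℂ} {A : Mat ℂ} (hF : HasMatDeriv F y v A) :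
    HasMatDeriv (fun x => (F x).map Complex.re) y v (A.map Complex.re) :=
  fun a b => (hF a b).re

theorem HasMatDeriv.ofReal {F : M → Mat ℝ} {A : Mat ℝ} (hF : HasMatDeriv F y v A) :
    HasMatDeriv (fun x => (F x).map Complex.ofReal) y v (A.map Complex.ofReal) :=
  fun a b => (hF a b).ofReal

theorem HasMatDeriv.comp_curve {γ : ℝ → M} {s : ℝ}
    (hγ : MDifferentiableAt 𝓘(ℝ, ℝ) 𝓘(ℝ, E) γ s) {A : Mat R}
    (hF : HasMatDeriv F (γ s) (mfderiv 𝓘(ℝ, ℝ) 𝓘(ℝ, E) γ s (1 : ℝ)) A) (a b : Fin 3) :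
    HasDerivAt (fun r => F (γ r) a b) (A a b) s :=
  (hF a b).comp_curve hγ

end Calculus

section Surface

variable {S : Type*} [TopologicalSpace S] [ChartedSpace ℂ S]
  {R : Type*} [NormedField R] [NormedAlgebra ℝ R]

theorem HasMatDeriv.matD_eq {F : S → Mat R} {y : S} {v : TangentSpace 𝓘(ℝ, ℂ) y} {A : Mat R}
    (hF : HasMatDeriv F y v A) : matD F y v = A := by
  ext a b; exact (hF a b).2

theorem hasMatDeriv_matD {F : S → Mat R} {y : S} (v : TangentSpace 𝓘(ℝ, ℂ) y)
    (hF : ∀ a b, MDifferentiableAt 𝓘(ℝ, ℂ) 𝓘(ℝ, R) (fun x => F x a b) y) :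
    HasMatDeriv F y v (matD F y v) :=
  fun a b => ⟨hF a b, rfl⟩

end Surface

/-! ### Wirtinger calculus and holomorphic coordinates -/

section Wirtinger

theorem fderiv_apply_eq_dZ (f : ℂ → ℂ) (z ζ : ℂ) :
    fderiv ℝ f z ζ = ζ * dZ f z + conj ζ * dZbar f z := by
  have h : fderiv ℝ f z ζ = ζ.re * fderiv ℝ f z 1 + ζ.im * fderiv ℝ f z Complex.I := by
    conv_lhs => rw [show ζ = ζ.re • (1 : ℂ) + ζ.im • Complex.I by simp [Complex.re_add_im]]
    rw [map_add, map_smul, map_smul]; rfl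
  have h1 : conj ζ = (ζ.re : ℂ) - ζ.im * Complex.I := by
    apply Complex.ext <;> simp
  have h2 : ζ = (ζ.re : ℂ) + ζ.im * Complex.I := (Complex.re_add_im ζ).symm
  rw [h, h1]
  nth_rewrite 3 [h2]
  unfold dZ dZbar
  linear_combination ((ζ.im : ℂ) * fderiv ℝ f z Complex.I) * Complex.I_sq

/-- A real-linear map ℂ → ℂ splits uniquely into a complex-linear and an antilinear part, so
Wirtinger derivatives can be read off from a formula for the real differential. The rules for
products and adjoints below are obtained in this way. -/
theorem dZ_eq_of_forall {f : ℂ → ℂ} {z A B : ℂ}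
    (h : ∀ ζ : ℂ, fderiv ℝ f z ζ = ζ * A + conj ζ * B) : dZ f z = A ∧ dZbar f z = B := by
  unfold dZ dZbar
  rw [h 1, h Complex.I]
  simp only [map_one, one_mul, Complex.conj_I]
  constructor
  · linear_combination (-(A - B) / 2) * Complex.I_sq
  · linear_combination ((A - B) / 2) * Complex.I_sq

theorem hasMatDeriv_matDZ {F : ℂ → Mat ℂ} {z : ℂ}
    (hF : ∀ a b, DifferentiableAt ℝ (fun w => F w a b) z) (ζ : ℂ) :
    HasMatDeriv F z (ζ : TangentSpace 𝓘(ℝ, ℂ) z)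
      (ζ • matDZ F z + conj ζ • matDZbar F z) := by
  intro a b
  refine hasDirDeriv_of_hasMFDerivAt (hF a b).hasFDerivAt.hasMFDerivAt ?_
  exact fderiv_apply_eq_dZ _ _ _

theorem HasMatDeriv.matDZ_eq {F : ℂ → Mat ℂ} {z : ℂ} {A B : Mat ℂ}
    (h : ∀ ζ : ℂ, HasMatDeriv F z (ζ : TangentSpace 𝓘(ℝ, ℂ) z) (ζ • A + conj ζ • B)) :
    matDZ F z = A ∧ matDZbar F z = B := by
  have key : ∀ a b, dZ (fun w => F w a b) z = A a b ∧ dZbar (fun w => F w a b) z = B a b :=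
    fun a b => dZ_eq_of_forall fun ζ => by
      have := (h ζ a b).2
      rw [mfderiv_eq_fderiv] at this
      exact this
  exact ⟨by ext a b; exact (key a b).1, by ext a b; exact (key a b).2⟩

variable {F G : ℂ → Mat ℂ} {z : ℂ}

theorem matDZ_mul (hF : ∀ a b, DifferentiableAt ℝ (fun w => F w a b) z)
    (hG : ∀ a b, DifferentiableAt ℝ (fun w => G w a b) z) :
    matDZ (fun w => F w * G w) z = matDZ F z * G z + F z * matDZ G z ∧
    matDZbar (fun w => F w * G w) z = matDZbar F z * G z + F z * matDZbar G z := by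
  refine HasMatDeriv.matDZ_eq fun ζ => ?_
  convert (hasMatDeriv_matDZ hF ζ).mul (hasMatDeriv_matDZ hG ζ) using 1
  simp only [add_mul, mul_add, Matrix.smul_mul, Matrix.mul_smul, smul_add]
  abel

theorem matDZ_const_mul_mul_const (C D : Mat ℂ)
    (hF : ∀ a b, DifferentiableAt ℝ (fun w => F w a b) z) :
    matDZ (fun w => C * F w * D) z = C * matDZ F z * D ∧
    matDZbar (fun w => C * F w * D) z = C * matDZbar F z * D := by
  refine HasMatDeriv.matDZ_eq fun ζ => ?_
  convert ((hasMatDeriv_matDZ hF ζ).const_mul C).mul_const D using 1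
  simp only [add_mul, mul_add, Matrix.smul_mul, Matrix.mul_smul]

theorem matDZ_conjTranspose (hF : ∀ a b, DifferentiableAt ℝ (fun w => F w a b) z) :
    matDZ (fun w => (F w)ᴴ) z = (matDZbar F z)ᴴ ∧
    matDZbar (fun w => (F w)ᴴ) z = (matDZ F z)ᴴ := by
  refine HasMatDeriv.matDZ_eq fun ζ => ?_
  convert (hasMatDeriv_matDZ hF ζ).conjTranspose using 1
  simp [add_comm]

theorem matDZ_congr (h : ∀ᶠ w in 𝓝 z, F w = G w) :
    matDZ F z = matDZ G z ∧ matDZbar F z = matDZbar G z := by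
  have key : ∀ a b, fderiv ℝ (fun w => F w a b) z = fderiv ℝ (fun w => G w a b) z :=
    fun a b => Filter.EventuallyEq.fderiv_eq
      (h.mono fun _ hw => congrFun (congrFun hw a) b)
  constructor <;> ext a b <;> simp [matDZ, matDZbar, dZ, dZbar, key]

theorem contDiffAt_dZ {f : ℂ → ℂ} (hf : ContDiffAt ℝ ∞ f z) : ContDiffAt ℝ ∞ (dZ f) z := by
  have h : ContDiffAt ℝ ∞ (fderiv ℝ f) z := hf.fderiv_right (m := ∞) (by simp)
  have h1 : ∀ e : ℂ, ContDiffAt ℝ ∞ (fun w => fderiv ℝ f w e) z := fun e =>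
    h.clm_apply contDiffAt_const
  exact (((h1 1).sub (contDiffAt_const.mul (h1 Complex.I))).div_const 2)

theorem contDiffAt_mat_mul {E : Type*} [NormedAddCommGroup E] [NormedSpace ℝ E]
    {R : Type*} [NormedField R] [NormedAlgebra ℝ R] {F G : E → Mat R} {z : E} {n : WithTop ℕ∞}
    (hF : ∀ a b, ContDiffAt ℝ n (fun w => F w a b) z)
    (hG : ∀ a b, ContDiffAt ℝ n (fun w => G w a b) z) (a b : Fin 3) :
    ContDiffAt ℝ n (fun w => (F w * G w) a b) z := by
  simp only [Matrix.mul_apply]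
  exact ContDiffAt.sum fun k _ => (hF a k).mul (hG k b)

theorem contDiffAt_mat_inv {n : WithTop ℕ∞}
    (hF : ∀ a b, ContDiffAt ℝ n (fun w => F w a b) z) (h0 : (F z).det ≠ 0) (a b : Fin 3) :
    ContDiffAt ℝ n (fun w => (F w)⁻¹ a b) z := by
  have hdet : ContDiffAt ℝ n (fun w => (F w).det) z := by
    simp only [Matrix.det_fin_three]
    have := hF
    fun_prop
  have hadj : ContDiffAt ℝ n (fun w => (F w).adjugate a b) z := by
    simp only [Matrix.adjugate_fin_three]
    have := hF
    fin_cases a <;> fin_cases b <;> simp <;> fun_prop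
  simp only [Matrix.inv_def, Matrix.smul_apply, Ring.inverse_eq_inv', smul_eq_mul]
  exact (hdet.inv h0).mul hadj

end Wirtinger

/-! ### Holomorphic coordinates as real local diffeomorphisms, and the cocycle of K^{1/2}. -/

section Charts

theorem contMDiffAt_real_of_complex {X Y : Type*} [TopologicalSpace X] [ChartedSpace ℂ X]
    [TopologicalSpace Y] [ChartedSpace ℂ Y] {f : X → Y} {x : X}
    (h : ContMDiffAt 𝓘(ℂ) 𝓘(ℂ) ω f x) : ContMDiffAt 𝓘(ℝ, ℂ) 𝓘(ℝ, ℂ) ∞ f x := by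
  rw [contMDiffAt_iff] at h ⊢
  refine ⟨h.1, ?_⟩
  have := (h.2.restrict_scalars ℝ).of_le (m := ∞) le_top
  exact this

namespace SqrtCanonical

variable {ι X : Type*} [TopologicalSpace X] [ChartedSpace ℂ X] (θ : SqrtCanonical ι X)

/-- The cocycle relation only makes `trans i i x` idempotent; the square relation, where the
coordinate change is the identity, excludes zero. -/
theorem trans_self {i : ι} {x : X} (hx : x ∈ (θ.chart i).source) : θ.trans i i x = 1 := by
  have h1 := θ.trans_cocycle i i i x hx hx hx
  have h2 := θ.trans_sq i i x hx hx
  have h3 : (fun z => θ.chart i ((θ.chart i).symm z)) =ᶠ[𝓝 (θ.chart i x)] id := by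
    filter_upwards [(θ.chart i).open_target.mem_nhds ((θ.chart i).map_source hx)] with z hz
    simp [(θ.chart i).right_inv hz]
  rw [h3.deriv_eq, deriv_id] at h2
  rw [sq, ← h1] at h2
  exact h2

theorem trans_mul_trans_symm {i j : ι} {x : X} (hi : x ∈ (θ.chart i).source)
    (hj : x ∈ (θ.chart j).source) : θ.trans i j x * θ.trans j i x = 1 := by
  rw [← θ.trans_cocycle i j i x hi hj hi, θ.trans_self hi]

theorem trans_ne_zero {i j : ι} {x : X} (hi : x ∈ (θ.chart i).source)
    (hj : x ∈ (θ.chart j).source) : θ.trans i j x ≠ 0 :=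
  left_ne_zero_of_mul_eq_one (θ.trans_mul_trans_symm hi hj)

/-- The coordinate change from `z_i` to `z_j` is holomorphic. -/
theorem differentiableAt_coordChange {i j : ι} {x : X}
    (hi : x ∈ (θ.chart i).source) (hj : x ∈ (θ.chart j).source) :
    DifferentiableAt ℂ (fun z => θ.chart j ((θ.chart i).symm z)) (θ.chart i x) := by
  have h1 : ContMDiffAt 𝓘(ℂ) 𝓘(ℂ) ω (θ.chart i).symm (θ.chart i x) :=
    (contMDiffOn_symm_of_mem_maximalAtlas (θ.chart_mem i)).contMDiffAt
      ((θ.chart i).open_target.mem_nhds ((θ.chart i).map_source hi))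
  have h2 : ContMDiffAt 𝓘(ℂ) 𝓘(ℂ) ω (θ.chart j) ((θ.chart i).symm (θ.chart i x)) := by
    rw [(θ.chart i).left_inv hi]
    exact (contMDiffOn_of_mem_maximalAtlas (θ.chart_mem j)).contMDiffAt
      ((θ.chart j).open_source.mem_nhds hj)
  have h3 := (h2.comp _ h1).contDiffAt
  exact h3.differentiableAt (by simp)

/-- The coordinate `z_i` as a partial diffeomorphism of real surfaces. -/
def realChart (i : ι) : PartialDiffeomorph 𝓘(ℝ, ℂ) 𝓘(ℝ, ℂ) X ℂ ∞ where
  toPartialEquiv := (θ.chart i).toPartialEquiv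
  open_source := (θ.chart i).open_source
  open_target := (θ.chart i).open_target
  contMDiffOn_toFun := fun _ hx => (contMDiffAt_real_of_complex
    ((contMDiffOn_of_mem_maximalAtlas (θ.chart_mem i)).contMDiffAt
      ((θ.chart i).open_source.mem_nhds hx))).contMDiffWithinAt
  contMDiffOn_invFun := fun _ hx => (contMDiffAt_real_of_complex
    ((contMDiffOn_symm_of_mem_maximalAtlas (θ.chart_mem i)).contMDiffAt
      ((θ.chart i).open_target.mem_nhds hx))).contMDiffWithinAt

variable {S : Type*} [TopologicalSpace S] [ChartedSpace ℂ S] {p : S → X}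

theorem isLocalDiffeomorphAt_coord (hp : IsLocalDiffeomorph 𝓘(ℝ, ℂ) 𝓘(ℝ, ℂ) ∞ p) {i : ι} {y : S}
    (hy : p y ∈ (θ.chart i).source) :
    IsLocalDiffeomorphAt 𝓘(ℝ, ℂ) 𝓘(ℝ, ℂ) ∞ (fun x => θ.chart i (p x)) y :=
  IsLocalDiffeomorphAt.comp (hf := hp y) (hg := ⟨θ.realChart i, hy, Set.eqOn_refl _ _⟩)

theorem contMDiffAt_coord (hp : IsLocalDiffeomorph 𝓘(ℝ, ℂ) 𝓘(ℝ, ℂ) ∞ p) {i : ι} {y : S}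
    (hy : p y ∈ (θ.chart i).source) :
    ContMDiffAt 𝓘(ℝ, ℂ) 𝓘(ℝ, ℂ) ∞ (fun x => θ.chart i (p x)) y :=
  (θ.isLocalDiffeomorphAt_coord hp hy).contMDiffAt

theorem mdifferentiableAt_coord (hp : IsLocalDiffeomorph 𝓘(ℝ, ℂ) 𝓘(ℝ, ℂ) ∞ p) {i : ι} {y : S}
    (hy : p y ∈ (θ.chart i).source) :
    MDifferentiableAt 𝓘(ℝ, ℂ) 𝓘(ℝ, ℂ) (fun x => θ.chart i (p x)) y :=
  (θ.contMDiffAt_coord hp hy).mdifferentiableAt (by simp)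

theorem isInvertible_mfderiv_coord (hp : IsLocalDiffeomorph 𝓘(ℝ, ℂ) 𝓘(ℝ, ℂ) ∞ p) {i : ι} {y : S}
    (hy : p y ∈ (θ.chart i).source) :
    (mfderiv 𝓘(ℝ, ℂ) 𝓘(ℝ, ℂ) (fun x => θ.chart i (p x)) y).IsInvertible :=
  ⟨(θ.isLocalDiffeomorphAt_coord hp hy).mfderivToContinuousLinearEquiv (by simp), rfl⟩

theorem dz_bijective (hp : IsLocalDiffeomorph 𝓘(ℝ, ℂ) 𝓘(ℝ, ℂ) ∞ p) {i : ι} {y : S}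
    (hy : p y ∈ (θ.chart i).source) : Function.Bijective (dz θ p i y) :=
  ((θ.isLocalDiffeomorphAt_coord hp hy).mfderivToContinuousLinearEquiv (by simp)).bijective

theorem dz_add (i : ι) (y : S) (u v : TangentSpace 𝓘(ℝ, ℂ) y) :
    dz θ p i y (u + v) = dz θ p i y u + dz θ p i y v :=
  map_add (mfderiv 𝓘(ℝ, ℂ) 𝓘(ℝ, ℂ) (fun x => θ.chart i (p x)) y) u v

theorem dz_smul (i : ι) (y : S) (c : ℝ) (v : TangentSpace 𝓘(ℝ, ℂ) y) :
    dz θ p i y (c • v) = c * dz θ p i y v :=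
  map_smul (mfderiv 𝓘(ℝ, ℂ) 𝓘(ℝ, ℂ) (fun x => θ.chart i (p x)) y) c v

/-- The transformation rule of the canonical bundle. -/
theorem dz_trans (hp : IsLocalDiffeomorph 𝓘(ℝ, ℂ) 𝓘(ℝ, ℂ) ∞ p) {i j : ι} {y : S}
    (hi : p y ∈ (θ.chart i).source) (hj : p y ∈ (θ.chart j).source)
    (v : TangentSpace 𝓘(ℝ, ℂ) y) :
    dz θ p j y v = θ.trans i j (p y) ^ 2 * dz θ p i y v := by
  have hτ := (θ.differentiableAt_coordChange hi hj)
  have h1 := HasDirDeriv.comp_fderiv (v := v)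
    (φ := fun z => θ.chart j ((θ.chart i).symm z)) (hτ.restrictScalars ℝ)
    (θ.mdifferentiableAt_coord hp hi)
  have hev : ∀ᶠ x in 𝓝 y, p x ∈ (θ.chart i).source :=
    (hp y).contMDiffAt.continuousAt ((θ.chart i).open_source.mem_nhds hi)
  have h2 : HasDirDeriv (fun x => θ.chart j (p x)) y v _ := h1.congr <| by
    filter_upwards [hev] with x hx
    rw [(θ.chart i).left_inv hx]
  have h3 : HasDirDeriv (fun x => θ.chart j (p x)) y v (dz θ p j y v) :=
    hasDirDeriv_of_mdifferentiableAt (θ.mdifferentiableAt_coord hp hj)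
  rw [h3.unique h2, θ.trans_sq i j _ hi hj]
  have h4 : fderiv ℝ (fun z => θ.chart j ((θ.chart i).symm z)) (θ.chart i (p y)) =
      (fderiv ℂ (fun z => θ.chart j ((θ.chart i).symm z)) (θ.chart i (p y))).restrictScalars ℝ :=
    hτ.fderiv_restrictScalars ℝ
  rw [h4]
  change fderiv ℂ (fun z => θ.chart j ((θ.chart i).symm z)) (θ.chart i (p y)) (dz θ p i y v) = _
  exact fderiv_eq_deriv_mul

theorem eventually_mem_source (hp : IsLocalDiffeomorph 𝓘(ℝ, ℂ) 𝓘(ℝ, ℂ) ∞ p) {i : ι} {y : S}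
    (hi : p y ∈ (θ.chart i).source) : ∀ᶠ x in 𝓝 y, p x ∈ (θ.chart i).source :=
  (hp y).contMDiffAt.continuousAt ((θ.chart i).open_source.mem_nhds hi)

end SqrtCanonical

end Charts

/-! ### The strong maximum principle in the plane -/

section MaximumPrinciple

/-- The Laplacian of a function on the complex plane. -/
def lap (u : ℂ → ℝ) (z : ℂ) : ℝ :=
  fderiv ℝ (fun w => fderiv ℝ u w 1) z 1 + fderiv ℝ (fun w => fderiv ℝ u w Complex.I) z Complex.I

/-- If the second derivative were positive, the second derivative test would make the point a local
minimum as well, so the function would be locally constant and its second derivative zero. -/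
theorem IsLocalMax.deriv_deriv_nonpos {f : ℝ → ℝ} {x : ℝ} (h : IsLocalMax f x)
    (hc : ContinuousAt f x) : deriv (deriv f) x ≤ 0 := by
  by_contra! h'
  have hmin := isLocalMin_of_deriv_deriv_pos h' h.deriv_eq_zero hc
  have heq : f =ᶠ[𝓝 x] fun _ => f x := by
    filter_upwards [h, hmin] with y h1 h2 using le_antisymm h1 h2
  have h0 : deriv (deriv f) x = 0 := by
    rw [heq.deriv.deriv_eq]; simp
  linarith

theorem deriv_deriv_line {u : ℂ → ℝ} {z : ℂ} (hu : ContDiffAt ℝ 2 u z) (e : ℂ) :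
    deriv (deriv fun t : ℝ => u (z + t * e)) 0 = fderiv ℝ (fun w => fderiv ℝ u w e) z e := by
  have hline : ∀ t : ℝ, HasDerivAt (fun t : ℝ => z + t * e) e t := fun t => by
    simpa using ((Complex.ofRealCLM.hasDerivAt (x := t)).mul_const e).const_add z
  have hev : ∀ᶠ w in 𝓝 z, DifferentiableAt ℝ u w := by
    filter_upwards [hu.eventually (by simp)] with w hw using hw.differentiableAt (by simp)
  have htend : Filter.Tendsto (fun t : ℝ => z + t * e) (𝓝 0) (𝓝 z) := by
    simpa using (hline 0).continuousAt.tendsto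
  have h1 : (deriv fun t : ℝ => u (z + t * e)) =ᶠ[𝓝 0] fun t => fderiv ℝ u (z + t * e) e := by
    filter_upwards [htend.eventually hev] with t ht
    exact (ht.hasFDerivAt.comp_hasDerivAt t (hline t)).deriv
  rw [h1.deriv_eq]
  have h2 : DifferentiableAt ℝ (fun w => fderiv ℝ u w e) (z + ((0 : ℝ) : ℂ) * e) := by
    have : DifferentiableAt ℝ (fderiv ℝ u) z :=
      (hu.fderiv_right (m := 1) (by norm_num)).differentiableAt (by simp)
    simpa using this.clm_apply (differentiableAt_const e)
  have h3 := (h2.hasFDerivAt.comp_hasDerivAt (0 : ℝ) (hline 0)).deriv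
  simpa [Function.comp_def] using h3

/-- The sum of the second derivatives along the axes of a quadratic perturbation is not
positive at a local maximum. -/
theorem lap_add_quadratic_nonpos {u : ℂ → ℝ} {z : ℂ} (hu : ContDiffAt ℝ 2 u z) {v : ℂ → ℝ}
    (hv : ContDiffAt ℝ 2 v z) (h : IsLocalMax (fun w => u w + v w) z) :
    lap u z + lap v z ≤ 0 := by
  have key : ∀ e : ℂ, fderiv ℝ (fun w => fderiv ℝ u w e) z e
      + fderiv ℝ (fun w => fderiv ℝ v w e) z e ≤ 0 := by
    intro e
    have hsum : ContDiffAt ℝ 2 (fun w => u w + v w) z := hu.add hv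
    have hcont : ContinuousAt (fun t : ℝ => z + t * e) 0 := by fun_prop
    have hmax : IsLocalMax (fun t : ℝ => u (z + t * e) + v (z + t * e)) 0 := by
      have ht : Filter.Tendsto (fun t : ℝ => z + t * e) (𝓝 0) (𝓝 z) := by
        simpa using hcont.tendsto
      filter_upwards [ht.eventually h] with t ht
      simpa using ht
    have hc : ContinuousAt (fun t : ℝ => u (z + t * e) + v (z + t * e)) 0 := by
      have : ContinuousAt (fun w => u w + v w) (z + ((0 : ℝ) : ℂ) * e) := by
        simpa using hsum.continuousAt
      exact ContinuousAt.comp (f := fun t : ℝ => z + t * e) this hcont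
    have h0 := IsLocalMax.deriv_deriv_nonpos hmax hc
    rw [deriv_deriv_line hsum e] at h0
    have hev : (fun w => fderiv ℝ (fun w => u w + v w) w e) =ᶠ[𝓝 z]
        fun w => fderiv ℝ u w e + fderiv ℝ v w e := by
      filter_upwards [hu.eventually (by simp), hv.eventually (by simp)] with w h1 h2
      rw [fderiv_fun_add (h1.differentiableAt (by simp)) (h2.differentiableAt (by simp))]
      rfl
    have hd : ∀ {f : ℂ → ℝ}, ContDiffAt ℝ 2 f z →
        DifferentiableAt ℝ (fun w => fderiv ℝ f w e) z := fun hf =>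
      ((hf.fderiv_right (m := 1) (by norm_num)).differentiableAt (by simp)).clm_apply
        (differentiableAt_const e)
    rw [hev.fderiv_eq, fderiv_fun_add (hd hu) (hd hv)] at h0
    exact h0
  have h1 := key 1
  have h2 := key Complex.I
  unfold lap
  linarith

/-- A quadratic polynomial in the coordinates of the frame at `x₀` whose first vector
is `(p, q)`. -/
def barrier (x₀ : ℂ) (p q A B : ℝ) (z : ℂ) : ℝ :=
  (p * (z - x₀).re + q * (z - x₀).im) + A * (p * (z - x₀).re + q * (z - x₀).im) ^ 2
    - B * (p * (z - x₀).im - q * (z - x₀).re) ^ 2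

theorem contDiff_barrier (x₀ : ℂ) (p q A B : ℝ) : ContDiff ℝ 2 (barrier x₀ p q A B) := by
  have h1 : ContDiff ℝ 2 fun z : ℂ => (z - x₀).re :=
    Complex.reCLM.contDiff.comp (contDiff_id.sub contDiff_const)
  have h2 : ContDiff ℝ 2 fun z : ℂ => (z - x₀).im :=
    Complex.imCLM.contDiff.comp (contDiff_id.sub contDiff_const)
  unfold barrier
  fun_prop

theorem deriv_deriv_quadratic (a b c : ℝ) :
    deriv (deriv fun t : ℝ => a + b * t + c * t ^ 2) 0 = 2 * c := by
  have h1 : (deriv fun t : ℝ => a + b * t + c * t ^ 2) = fun t => b + 2 * c * t := by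
    ext t
    have : HasDerivAt (fun t : ℝ => a + b * t + c * t ^ 2) (b + 2 * c * t) t := by
      have h := ((hasDerivAt_id t).const_mul b).const_add a |>.add
        (((hasDerivAt_id t).pow 2).const_mul c)
      refine h.congr_deriv ?_
      simp; ring
    exact this.deriv
  rw [h1]
  have : HasDerivAt (fun t : ℝ => b + 2 * c * t) (2 * c) 0 := by
    simpa using ((hasDerivAt_id (0 : ℝ)).const_mul (2 * c)).const_add b
  exact this.deriv

theorem lap_const_mul_barrier (x₀ : ℂ) (p q A B ε : ℝ) (z : ℂ) :
    lap (fun w => ε * barrier x₀ p q A B w) z = 2 * ε * (A - B) * (p ^ 2 + q ^ 2) := by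
  have hc : ContDiffAt ℝ 2 (fun w => ε * barrier x₀ p q A B w) z :=
    (contDiff_const.mul (contDiff_barrier x₀ p q A B)).contDiffAt
  unfold lap
  rw [← deriv_deriv_line hc, ← deriv_deriv_line hc]
  set x := (z - x₀).re
  set y := (z - x₀).im
  have h1 : (fun t : ℝ => ε * barrier x₀ p q A B (z + t * 1)) = fun t =>
      ε * ((p * x + q * y) + A * (p * x + q * y) ^ 2 - B * (p * y - q * x) ^ 2)
      + ε * (p + 2 * A * p * (p * x + q * y) + 2 * B * q * (p * y - q * x)) * t
      + ε * (A * p ^ 2 - B * q ^ 2) * t ^ 2 := by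
    ext t
    have e1 : (z + t * 1 - x₀).re = x + t := by simp [x]; ring
    have e2 : (z + t * 1 - x₀).im = y := by simp [y]
    unfold barrier
    rw [e1, e2]; ring
  have h2 : (fun t : ℝ => ε * barrier x₀ p q A B (z + t * Complex.I)) = fun t =>
      ε * ((p * x + q * y) + A * (p * x + q * y) ^ 2 - B * (p * y - q * x) ^ 2)
      + ε * (q + 2 * A * q * (p * x + q * y) - 2 * B * p * (p * y - q * x)) * t
      + ε * (A * q ^ 2 - B * p ^ 2) * t ^ 2 := by
    ext t
    have e1 : (z + t * Complex.I - x₀).re = x := by simp [x]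
    have e2 : (z + t * Complex.I - x₀).im = y + t := by simp [y]; ring
    unfold barrier
    rw [e1, e2]; ring
  rw [h1, h2, deriv_deriv_quadratic, deriv_deriv_quadratic]
  ring

/-- Hopf's lemma: a subharmonic function cannot have a local maximum at a boundary point of a disk
inside which it is smaller. -/
theorem hopf_disk {u : ℂ → ℝ} {x₀ z₁ : ℂ} {r₀ : ℝ} (hr₀ : 0 < r₀) (hne : z₁ ≠ x₀)
    (hu : ∀ z ∈ Metric.ball x₀ r₀, ContDiffAt ℝ 2 u z)
    (hlap : ∀ z ∈ Metric.ball x₀ r₀, 0 ≤ lap u z)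
    (hle : ∀ z ∈ Metric.ball x₀ r₀, u z ≤ u x₀)
    (hlt : ∀ z ∈ Metric.ball x₀ r₀, dist z z₁ < dist x₀ z₁ → u z < u x₀) : False := by
  set R := dist x₀ z₁ with hR
  have hRpos : 0 < R := dist_pos.2 hne.symm
  set p := (z₁ - x₀).re / R with hp
  set q := (z₁ - x₀).im / R with hq
  have hR2 : (z₁ - x₀).re ^ 2 + (z₁ - x₀).im ^ 2 = R ^ 2 := by
    rw [hR, dist_comm, Complex.dist_eq, ← Complex.normSq_eq_norm_sq, Complex.normSq_apply]; ring
  have hpq : p ^ 2 + q ^ 2 = 1 := by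
    rw [hp, hq, div_pow, div_pow, ← add_div, hR2]; field_simp
  have hpR : (z₁ - x₀).re = R * p := by rw [hp]; field_simp
  have hqR : (z₁ - x₀).im = R * q := by rw [hq]; field_simp
  -- The inequality 4/R > 3/R makes the barrier strictly subharmonic. The coefficient 3/R > 1/(2R)
  -- bends {v ≥ 0} more sharply than the circle about z₁ through x₀, so near x₀, apart from x₀
  -- itself, this set lies inside the disk.
  set v := barrier x₀ p q (4 / R) (3 / R) with hv
  set ρ := min (r₀ / 2) (R / 8) with hρ
  have hρpos : 0 < ρ := by positivity
  have hρr : ρ < r₀ := lt_of_le_of_lt (min_le_left _ _) (by linarith)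
  have hρR : ρ ≤ R / 8 := min_le_right _ _
  have hsub : Metric.closedBall x₀ ρ ⊆ Metric.ball x₀ r₀ := Metric.closedBall_subset_ball hρr
  have hvneg : ∀ z ∈ Metric.sphere x₀ ρ, 0 ≤ v z → dist z z₁ < R := by
    intro z hz hvz
    by_contra! hfar
    set l := p * (z - x₀).re + q * (z - x₀).im with hl
    set m := p * (z - x₀).im - q * (z - x₀).re with hm
    have hlm : l ^ 2 + m ^ 2 = ρ ^ 2 := by
      have : (z - x₀).re ^ 2 + (z - x₀).im ^ 2 = ρ ^ 2 := by
        rw [← Metric.mem_sphere.1 hz, Complex.dist_eq, ← Complex.normSq_eq_norm_sq,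
          Complex.normSq_apply]; ring
      calc l ^ 2 + m ^ 2 = (p ^ 2 + q ^ 2) * ((z - x₀).re ^ 2 + (z - x₀).im ^ 2) := by
            rw [hl, hm]; ring
        _ = ρ ^ 2 := by rw [hpq, this, one_mul]
    have hfar' : R ^ 2 ≤ (l - R) ^ 2 + m ^ 2 := by
      have h1 : dist z z₁ ^ 2 = (l - R) ^ 2 + m ^ 2 := by
        rw [Complex.dist_eq, ← Complex.normSq_eq_norm_sq, Complex.normSq_apply]
        have e1 : (z - z₁).re = (z - x₀).re - R * p := by rw [← hpR]; simp
        have e2 : (z - z₁).im = (z - x₀).im - R * q := by rw [← hqR]; simp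
        rw [e1, e2, hl, hm]
        linear_combination (R ^ 2 - ((z - x₀).re ^ 2 + (z - x₀).im ^ 2)) * hpq
      rw [← h1]
      exact pow_le_pow_left₀ hRpos.le hfar 2
    have hlρ : |l| ≤ ρ := abs_le_of_sq_le_sq (by nlinarith [sq_nonneg m]) hρpos.le
    have hvz' : 0 ≤ R * l + 4 * l ^ 2 - 3 * m ^ 2 := by
      have : R * v z = R * l + 4 * l ^ 2 - 3 * m ^ 2 := by
        rw [hv]; unfold barrier; rw [← hl, ← hm]; field_simp
      rw [← this]; positivity
    obtain ⟨h1, h2⟩ := abs_le.1 hlρ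
    -- If l ≤ 0, then ρ ≤ R/8 makes R l + 4 l² nonpositive, with equality only at l = 0. If l > 0,
    -- being outside the disk bounds l by ρ²/(2R), so m² is close to ρ² and −3m² dominates.
    rcases le_or_gt l 0 with h | h
    · nlinarith [sq_nonneg m, sq_nonneg l, mul_pos hρpos hρpos]
    · nlinarith [mul_pos hRpos h]
  -- the values of `u` on the part of the small circle where the barrier is nonnegative
  have hucont : ContinuousOn u (Metric.closedBall x₀ ρ) := fun z hz =>
    (hu z (hsub hz)).continuousAt.continuousWithinAt
  have hvcont : Continuous v := (contDiff_barrier _ _ _ _ _).continuous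
  have hK : IsCompact (Metric.sphere x₀ ρ ∩ {z | 0 ≤ v z}) :=
    (isCompact_sphere x₀ ρ).inter_right (isClosed_le continuous_const hvcont)
  obtain ⟨δ, hδ, hδu⟩ : ∃ δ > 0, ∀ z ∈ Metric.sphere x₀ ρ ∩ {z | 0 ≤ v z}, u z + δ ≤ u x₀ := by
    rcases (Metric.sphere x₀ ρ ∩ {z | 0 ≤ v z}).eq_empty_or_nonempty with h | h
    · exact ⟨1, one_pos, by simp [h]⟩
    · obtain ⟨z, hz, hmax⟩ := hK.exists_isMaxOn h
        (hucont.mono (Set.inter_subset_left.trans Metric.sphere_subset_closedBall))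
      have := hlt z (hsub (Metric.sphere_subset_closedBall hz.1)) (hvneg z hz.1 hz.2)
      exact ⟨u x₀ - u z, by linarith, fun w hw => by linarith [isMaxOn_iff.1 hmax w hw]⟩
  obtain ⟨C, hC⟩ := (isCompact_sphere x₀ ρ).exists_bound_of_continuousOn hvcont.continuousOn
  -- With this ε the perturbation ε v is at most δ/2 on the circle, less than the gap δ available
  -- where v ≥ 0; where v < 0 no gap is needed.
  set ε := δ / (2 * (|C| + 1)) with hε
  have hεpos : 0 < ε := by positivity
  have hbd : ∀ z ∈ Metric.sphere x₀ ρ, u z + ε * v z < u x₀ := by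
    intro z hz
    have hz' := hsub (Metric.sphere_subset_closedBall hz)
    rcases lt_or_ge (v z) 0 with h | h
    · nlinarith [hle z hz', mul_neg_of_pos_of_neg hεpos h]
    · have h1 := hδu z ⟨hz, h⟩
      have h2 : v z ≤ |C| + 1 := by
        have := hC z hz
        rw [Real.norm_eq_abs] at this
        linarith [le_abs_self (v z), le_abs_self C]
      have h3 : ε * v z ≤ δ / 2 := by
        calc ε * v z ≤ ε * (|C| + 1) := by gcongr
          _ = δ / 2 := by rw [hε]; field_simp
      linarith
  have hv0 : v x₀ = 0 := by simp [hv, barrier]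
  -- The perturbed function equals u x₀ at the centre and is smaller on the circle, so its maximum
  -- is interior; but its Laplacian is positive everywhere in the disk.
  obtain ⟨z, hz, hmax⟩ := (isCompact_closedBall x₀ ρ).exists_isMaxOn
    (f := fun z => u z + ε * v z) ⟨x₀, Metric.mem_closedBall_self hρpos.le⟩
    (hucont.add (hvcont.continuousOn.const_smul ε))
  have hzx : u x₀ ≤ u z + ε * v z := by
    have := isMaxOn_iff.1 hmax x₀ (Metric.mem_closedBall_self hρpos.le)
    simpa [hv0] using this
  have hzball : z ∈ Metric.ball x₀ ρ := by
    rcases (Metric.mem_closedBall.1 hz).lt_or_eq with h | h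
    · exact h
    · exact absurd (hbd z h) (not_lt.2 hzx)
  have hlocal : IsLocalMax (fun w => u w + ε * v w) z :=
    hmax.isLocalMax (Filter.mem_of_superset (Metric.isOpen_ball.mem_nhds hzball)
      Metric.ball_subset_closedBall)
  have h := lap_add_quadratic_nonpos (hu z (hsub hz))
    (v := fun w => ε * v w)
    (contDiff_const.mul (contDiff_barrier _ _ _ _ _)).contDiffAt hlocal
  rw [hv, lap_const_mul_barrier, hpq] at h
  have := hlap z (hsub hz)
  have h4 : 0 < 2 * ε * (4 / R - 3 / R) * 1 := by
    have : 4 / R - 3 / R = 1 / R := by ring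
    rw [this]; positivity
  linarith

/-- The strong maximum principle for subharmonic functions, on a disk. -/
theorem eq_of_lap_nonneg_of_le {u : ℂ → ℝ} {c : ℂ} {r : ℝ}
    (hu : ∀ z ∈ Metric.ball c r, ContDiffAt ℝ 2 u z)
    (hlap : ∀ z ∈ Metric.ball c r, 0 ≤ lap u z)
    (hle : ∀ z ∈ Metric.ball c r, u z ≤ u c) {z₁ : ℂ} (hz₁ : z₁ ∈ Metric.ball c (r / 2)) :
    u z₁ = u c := by
  by_contra hne
  have hz₁' := Metric.mem_ball.1 hz₁
  have hr : 0 < r := by linarith [dist_nonneg (x := z₁) (y := c)]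
  -- The radius r / 2 in the hypothesis on z₁ is what keeps this disk inside the domain of u.
  have hsub : Metric.closedBall z₁ (dist z₁ c) ⊆ Metric.ball c r := by
    intro z hz
    have := dist_triangle z z₁ c
    have := Metric.mem_closedBall.1 hz
    exact Metric.mem_ball.2 (by linarith)
  have hlt₁ : u z₁ < u c := lt_of_le_of_ne (hle z₁ (hsub (Metric.mem_closedBall_self
    dist_nonneg))) hne
  have hcont : ContinuousOn u (Metric.closedBall z₁ (dist z₁ c)) := fun z hz =>
    (hu z (hsub hz)).continuousAt.continuousWithinAt
  have hF : IsCompact (Metric.closedBall z₁ (dist z₁ c) ∩ u ⁻¹' {u c}) :=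
    (isCompact_closedBall _ _).of_isClosed_subset
      (hcont.preimage_isClosed_of_isClosed Metric.isClosed_closedBall isClosed_singleton)
      Set.inter_subset_left
  -- Take a point of the maximal level set nearest to z₁: the open disk about z₁ that reaches it
  -- contains no other point of that set, which is the situation of Hopf's lemma.
  obtain ⟨x₀, ⟨hx₀, hx₀c⟩, hmin⟩ := hF.exists_isMinOn
    ⟨c, by simp [dist_comm], rfl⟩ (f := fun z => dist z z₁) (by fun_prop)
  have hx₀c : u x₀ = u c := hx₀c
  obtain ⟨r₀, hr₀, hr₀s⟩ := Metric.isOpen_iff.1 Metric.isOpen_ball x₀ (hsub hx₀)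
  refine hopf_disk (u := u) (x₀ := x₀) (z₁ := z₁) hr₀ ?_ (fun z hz => hu z (hr₀s hz))
    (fun z hz => hlap z (hr₀s hz)) (fun z hz => hx₀c ▸ hle z (hr₀s hz)) ?_
  · rintro rfl; exact hne hx₀c
  · intro z hz hd
    rw [hx₀c]
    refine lt_of_le_of_ne (hle z (hr₀s hz)) fun heq => ?_
    have hzm : z ∈ Metric.closedBall z₁ (dist z₁ c) :=
      Metric.mem_closedBall.2 (hd.le.trans (Metric.mem_closedBall.1 hx₀))
    exact absurd hd (not_lt.2 (isMinOn_iff.1 hmin z ⟨hzm, heq⟩))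

/-- A function on a compact connected surface which is subharmonic in charts is constant. -/
theorem eq_of_lap_nonneg {X : Type*} [TopologicalSpace X] [CompactSpace X] [ConnectedSpace X]
    {u : X → ℝ}
    (h : ∀ x, ∃ φ : OpenPartialHomeomorph X ℂ, x ∈ φ.source ∧
      ContDiffOn ℝ 2 (fun z => u (φ.symm z)) φ.target ∧
      ∀ z ∈ φ.target, 0 ≤ lap (fun z => u (φ.symm z)) z) (x y : X) : u x = u y := by
  have hcont : Continuous u := by
    refine continuous_iff_continuousAt.2 fun x => ?_
    obtain ⟨φ, hx, hφ, -⟩ := h x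
    have h1 : ContinuousAt (fun z => u (φ.symm z)) (φ x) :=
      hφ.continuousOn.continuousAt (φ.open_target.mem_nhds (φ.map_source hx))
    refine (h1.comp (φ.continuousAt hx)).congr ?_
    filter_upwards [φ.open_source.mem_nhds hx] with w hw
    simp [φ.left_inv hw]
  obtain ⟨m, -, hm⟩ := isCompact_univ.exists_isMaxOn Set.univ_nonempty hcont.continuousOn
  have hm : ∀ x, u x ≤ u m := fun x => isMaxOn_iff.1 hm x trivial
  have hclopen : IsClopen (u ⁻¹' {u m}) := by
    refine ⟨isClosed_singleton.preimage hcont, isOpen_iff_mem_nhds.2 fun x hx => ?_⟩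
    have hx : u x = u m := hx
    obtain ⟨φ, hxs, hφ, hlap⟩ := h x
    obtain ⟨r, hr, hrs⟩ := Metric.isOpen_iff.1 φ.open_target (φ x) (φ.map_source hxs)
    have hball : φ ⁻¹' Metric.ball (φ x) (r / 2) ∈ 𝓝 x :=
      φ.continuousAt hxs (Metric.ball_mem_nhds _ (by positivity))
    filter_upwards [hball, φ.open_source.mem_nhds hxs] with w hw hws
    have := eq_of_lap_nonneg_of_le (u := fun z => u (φ.symm z)) (c := φ x) (r := r)
      (fun z hz => hφ.contDiffAt (φ.open_target.mem_nhds (hrs hz)))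
      (fun z hz => hlap z (hrs hz))
      (fun z _ => by rw [φ.left_inv hxs, hx]; exact hm _) hw
    simp only [φ.left_inv hxs, φ.left_inv hws] at this
    exact this.trans hx
  have huniv : u ⁻¹' {u m} = Set.univ := hclopen.eq_univ ⟨m, rfl⟩
  have h' : ∀ x, u x = u m := fun x => by
    have : x ∈ u ⁻¹' {u m} := huniv ▸ trivial
    exact this
  rw [h' x, h' y]

end MaximumPrinciple

/-! ### Vanishing of sections of negative degree -/

namespace SqrtCanonical

section Vanishing

variable {ι X : Type*} [TopologicalSpace X] [ChartedSpace ℂ X] (θ : SqrtCanonical ι X)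

variable {θ} in
theorem sections_eq_zero_iff {k : ℤ} {b : ι → X → ℂ} (hb : b ∈ θ.sections k) {i : ι} {x : X}
    (hi : x ∈ (θ.chart i).source) : (∀ j, b j x = 0) ↔ b i x = 0 := by
  refine ⟨fun h => h i, fun h j => ?_⟩
  by_cases hj : x ∈ (θ.chart j).source
  · rw [hb.2.1 j i x hj hi, h, mul_zero]
  · exact hb.2.2 j x hj

/-- The identity theorem for holomorphic sections of powers of `K^{1/2}`. -/
theorem sections_identity [ConnectedSpace X] {k : ℤ} {b : ι → X → ℂ} (hb : b ∈ θ.sections k)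
    {x₀ : X} (h0 : ∀ᶠ y in 𝓝 x₀, ∀ j, b j y = 0) : b = 0 := by
  set V : Set X := {x | ∀ᶠ y in 𝓝 x, ∀ j, b j y = 0} with hV
  have hopen : IsOpen V := isOpen_iff_mem_nhds.2 fun x hx => eventually_eventually_nhds.2 hx
  have hclosed : IsClosed V := by
    refine isClosed_of_closure_subset fun x hx => ?_
    set i := θ.idx x
    set φ := θ.chart i
    have hxs : x ∈ φ.source := θ.mem_source x
    obtain ⟨r, hr, hrs⟩ := Metric.isOpen_iff.1 φ.open_target (φ x) (φ.map_source hxs)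
    set g : ℂ → ℂ := fun z => b i (φ.symm z)
    have hg : AnalyticOnNhd ℂ g (Metric.ball (φ x) r) :=
      ((hb.1 i).mono hrs).analyticOnNhd Metric.isOpen_ball
    have hnhd : φ.source ∩ φ ⁻¹' Metric.ball (φ x) r ∈ 𝓝 x :=
      Filter.inter_mem (φ.open_source.mem_nhds hxs)
        (φ.continuousAt hxs (Metric.ball_mem_nhds _ hr))
    -- One point of V in the coordinate ball is enough: analyticity spreads the vanishing near it to
    -- the whole ball, hence to a neighbourhood of the limit point `x`.
    obtain ⟨x', ⟨hx's, hx'b⟩, hx'V⟩ := mem_closure_iff_nhds.1 hx _ hnhd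
    have hloc : g =ᶠ[𝓝 (φ x')] 0 := by
      have htend : Filter.Tendsto φ.symm (𝓝 (φ x')) (𝓝 x') := by
        have h := (φ.continuousAt_symm (φ.map_source hx's)).tendsto
        rwa [φ.left_inv hx's] at h
      filter_upwards [htend.eventually hx'V] with z hz using hz i
    have hzero := hg.eqOn_zero_of_preconnected_of_eventuallyEq_zero
      (convex_ball _ _).isPreconnected hx'b hloc
    change ∀ᶠ y in 𝓝 x, ∀ j, b j y = 0
    filter_upwards [hnhd] with y hy
    refine (sections_eq_zero_iff hb hy.1).2 ?_
    have := hzero hy.2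
    simpa [g, φ.left_inv hy.1] using this
  have huniv : V = Set.univ := IsClopen.eq_univ ⟨hclosed, hopen⟩ ⟨x₀, h0⟩
  funext j x
  have hx : x ∈ V := huniv ▸ trivial
  exact hx.self_of_nhds j

variable [IsManifold 𝓘(ℂ) ω X] [CompactSpace X] [ConnectedSpace X]

/-- The pairing of a section of `K⁻¹` with a one-form is constant. -/
theorem pairing_const {b f : ι → X → ℂ} (hb : b ∈ θ.sections (-2)) (hf : f ∈ θ.sections 2)
    {i j : ι} {x y : X} (hx : x ∈ (θ.chart i).source) (hy : y ∈ (θ.chart j).source) :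
    b i x * f i x = b j y * f j y := by
  have key : ∀ i j x, x ∈ (θ.chart i).source → x ∈ (θ.chart j).source →
      b i x * f i x = b j x * f j x := by
    intro i j x hi hj
    have := θ.trans_ne_zero hi hj
    rw [hb.2.1 i j x hi hj, hf.2.1 i j x hi hj]
    have h2 : θ.trans i j x ^ (-2 : ℤ) * θ.trans i j x ^ (2 : ℤ) = 1 := by
      rw [← zpow_add₀ this]; simp
    linear_combination (b j x * f j x) * h2
  set F : X → ℂ := fun x => b (θ.idx x) x * f (θ.idx x) x with hF
  have hFd : MDifferentiable 𝓘(ℂ) 𝓘(ℂ) F := by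
    intro x
    set i := θ.idx x
    have hxs : x ∈ (θ.chart i).source := θ.mem_source x
    have h1 : DifferentiableAt ℂ
        (fun z => b i ((θ.chart i).symm z) * f i ((θ.chart i).symm z)) (θ.chart i x) :=
      ((hb.1 i).mul (hf.1 i)).differentiableAt
        ((θ.chart i).open_target.mem_nhds ((θ.chart i).map_source hxs))
    have h2 : MDifferentiableAt 𝓘(ℂ) 𝓘(ℂ) (θ.chart i) x :=
      ((contMDiffOn_of_mem_maximalAtlas (θ.chart_mem i)).contMDiffAt
        ((θ.chart i).open_source.mem_nhds hxs)).mdifferentiableAt (by simp)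
    refine (h1.mdifferentiableAt.comp x h2).congr_of_eventuallyEq ?_
    filter_upwards [(θ.chart i).open_source.mem_nhds hxs] with w hw
    simp only [hF, Function.comp_apply, (θ.chart i).left_inv hw]
    exact key _ _ _ (θ.mem_source w) hw
  have hconst := hFd.apply_eq_of_compactSpace x y
  rw [key i _ x hx (θ.mem_source x), key j _ y hy (θ.mem_source y)]
  exact hconst

/-- A surface of genus at least two has no holomorphic vector fields. -/
theorem sections_neg_two_eq_zero (hgenus : 2 ≤ θ.genus) {b : ι → X → ℂ}
    (hb : b ∈ θ.sections (-2)) : b = 0 := by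
  obtain ⟨x₀⟩ := (inferInstance : Nonempty X)
  -- By `pairing_const`, L f is the constant value of b f. A linear functional on a space of
  -- dimension at least two has a nonzero kernel, so some nonzero one-form f satisfies b f = 0
  -- everywhere.
  let L : θ.sections 2 →ₗ[ℂ] ℂ :=
    { toFun := fun f => b (θ.idx x₀) x₀ * f.1 (θ.idx x₀) x₀
      map_add' := fun f g => by simp [mul_add]
      map_smul' := fun c f => by simp; ring }
  have hg : 2 ≤ Module.finrank ℂ (θ.sections 2) := hgenus
  -- The value of `finrank` is 0 in infinite dimension, so the genus bound also gives finiteness.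
  have : Module.Finite ℂ (θ.sections 2) := Module.finite_of_finrank_pos (by omega)
  have hker : LinearMap.ker L ≠ ⊥ :=
    LinearMap.ker_ne_bot_of_finrank_lt (by rw [Module.finrank_self]; omega)
  obtain ⟨f, hfL, hf0⟩ := Submodule.exists_mem_ne_zero_of_ne_bot hker
  have hprod : ∀ i x, x ∈ (θ.chart i).source → b i x * f.1 i x = 0 := fun i x hx => by
    rw [θ.pairing_const hb f.2 hx (θ.mem_source x₀)]
    exact hfL
  obtain ⟨i, x, hix⟩ : ∃ i x, f.1 i x ≠ 0 := by
    by_contra! h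
    exact hf0 (Subtype.ext (funext fun i => funext fun x => h i x))
  have hxs : x ∈ (θ.chart i).source := by
    by_contra h
    exact hix (f.2.2.2 i x h)
  refine θ.sections_identity hb (x₀ := x) ?_
  have hcont : ContinuousAt (fun y => f.1 i y) x := by
    have h1 : ContinuousAt (fun z => f.1 i ((θ.chart i).symm z)) (θ.chart i x) :=
      ((f.2.1 i).differentiableAt ((θ.chart i).open_target.mem_nhds
        ((θ.chart i).map_source hxs))).continuousAt
    refine (h1.comp ((θ.chart i).continuousAt hxs)).congr ?_
    filter_upwards [(θ.chart i).open_source.mem_nhds hxs] with w hw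
    simp [(θ.chart i).left_inv hw]
  filter_upwards [hcont.eventually_ne hix, (θ.chart i).open_source.mem_nhds hxs] with y hy hys
  exact (sections_eq_zero_iff hb hys).2 ((mul_eq_zero.1 (hprod i y hys)).resolve_right hy)

/-- The bundle `K^{-1/2}` has no holomorphic sections. -/
theorem sections_neg_one_eq_zero (hgenus : 2 ≤ θ.genus) {b : ι → X → ℂ}
    (hb : b ∈ θ.sections (-1)) : b = 0 := by
  have h2 : (fun i x => b i x * b i x) ∈ θ.sections (-2) := by
    refine ⟨fun i => (hb.1 i).mul (hb.1 i), fun i j x hi hj => ?_, fun i x hx => ?_⟩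
    · have h := θ.trans_ne_zero hi hj
      have h3 : θ.trans i j x ^ (-2 : ℤ) =
          θ.trans i j x ^ (-1 : ℤ) * θ.trans i j x ^ (-1 : ℤ) := by
        rw [← zpow_add₀ h]; rfl
      simp only [hb.2.1 i j x hi hj, h3]
      ring
    · simp [hb.2.2 i x hx]
  have h0 := θ.sections_neg_two_eq_zero hgenus h2
  funext i x
  exact mul_self_eq_zero.1 (congrFun (congrFun h0 i) x)

end Vanishing

end SqrtCanonical

/-! ### Hermitian metrics and the second variation of the trace -/

section Positivity

open scoped MatrixOrder Matrix.Norms.L2Operator in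
theorem exists_eq_conjTranspose_mul_self {𝕜 : Type*} [RCLike 𝕜] {P : Mat 𝕜} (hP : P.PosDef) :
    ∃ B : Mat 𝕜, IsUnit B.det ∧ P = Bᴴ * B := by
  obtain ⟨B, hB⟩ := CStarAlgebra.nonneg_iff_eq_star_mul_self.mp hP.posSemidef.nonneg
  refine ⟨B, ?_, hB⟩
  have h := hP.det_pos.ne'
  rw [hB, Matrix.det_mul] at h
  exact isUnit_iff_ne_zero.2 (right_ne_zero_of_mul h)

/-- The weighted Hilbert–Schmidt norm of `T` is nonnegative, and it vanishes only for `T = 0`. -/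
theorem trace_weighted_nonneg {𝕜 : Type*} [RCLike 𝕜] {P Q : Mat 𝕜} (hP : P.PosDef)
    (hQ : Q.PosDef) (T : Mat 𝕜) : 0 ≤ RCLike.re (T * Q * Tᴴ * P).trace ∧
      (RCLike.re (T * Q * Tᴴ * P).trace = 0 → T = 0) := by
  obtain ⟨B, hB, rfl⟩ := exists_eq_conjTranspose_mul_self hP
  obtain ⟨C, hC, rfl⟩ := exists_eq_conjTranspose_mul_self hQ
  -- With P = BᴴB and Q = CᴴC, the trace is the squared Hilbert–Schmidt norm of B T Cᴴ.
  have h1 : (T * (Cᴴ * C) * Tᴴ * (Bᴴ * B)).trace =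
      ((B * T * Cᴴ) * (B * T * Cᴴ)ᴴ).trace := by
    have : T * (Cᴴ * C) * Tᴴ * (Bᴴ * B) = (T * Cᴴ * C * Tᴴ * Bᴴ) * B := by noncomm_ring
    rw [this, Matrix.trace_mul_comm]
    simp [Matrix.conjTranspose_mul, Matrix.mul_assoc]
  have hpos := (Matrix.posSemidef_self_mul_conjTranspose (B * T * Cᴴ)).trace_nonneg
  rw [h1]
  refine ⟨(RCLike.nonneg_iff.1 hpos).1, fun h => ?_⟩
  have h0 : ((B * T * Cᴴ) * (B * T * Cᴴ)ᴴ).trace = 0 :=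
    RCLike.ext (by simpa using h) (by simpa using (RCLike.nonneg_iff.1 hpos).2)
  rw [Matrix.trace_mul_conjTranspose_self_eq_zero_iff] at h0
  have hC' : IsUnit (Cᴴ).det := by rw [Matrix.det_conjTranspose]; exact hC.star
  calc T = B⁻¹ * (B * T * Cᴴ) * (Cᴴ)⁻¹ := by
        rw [Matrix.mul_assoc B, Matrix.nonsing_inv_mul_cancel_left _ _ hB,
          Matrix.mul_nonsing_inv_cancel_right _ _ hC']
    _ = 0 := by rw [h0]; simp

theorem posDef_isUnit_det {𝕜 : Type*} [RCLike 𝕜] {P : Mat 𝕜} (hP : P.PosDef) : IsUnit P.det :=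
  isUnit_iff_ne_zero.2 hP.det_pos.ne'

end Positivity

/-! ### Comparison of two solutions of Hitchin's equation. -/

section SecondVariation

/-- The connection form `H⁻¹ ∂H` of a metric on a domain of the complex plane. -/
def connForm (H : ℂ → Mat ℂ) (z : ℂ) : Mat ℂ := (H z)⁻¹ * matDZ H z

variable {U : Set ℂ} {H K : ℂ → Mat ℂ} {z : ℂ}

theorem contDiffAt_matDZ {F : ℂ → Mat ℂ} (hF : ∀ a b, ContDiffAt ℝ ∞ (fun w => F w a b) z)
    (a b : Fin 3) : ContDiffAt ℝ ∞ (fun w => matDZ F w a b) z := contDiffAt_dZ (hF a b)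

theorem contDiffAt_connForm (hH : ∀ a b, ContDiffAt ℝ ∞ (fun w => H w a b) z)
    (h : (H z).PosDef) (a b : Fin 3) : ContDiffAt ℝ ∞ (fun w => connForm H w a b) z :=
  contDiffAt_mat_mul (contDiffAt_mat_inv hH h.det_pos.ne') (contDiffAt_matDZ hH) a b

theorem matDZ_eq_mul_connForm (h : (H z).PosDef) : matDZ H z = H z * connForm H z := by
  unfold connForm
  rw [Matrix.mul_nonsing_inv_cancel_left _ _ (posDef_isUnit_det h)]

/-- The endomorphism that compares the metric `K` to `H`. -/
def ratio (H K : ℂ → Mat ℂ) (z : ℂ) : Mat ℂ := (H z)⁻¹ * K z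

/-- The identity behind the uniqueness of harmonic metrics: the Laplacian of the trace of `H⁻¹ K`
is a sum of squares if `H` and `K` are solutions of Hitchin's equation. -/
theorem trace_second_variation (hU : IsOpen U) (hz : z ∈ U)
    (hH : ∀ w ∈ U, ∀ a b, ContDiffAt ℝ ∞ (fun w => H w a b) w)
    (hK : ∀ w ∈ U, ∀ a b, ContDiffAt ℝ ∞ (fun w => K w a b) w)
    (hHpos : ∀ w ∈ U, (H w).PosDef) (hKpos : ∀ w ∈ U, (K w).PosDef) {φ : Mat ℂ}
    (hHeq : matDZbar (connForm H) z = φ * adj (H z) φ - adj (H z) φ * φ)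
    (hKeq : matDZbar (connForm K) z = φ * adj (K z) φ - adj (K z) φ * φ) :
    (matDZbar (matDZ (ratio H K)) z).trace =
      (matDZbar (ratio H K) z * (K z)⁻¹ * (matDZbar (ratio H K) z)ᴴ * H z).trace +
      ((ratio H K z * φ - φ * ratio H K z) * (K z)⁻¹
        * (ratio H K z * φ - φ * ratio H K z)ᴴ * H z).trace := by
  have diff : ∀ {F : ℂ → Mat ℂ} {w : ℂ}, (∀ a b, ContDiffAt ℝ ∞ (fun w => F w a b) w) →
      ∀ a b, DifferentiableAt ℝ (fun w => F w a b) w :=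
    fun h a b => (h a b).differentiableAt (by simp)
  have hs : ∀ w ∈ U, ∀ a b, ContDiffAt ℝ ∞ (fun w => ratio H K w a b) w := fun w hw =>
    contDiffAt_mat_mul (contDiffAt_mat_inv (hH w hw) (hHpos w hw).det_pos.ne') (hK w hw)
  have hHs : ∀ w ∈ U, H w * ratio H K w = K w := fun w hw =>
    Matrix.mul_nonsing_inv_cancel_left _ _ (posDef_isUnit_det (hHpos w hw))
  -- This is the derivative of H s = K, with ∂H and ∂K expressed through the connection forms.
  have hds : ∀ w ∈ U, matDZ (ratio H K) w =
      ratio H K w * connForm K w - connForm H w * ratio H K w := by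
    intro w hw
    have h1 := (matDZ_mul (diff (hH w hw)) (diff (hs w hw))).1
    have h2 : matDZ (fun w => H w * ratio H K w) w = matDZ K w :=
      (matDZ_congr (Filter.mem_of_superset (hU.mem_nhds hw) hHs)).1
    rw [h2, matDZ_eq_mul_connForm (hKpos w hw), matDZ_eq_mul_connForm (hHpos w hw),
      ← hHs w hw, Matrix.mul_assoc, Matrix.mul_assoc, ← Matrix.mul_add] at h1
    have h3 := congrArg (fun A => (H w)⁻¹ * A) h1
    simp only [Matrix.nonsing_inv_mul_cancel_left _ _ (posDef_isUnit_det (hHpos w hw))] at h3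
    rw [h3]; abel
  -- differentiate the formula for `∂s`
  have hA := contDiffAt_connForm (hH z hz) (hHpos z hz)
  have hB := contDiffAt_connForm (hK z hz) (hKpos z hz)
  have hsz := hs z hz
  set s := ratio H K with hsdef
  set A := connForm H with hAdef
  set B := connForm K with hBdef
  have hdds : matDZbar (matDZ s) z =
      matDZbar s z * B z + s z * matDZbar B z - (matDZbar A z * s z + A z * matDZbar s z) := by
    rw [(matDZ_congr (Filter.mem_of_superset (hU.mem_nhds hz) hds)).2]
    refine (HasMatDeriv.matDZ_eq (A := matDZ s z * B z + s z * matDZ B z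
      - (matDZ A z * s z + A z * matDZ s z)) fun ζ => ?_).2
    have e1 := (hasMatDeriv_matDZ (diff hsz) ζ).mul (hasMatDeriv_matDZ (diff hB) ζ)
    have e2 := (hasMatDeriv_matDZ (diff hA) ζ).mul (hasMatDeriv_matDZ (diff hsz) ζ)
    have e3 := e1.add (e2.const_smul (-1))
    have e4 : (fun w => s w * B w + (-1 : ℂ) • (A w * s w)) = fun w => s w * B w - A w * s w := by
      funext w; rw [neg_one_smul, sub_eq_add_neg]
    rw [e4] at e3
    convert e3 using 1
    simp only [add_mul, mul_add, Matrix.smul_mul, Matrix.mul_smul, smul_add,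
      neg_one_smul, sub_eq_add_neg, neg_add, smul_neg]
    abel
  -- the adjoint of `∂̄s`
  set T := matDZbar s z with hT
  have hHh : (H z)ᴴ = H z := (hHpos z hz).isHermitian
  have hKh : (K z)ᴴ = K z := (hKpos z hz).isHermitian
  have hsH : (s z)ᴴ * H z = K z := by
    rw [← hKh, ← hHs z hz, Matrix.conjTranspose_mul, hHh]
  have hTadj : Tᴴ * H z = K z * (B z - A z) := by
    have e1 : ∀ᶠ w in 𝓝 z, (s w)ᴴ * H w = K w := by
      filter_upwards [hU.mem_nhds hz] with w hw
      have : (H w)ᴴ = H w := (hHpos w hw).isHermitian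
      have h' : (K w)ᴴ = K w := (hKpos w hw).isHermitian
      rw [← h', ← hHs w hw, Matrix.conjTranspose_mul, this]
    have hsc : ∀ a b, DifferentiableAt ℝ (fun w => (s w)ᴴ a b) z := fun a b =>
      (Complex.conjCLE.differentiableAt.comp z (diff hsz b a) : _)
    have e2 := (matDZ_congr e1).1
    rw [(matDZ_mul hsc (diff (hH z hz))).1, (matDZ_conjTranspose (diff hsz)).1, ← hT,
      matDZ_eq_mul_connForm (hKpos z hz), matDZ_eq_mul_connForm (hHpos z hz), ← Matrix.mul_assoc,
      hsH] at e2
    rw [Matrix.mul_sub]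
    exact eq_sub_of_add_eq e2
  have hKu := posDef_isUnit_det (hKpos z hz)
  have hHu := posDef_isUnit_det (hHpos z hz)
  have hBA : B z - A z = (K z)⁻¹ * Tᴴ * H z := by
    rw [Matrix.mul_assoc, hTadj, Matrix.nonsing_inv_mul_cancel_left _ _ hKu]
  have hsK : s z * (K z)⁻¹ = (H z)⁻¹ := by
    rw [hsdef]; unfold ratio
    rw [Matrix.mul_nonsing_inv_cancel_right _ _ hKu]
  have hKs : (K z)⁻¹ * (s z)ᴴ = (H z)⁻¹ := by
    have := congrArg Matrix.conjTranspose hsK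
    rwa [Matrix.conjTranspose_mul, Matrix.conjTranspose_nonsing_inv,
      Matrix.conjTranspose_nonsing_inv, hHh, hKh] at this
  have hHss : H z * s z = K z := hHs z hz
  rw [hdds, hKeq, hHeq]
  unfold adj
  -- The term tr(∂̄s (B − A)) is the first square by `hBA`. The four curvature terms, after cyclic
  -- permutation under the trace, are the expansion `t2` of the second square.
  have t1 : (T * B z + s z * (φ * ((K z)⁻¹ * φᴴ * K z) - (K z)⁻¹ * φᴴ * K z * φ)
      - ((φ * ((H z)⁻¹ * φᴴ * H z) - (H z)⁻¹ * φᴴ * H z * φ) * s z + A z * T)).trace =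
      (T * (B z - A z)).trace + (s z * φ * (K z)⁻¹ * φᴴ * K z).trace
      - ((s z * (K z)⁻¹) * φᴴ * K z * φ).trace - (φ * (H z)⁻¹ * φᴴ * (H z * s z)).trace
      + ((H z)⁻¹ * φᴴ * H z * φ * s z).trace := by
    simp only [Matrix.mul_sub, Matrix.sub_mul, Matrix.trace_add, Matrix.trace_sub,
      Matrix.mul_assoc]
    rw [Matrix.trace_mul_comm (A z) T]
    ring
  have t2 : ((s z * φ - φ * s z) * (K z)⁻¹ * (s z * φ - φ * s z)ᴴ * H z) =
      s z * φ * (K z)⁻¹ * φᴴ * ((s z)ᴴ * H z) - s z * φ * ((K z)⁻¹ * (s z)ᴴ) * φᴴ * H z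
      - φ * (s z * (K z)⁻¹) * φᴴ * ((s z)ᴴ * H z)
      + φ * s z * ((K z)⁻¹ * (s z)ᴴ) * φᴴ * H z := by
    simp only [Matrix.conjTranspose_sub, Matrix.conjTranspose_mul]
    noncomm_ring
  rw [t1, t2, hBA, hsK, hHss, hsH, hKs]
  simp only [Matrix.trace_add, Matrix.trace_sub]
  have c1 : ((H z)⁻¹ * φᴴ * K z * φ).trace = (φ * (H z)⁻¹ * φᴴ * K z).trace := by
    rw [Matrix.trace_mul_comm]; simp only [Matrix.mul_assoc]
  have c2 : ((H z)⁻¹ * φᴴ * H z * φ * s z).trace = (φ * s z * (H z)⁻¹ * φᴴ * H z).trace := by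
    have : (H z)⁻¹ * φᴴ * H z * φ * s z = ((H z)⁻¹ * φᴴ * H z) * (φ * s z) := by
      simp only [Matrix.mul_assoc]
    rw [this, Matrix.trace_mul_comm]; simp only [Matrix.mul_assoc]
  have c3 : (s z * φ * (H z)⁻¹ * φᴴ * H z).trace = (φ * (H z)⁻¹ * φᴴ * K z).trace := by
    have : s z * φ * (H z)⁻¹ * φᴴ * H z = s z * (φ * (H z)⁻¹ * φᴴ * H z) := by
      simp only [Matrix.mul_assoc]
    rw [this, Matrix.trace_mul_comm, ← hHss]; simp only [Matrix.mul_assoc]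
  rw [c1, c2, c3]
  simp only [← Matrix.mul_assoc]
  ring

/-- The Laplacian is 4∂̄∂, and taking the real part discards the mixed second derivatives, so their
symmetry is not needed. -/
theorem lap_eq_re_dZbar_dZ {u : ℂ → ℝ} {f : ℂ → ℂ} (hu : ContDiffAt ℝ ∞ u z)
    (hf : ∀ᶠ w in 𝓝 z, f w = u w) : lap u z = 4 * (dZbar (dZ f) z).re := by
  have hu2 : ContDiffAt ℝ 2 u z := hu.of_le (by norm_cast)
  have h2 : ∀ e : ℂ, DifferentiableAt ℝ (fun w => fderiv ℝ u w e) z := fun e =>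
    ((hu2.fderiv_right (m := 1) (by norm_num)).differentiableAt (by simp)).clm_apply
      (differentiableAt_const e)
  have h3 : dZ f =ᶠ[𝓝 z] fun w =>
      ((fderiv ℝ u w 1 : ℝ) - Complex.I * (fderiv ℝ u w Complex.I : ℝ)) / 2 := by
    have hdiff : ∀ᶠ w in 𝓝 z, DifferentiableAt ℝ u w := by
      filter_upwards [hu2.eventually (by simp)] with w hw
      exact hw.differentiableAt (by simp)
    filter_upwards [hf.eventually_nhds, hdiff] with w hw hd
    have : HasFDerivAt f (Complex.ofRealCLM.comp (fderiv ℝ u w)) w :=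
      (Complex.ofRealCLM.hasFDerivAt.comp w hd.hasFDerivAt).congr_of_eventuallyEq hw
    unfold dZ
    rw [this.fderiv]; rfl
  have h4 : ∀ e : ℂ, HasFDerivAt (fun w => ((fderiv ℝ u w e : ℝ) : ℂ))
      (Complex.ofRealCLM.comp (fderiv ℝ (fun w => fderiv ℝ u w e) z)) z := fun e =>
    Complex.ofRealCLM.hasFDerivAt.comp z (h2 e).hasFDerivAt
  have h5 := (((h4 1).sub ((h4 Complex.I).const_mul Complex.I)).mul_const ((2 : ℂ)⁻¹))
  have h6 := (h5.congr_of_eventuallyEq h3).fderiv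
  unfold dZbar lap
  rw [h6]
  simp
  ring

end SecondVariation

/-! ### The harmonic metric is diagonal -/

section CyclicSymmetry

/-- A primitive cube root of unity. -/
def cubeRoot : ℂ := Complex.exp (2 * Real.pi * Complex.I / 3)

theorem isPrimitiveRoot_cubeRoot : IsPrimitiveRoot cubeRoot 3 := by
  have := Complex.isPrimitiveRoot_exp 3 (by norm_num)
  simpa [cubeRoot] using this

theorem cubeRoot_pow : cubeRoot ^ 3 = 1 := isPrimitiveRoot_cubeRoot.pow_eq_one

theorem cubeRoot_ne_one : cubeRoot ≠ 1 := isPrimitiveRoot_cubeRoot.ne_one (by norm_num)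

theorem cubeRoot_sq_ne_one : cubeRoot ^ 2 ≠ 1 := fun h => cubeRoot_ne_one <| by
  have := cubeRoot_pow
  rwa [pow_succ, h, one_mul] at this

theorem conj_cubeRoot : conj cubeRoot = cubeRoot ^ 2 := by
  have h1 : ‖cubeRoot‖ = 1 := isPrimitiveRoot_cubeRoot.norm'_eq_one (by norm_num)
  have h2 : conj cubeRoot * cubeRoot = 1 := by
    rw [← Complex.normSq_eq_conj_mul_self, Complex.normSq_eq_norm_sq, h1]; simp
  have h3 : cubeRoot ≠ 0 := right_ne_zero_of_mul_eq_one h2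
  apply mul_right_cancel₀ h3
  rw [h2, ← pow_succ, cubeRoot_pow]

/-- The diagonal gauge transformation of order three that multiplies the Higgs field by a root
of unity. -/
def rotation : Mat ℂ := Matrix.diagonal ![1, cubeRoot, cubeRoot ^ 2]

theorem rotation_conjTranspose : rotationᴴ = Matrix.diagonal ![1, cubeRoot ^ 2, cubeRoot] := by
  unfold rotation
  rw [Matrix.diagonal_conjTranspose]
  congr 1
  ext k
  fin_cases k
  · simp
  · simpa using conj_cubeRoot
  · have : conj (cubeRoot ^ 2) = cubeRoot := by
      rw [map_pow, conj_cubeRoot]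
      linear_combination cubeRoot * cubeRoot_pow
    simpa using this

theorem rotation_mul_conjTranspose : rotation * rotationᴴ = 1 := by
  rw [rotation_conjTranspose, rotation, Matrix.diagonal_mul_diagonal, ← Matrix.diagonal_one]
  congr 1
  ext k
  fin_cases k
  · simp
  · simpa [← pow_succ'] using cubeRoot_pow
  · simpa [← pow_succ] using cubeRoot_pow

theorem conjTranspose_mul_rotation : rotationᴴ * rotation = 1 :=
  mul_eq_one_comm.1 rotation_mul_conjTranspose

/-- All nonzero entries of `higgs` sit at positions (a, a + 1) modulo 3, so multiplying by
`rotation` on the left or on the right differs by the scalar ω⁻¹ = ω². -/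
theorem rotation_mul_higgs (c : ℂ) :
    rotation * higgs c = cubeRoot ^ 2 • (higgs c * rotation) := by
  have h4 : cubeRoot ^ 2 * cubeRoot ^ 2 = cubeRoot := by linear_combination cubeRoot * cubeRoot_pow
  have h3 : cubeRoot ^ 2 * cubeRoot = 1 := by rw [← pow_succ, cubeRoot_pow]
  ext a b
  unfold rotation
  rw [Matrix.diagonal_mul, Matrix.smul_apply, Matrix.mul_diagonal]
  fin_cases a <;> fin_cases b <;> simp [higgs]
  · linear_combination -c * h3
  · linear_combination -c * h4

theorem conj_cubeRoot_sq_mul : conj (cubeRoot ^ 2) * cubeRoot ^ 2 = 1 := by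
  rw [map_pow, conj_cubeRoot]
  linear_combination (cubeRoot ^ 3 + 1) * cubeRoot_pow

theorem rotation_inv : rotation⁻¹ = rotationᴴ :=
  Matrix.inv_eq_left_inv conjTranspose_mul_rotation

theorem inv_rotation_conj (H : Mat ℂ) :
    (rotationᴴ * H * rotation)⁻¹ = rotationᴴ * H⁻¹ * rotation := by
  have h : (rotationᴴ)⁻¹ = rotation := Matrix.inv_eq_left_inv rotation_mul_conjTranspose
  rw [Matrix.mul_inv_rev, Matrix.mul_inv_rev, h, rotation_inv, Matrix.mul_assoc]

theorem cancel_rotation (A B : Mat ℂ) :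
    rotationᴴ * A * rotation * (rotationᴴ * B * rotation) = rotationᴴ * (A * B) * rotation := by
  have : rotationᴴ * A * rotation * (rotationᴴ * B * rotation) =
      rotationᴴ * A * (rotation * rotationᴴ) * (B * rotation) := by
    simp only [Matrix.mul_assoc]
  rw [this, rotation_mul_conjTranspose]
  simp only [Matrix.mul_assoc, Matrix.one_mul]

theorem conj_rotation_higgs (c : ℂ) :
    rotationᴴ * higgs c * rotation = conj (cubeRoot ^ 2) • higgs c := by
  have h := congrArg (fun A => rotationᴴ * A) (rotation_mul_higgs c)
  simp only [← Matrix.mul_assoc, Matrix.mul_smul, conjTranspose_mul_rotation,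
    Matrix.one_mul] at h
  have h2 := congrArg (fun A => conj (cubeRoot ^ 2) • A) h
  simp only [smul_smul, conj_cubeRoot_sq_mul, one_smul] at h2
  rw [h2]

/-- Hitchin's equation is invariant under the cyclic symmetry. -/
theorem bracket_adj_rotation (H : Mat ℂ) (c : ℂ) :
    higgs c * adj (rotationᴴ * H * rotation) (higgs c)
      - adj (rotationᴴ * H * rotation) (higgs c) * higgs c =
    rotationᴴ * (higgs c * adj H (higgs c) - adj H (higgs c) * higgs c) * rotation := by
  -- The Higgs field is conjugated to a unimodular multiple of itself; the opposite phases of φ and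
  -- of its adjoint cancel in the bracket.
  set l := conj (cubeRoot ^ 2) with hl
  have h1 : conj l * l = 1 := by
    rw [hl, Complex.conj_conj, mul_comm]; exact conj_cubeRoot_sq_mul
  have e1 : higgs c = conj l • (rotationᴴ * higgs c * rotation) := by
    rw [conj_rotation_higgs, smul_smul, h1, one_smul]
  have e2 : (higgs c)ᴴ = l • (rotationᴴ * (higgs c)ᴴ * rotation) := by
    conv_lhs => rw [e1]
    simp [Matrix.conjTranspose_mul, Matrix.mul_assoc]
  have e3 : adj (rotationᴴ * H * rotation) (higgs c) =
      l • (rotationᴴ * adj H (higgs c) * rotation) := by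
    have : adj (rotationᴴ * H * rotation) (higgs c) = rotationᴴ * H⁻¹ * rotation *
        (l • (rotationᴴ * (higgs c)ᴴ * rotation)) * (rotationᴴ * H * rotation) := by
      unfold adj
      rw [inv_rotation_conj, ← e2]
    rw [this]
    simp only [Matrix.mul_smul, Matrix.smul_mul, cancel_rotation]
    rfl
  rw [e3]
  have e4 : higgs c * l • (rotationᴴ * adj H (higgs c) * rotation) =
      rotationᴴ * (higgs c * adj H (higgs c)) * rotation := by
    have : higgs c * l • (rotationᴴ * adj H (higgs c) * rotation) =
        (conj l • (rotationᴴ * higgs c * rotation)) *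
          l • (rotationᴴ * adj H (higgs c) * rotation) := by rw [← e1]
    rw [this]
    simp only [Matrix.mul_smul, Matrix.smul_mul, cancel_rotation, smul_smul, mul_comm l, h1,
      one_smul]
  have e5 : l • (rotationᴴ * adj H (higgs c) * rotation) * higgs c =
      rotationᴴ * (adj H (higgs c) * higgs c) * rotation := by
    have : l • (rotationᴴ * adj H (higgs c) * rotation) * higgs c =
        l • (rotationᴴ * adj H (higgs c) * rotation) *
          (conj l • (rotationᴴ * higgs c * rotation)) := by rw [← e1]
    rw [this]
    simp only [Matrix.mul_smul, Matrix.smul_mul, cancel_rotation, smul_smul, h1,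
      one_smul]
  rw [e4, e5, Matrix.mul_sub, Matrix.sub_mul]

theorem posDef_rotation {H : Mat ℂ} (hH : H.PosDef) : (rotationᴴ * H * rotation).PosDef := by
  refine hH.conjTranspose_mul_mul_same ?_
  have : IsUnit rotation := IsUnit.of_mul_eq_one _ rotation_mul_conjTranspose
  exact Matrix.mulVec_injective_iff_isUnit.2 this

end CyclicSymmetry

/-! ### The comparison endomorphism of the cyclic symmetry, and the diagonal shape of H. -/

section Diagonal

variable {ι X : Type*} [TopologicalSpace X] [ChartedSpace ℂ X] {θ : SqrtCanonical ι X}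
  {t : ι → X → ℂ} {H : ι → X → Mat ℂ}

/-- The comparison endomorphism between a metric and its image under the cyclic symmetry. -/
def cyclicRatio (H : ι → X → Mat ℂ) (i : ι) (x : X) : Mat ℂ :=
  (H i x)⁻¹ * (rotationᴴ * H i x * rotation)

namespace IsHarmonicMetric

theorem h₁_pos (hH : IsHarmonicMetric θ t H)
    {i : ι} {x : X} (hx : x ∈ (θ.chart i).source) : 0 < h₁ H i x :=
  (Complex.pos_iff.1 (hH.posDef i x hx).diag_pos).1

theorem contDiffAt_chart (hH : IsHarmonicMetric θ t H)
    {i : ι} {z : ℂ} (hz : z ∈ (θ.chart i).target) (a b : Fin 3) :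
    ContDiffAt ℝ ∞ (fun z => H i ((θ.chart i).symm z) a b) z :=
  (hH.smooth i a b).contDiffAt ((θ.chart i).open_target.mem_nhds hz)

theorem posDef_chart (hH : IsHarmonicMetric θ t H)
    {i : ι} {z : ℂ} (hz : z ∈ (θ.chart i).target) :
    (H i ((θ.chart i).symm z)).PosDef := hH.posDef i _ ((θ.chart i).map_target hz)

theorem contDiffAt_rotation (hH : IsHarmonicMetric θ t H)
    {i : ι} {z : ℂ} (hz : z ∈ (θ.chart i).target) (a b : Fin 3) :
    ContDiffAt ℝ ∞ (fun z => (rotationᴴ * H i ((θ.chart i).symm z) * rotation) a b) z :=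
  contDiffAt_mat_mul (F := fun z => rotationᴴ * H i ((θ.chart i).symm z)) (G := fun _ => rotation)
    (contDiffAt_mat_mul (F := fun _ => rotationᴴ) (G := fun z => H i ((θ.chart i).symm z))
      (fun _ _ => contDiffAt_const) (hH.contDiffAt_chart hz))
    (fun _ _ => contDiffAt_const) a b

theorem contDiffAt_cyclicRatio (hH : IsHarmonicMetric θ t H)
    {i : ι} {z : ℂ} (hz : z ∈ (θ.chart i).target) (a b : Fin 3) :
    ContDiffAt ℝ ∞ (fun z => cyclicRatio H i ((θ.chart i).symm z) a b) z :=
  contDiffAt_mat_mul (contDiffAt_mat_inv (hH.contDiffAt_chart hz)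
    (hH.posDef_chart hz).det_pos.ne') (hH.contDiffAt_rotation hz) a b

theorem curvature_eq (hH : IsHarmonicMetric θ t H)
    {i : ι} {z : ℂ} (hz : z ∈ (θ.chart i).target) :
    matDZbar (connForm fun w => H i ((θ.chart i).symm w)) z =
      higgs (t i ((θ.chart i).symm z)) *
        adj (H i ((θ.chart i).symm z)) (higgs (t i ((θ.chart i).symm z))) -
      adj (H i ((θ.chart i).symm z)) (higgs (t i ((θ.chart i).symm z))) *
        higgs (t i ((θ.chart i).symm z)) := by
  have h := hH.hitchin i _ ((θ.chart i).map_target hz)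
  rw [(θ.chart i).right_inv hz] at h
  exact (neg_add_eq_zero.1 h)

/-- The rotation is a constant unitary matrix, so it passes through both derivatives, and the
bracket is equivariant under it. -/
theorem curvature_rotation_eq (hH : IsHarmonicMetric θ t H)
    {i : ι} {z : ℂ} (hz : z ∈ (θ.chart i).target) :
    matDZbar (connForm fun w => rotationᴴ * H i ((θ.chart i).symm w) * rotation) z =
      higgs (t i ((θ.chart i).symm z)) *
        adj (rotationᴴ * H i ((θ.chart i).symm z) * rotation) (higgs (t i ((θ.chart i).symm z))) -
      adj (rotationᴴ * H i ((θ.chart i).symm z) * rotation) (higgs (t i ((θ.chart i).symm z))) *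
        higgs (t i ((θ.chart i).symm z)) := by
  have h1 : ∀ w ∈ (θ.chart i).target,
      connForm (fun w => rotationᴴ * H i ((θ.chart i).symm w) * rotation) w =
        rotationᴴ * connForm (fun w => H i ((θ.chart i).symm w)) w * rotation := by
    intro w hw
    unfold connForm
    rw [(matDZ_const_mul_mul_const _ _ fun a b =>
      (hH.contDiffAt_chart hw a b).differentiableAt (by simp)).1, inv_rotation_conj,
      cancel_rotation]
  rw [(matDZ_congr (Filter.mem_of_superset ((θ.chart i).open_target.mem_nhds hz) h1)).2,
    (matDZ_const_mul_mul_const _ _ fun a b => (contDiffAt_connForm (hH.contDiffAt_chart hz)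
      (hH.posDef_chart hz) a b).differentiableAt (by simp)).2, hH.curvature_eq hz,
    bracket_adj_rotation]

/-- Transition matrices and `rotation` are diagonal and commute, so the local comparison matrices
form a global endomorphism of E. Its trace is therefore a function on X, and its entries are
sections of powers of K^{1/2}. -/
theorem cyclicRatio_trans (hH : IsHarmonicMetric θ t H)
    {i j : ι} {x : X} (hi : x ∈ (θ.chart i).source)
    (hj : x ∈ (θ.chart j).source) :
    cyclicRatio H i x = θ.gauge i j x * cyclicRatio H j x * (θ.gauge i j x)⁻¹ := by
  set G := θ.gauge i j x with hG
  have h0 := θ.trans_ne_zero hi hj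
  have hGdet : IsUnit G.det := by
    rw [hG, SqrtCanonical.gauge, Matrix.det_diagonal]
    simp [Fin.prod_univ_three, h0]
  have hGdet' : IsUnit (Gᴴ).det := by rw [Matrix.det_conjTranspose]; exact hGdet.star
  have c1 : G * rotation = rotation * G := by
    rw [hG, SqrtCanonical.gauge, rotation, Matrix.diagonal_mul_diagonal,
      Matrix.diagonal_mul_diagonal]
    simp only [mul_comm]
  have c2 : Gᴴ * rotationᴴ = rotationᴴ * Gᴴ := by
    rw [← Matrix.conjTranspose_mul, ← Matrix.conjTranspose_mul, c1]
  unfold cyclicRatio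
  rw [hH.transition i j x hi hj, ← hG, Matrix.mul_inv_rev, Matrix.mul_inv_rev]
  have : G * (G⁻¹ * ((H i x)⁻¹ * (Gᴴ)⁻¹) * (rotationᴴ * (Gᴴ * H i x * G) * rotation)) * G⁻¹ =
      (G * G⁻¹) * ((H i x)⁻¹ * ((Gᴴ)⁻¹ * ((rotationᴴ * Gᴴ) *
        (H i x * ((G * rotation) * G⁻¹))))) := by
    simp only [Matrix.mul_assoc]
  rw [this, ← c2, c1, Matrix.mul_nonsing_inv _ hGdet, Matrix.one_mul, Matrix.mul_assoc Gᴴ,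
    Matrix.nonsing_inv_mul_cancel_left _ _ hGdet', Matrix.mul_nonsing_inv_cancel_right _ _ hGdet]
  simp only [Matrix.mul_assoc]

theorem trace_cyclicRatio (hH : IsHarmonicMetric θ t H)
    {i j : ι} {x : X} (hi : x ∈ (θ.chart i).source)
    (hj : x ∈ (θ.chart j).source) :
    (cyclicRatio H i x).trace = (cyclicRatio H j x).trace := by
  have hGdet : IsUnit (θ.gauge i j x).det := by
    rw [SqrtCanonical.gauge, Matrix.det_diagonal]
    simp [Fin.prod_univ_three, θ.trans_ne_zero hi hj]
  rw [hH.cyclicRatio_trans hi hj, Matrix.mul_assoc, Matrix.trace_mul_comm,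
    Matrix.nonsing_inv_mul_cancel_right _ _ hGdet]

theorem trace_cyclicRatio_real (hH : IsHarmonicMetric θ t H)
    {i : ι} {x : X} (hi : x ∈ (θ.chart i).source) :
    (cyclicRatio H i x).trace = ((cyclicRatio H i x).trace.re : ℂ) := by
  have h1 : (H i x)ᴴ = H i x := (hH.posDef i x hi).isHermitian
  have h2 : conj (cyclicRatio H i x).trace = (cyclicRatio H i x).trace := by
    have : (cyclicRatio H i x)ᴴ.trace = (cyclicRatio H i x).trace := by
      unfold cyclicRatio
      simp only [Matrix.conjTranspose_mul, Matrix.conjTranspose_nonsing_inv,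
        Matrix.conjTranspose_conjTranspose, h1]
      rw [Matrix.trace_mul_comm]
      simp only [Matrix.mul_assoc]
    rw [Matrix.trace_conjTranspose] at this
    exact this
  exact (Complex.conj_eq_iff_re.1 h2).symm

theorem lap_trace (hH : IsHarmonicMetric θ t H)
    {i : ι} {z : ℂ} (hz : z ∈ (θ.chart i).target) :
    lap (fun w => (cyclicRatio H i ((θ.chart i).symm w)).trace.re) z =
      4 * (matDZbar (matDZ fun w => cyclicRatio H i ((θ.chart i).symm w)) z).trace.re := by
  set s : ℂ → Mat ℂ := fun w => cyclicRatio H i ((θ.chart i).symm w) with hs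
  have hsm : ∀ w ∈ (θ.chart i).target, ∀ a b, ContDiffAt ℝ ∞ (fun w => s w a b) w :=
    fun w hw => hH.contDiffAt_cyclicRatio hw
  have hu : ContDiffAt ℝ ∞ (fun w => (s w).trace.re) z := by
    have : ContDiffAt ℝ ∞ (fun w => (s w).trace) z := by
      simp only [Matrix.trace, Matrix.diag]
      exact ContDiffAt.sum fun k _ => hsm z hz k k
    exact Complex.reCLM.contDiff.contDiffAt.comp z this
  have hev := (θ.chart i).open_target.mem_nhds hz
  rw [lap_eq_re_dZbar_dZ hu (f := fun w => (s w).trace)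
    (by filter_upwards [hev] with w hw
        exact hH.trace_cyclicRatio_real ((θ.chart i).map_target hw))]
  have tr_dZ : ∀ {F : ℂ → Mat ℂ} {w : ℂ}, (∀ a b, ContDiffAt ℝ ∞ (fun w => F w a b) w) →
      dZ (fun w => (F w).trace) w = (matDZ F w).trace ∧
      dZbar (fun w => (F w).trace) w = (matDZbar F w).trace := by
    intro F w hF
    refine dZ_eq_of_forall fun ζ => ?_
    have h := (hasMatDeriv_matDZ (fun a b => (hF a b).differentiableAt (by simp)) ζ).trace.2
    rw [mfderiv_eq_fderiv] at h
    rw [Matrix.trace_add, Matrix.trace_smul, Matrix.trace_smul] at h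
    exact h
  have h1 : dZ (fun w => (s w).trace) =ᶠ[𝓝 z] fun w => (matDZ s w).trace := by
    filter_upwards [hev] with w hw using (tr_dZ (hsm w hw)).1
  have h2 : dZbar (dZ fun w => (s w).trace) z = dZbar (fun w => (matDZ s w).trace) z := by
    unfold dZbar
    rw [h1.fderiv_eq]
  rw [h2, (tr_dZ (contDiffAt_matDZ (hsm z hz))).2]

theorem second_variation (hH : IsHarmonicMetric θ t H)
    {i : ι} {z : ℂ} (hz : z ∈ (θ.chart i).target) :
    0 ≤ lap (fun w => (cyclicRatio H i ((θ.chart i).symm w)).trace.re) z ∧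
    (lap (fun w => (cyclicRatio H i ((θ.chart i).symm w)).trace.re) z = 0 →
      matDZbar (fun w => cyclicRatio H i ((θ.chart i).symm w)) z = 0 ∧
      cyclicRatio H i ((θ.chart i).symm z) * higgs (t i ((θ.chart i).symm z)) =
        higgs (t i ((θ.chart i).symm z)) * cyclicRatio H i ((θ.chart i).symm z)) := by
  have key := trace_second_variation (H := fun w => H i ((θ.chart i).symm w))
    (K := fun w => rotationᴴ * H i ((θ.chart i).symm w) * rotation)
    (θ.chart i).open_target hz (fun w hw => hH.contDiffAt_chart hw)
    (fun w hw => hH.contDiffAt_rotation hw) (fun w hw => hH.posDef_chart hw)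
    (fun w hw => posDef_rotation (hH.posDef_chart hw)) (hH.curvature_eq hz)
    (hH.curvature_rotation_eq hz)
  rw [hH.lap_trace hz]
  change (matDZbar (matDZ fun w => cyclicRatio H i ((θ.chart i).symm w)) z).trace = _ at key
  rw [key, Complex.add_re]
  obtain ⟨p1, q1⟩ := trace_weighted_nonneg (hH.posDef_chart hz)
    (posDef_rotation (hH.posDef_chart hz)).inv
    (matDZbar (ratio (fun w => H i ((θ.chart i).symm w))
      (fun w => rotationᴴ * H i ((θ.chart i).symm w) * rotation)) z)
  obtain ⟨p2, q2⟩ := trace_weighted_nonneg (hH.posDef_chart hz)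
    (posDef_rotation (hH.posDef_chart hz)).inv
    (ratio (fun w => H i ((θ.chart i).symm w))
      (fun w => rotationᴴ * H i ((θ.chart i).symm w) * rotation) z *
      higgs (t i ((θ.chart i).symm z)) - higgs (t i ((θ.chart i).symm z)) *
      ratio (fun w => H i ((θ.chart i).symm w))
      (fun w => rotationᴴ * H i ((θ.chart i).symm w) * rotation) z)
  simp only [RCLike.re_eq_complex_re] at p1 q1 p2 q2
  refine ⟨by linarith, fun h => ⟨q1 (by linarith), sub_eq_zero.1 (q2 (by linarith))⟩⟩

theorem cyclicRatio_trans_apply (hH : IsHarmonicMetric θ t H)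
    {i j : ι} {x : X} (hi : x ∈ (θ.chart i).source)
    (hj : x ∈ (θ.chart j).source) (a b : Fin 3) :
    cyclicRatio H i x a b = ![θ.trans i j x, 1, (θ.trans i j x)⁻¹] a * cyclicRatio H j x a b *
      ![(θ.trans i j x)⁻¹, 1, θ.trans i j x] b := by
  have h0 := θ.trans_ne_zero hi hj
  have hinv : (θ.gauge i j x)⁻¹ =
      Matrix.diagonal ![(θ.trans i j x)⁻¹, 1, θ.trans i j x] := by
    refine Matrix.inv_eq_right_inv ?_
    rw [SqrtCanonical.gauge, Matrix.diagonal_mul_diagonal, ← Matrix.diagonal_one]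
    congr 1
    ext k
    fin_cases k <;> simp [h0]
  rw [hH.cyclicRatio_trans hi hj, hinv, SqrtCanonical.gauge, Matrix.mul_diagonal,
    Matrix.diagonal_mul]

variable [CompactSpace X] [ConnectedSpace X]

/-- The trace is a subharmonic function on all of X, hence constant by compactness. Its Laplacian is
then zero, and both squares in the second variation vanish. -/
theorem cyclicRatio_holomorphic (hH : IsHarmonicMetric θ t H)
    {i : ι} {z : ℂ} (hz : z ∈ (θ.chart i).target) :
    matDZbar (fun w => cyclicRatio H i ((θ.chart i).symm w)) z = 0 ∧
      cyclicRatio H i ((θ.chart i).symm z) * higgs (t i ((θ.chart i).symm z)) =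
        higgs (t i ((θ.chart i).symm z)) * cyclicRatio H i ((θ.chart i).symm z) := by
  refine (hH.second_variation hz).2 ?_
  set u : X → ℝ := fun x => (cyclicRatio H (θ.idx x) x).trace.re with hu
  have hui : ∀ {i w}, w ∈ (θ.chart i).target →
      u ((θ.chart i).symm w) = (cyclicRatio H i ((θ.chart i).symm w)).trace.re :=
    fun {i w} hw => by
      rw [hu]
      simp only
      rw [hH.trace_cyclicRatio (θ.mem_source _) ((θ.chart i).map_target hw)]
  have hlap : ∀ {i w}, w ∈ (θ.chart i).target → lap (fun w => u ((θ.chart i).symm w)) w =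
      lap (fun w => (cyclicRatio H i ((θ.chart i).symm w)).trace.re) w := fun {i w} hw => by
    have hev : (fun w => u ((θ.chart i).symm w)) =ᶠ[𝓝 w]
        fun w => (cyclicRatio H i ((θ.chart i).symm w)).trace.re := by
      filter_upwards [(θ.chart i).open_target.mem_nhds hw] with w' hw' using hui hw'
    have hev' : ∀ e : ℂ, (fun w => fderiv ℝ (fun w => u ((θ.chart i).symm w)) w e) =ᶠ[𝓝 w]
        fun w => fderiv ℝ (fun w => (cyclicRatio H i ((θ.chart i).symm w)).trace.re) w e :=
      fun e => by
        filter_upwards [hev.eventuallyEq_nhds] with w' hw'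
        rw [hw'.fderiv_eq]
    unfold lap
    rw [(hev' 1).fderiv_eq, (hev' Complex.I).fderiv_eq]
  have hconst := eq_of_lap_nonneg (u := u) fun x => by
    refine ⟨θ.chart (θ.idx x), θ.mem_source x, ?_, fun w hw => ?_⟩
    · refine ContDiffOn.congr (fun w hw => ?_) fun w hw => hui hw
      refine ContDiffAt.contDiffWithinAt ?_
      have : ContDiffAt ℝ ∞ (fun w => (cyclicRatio H (θ.idx x)
          ((θ.chart (θ.idx x)).symm w)).trace) w := by
        simp only [Matrix.trace, Matrix.diag]
        exact ContDiffAt.sum fun k _ => hH.contDiffAt_cyclicRatio hw k k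
      exact Complex.reCLM.contDiff.contDiffAt.comp w (this.of_le (by norm_cast))
    · rw [hlap hw]
      exact (hH.second_variation hw).1
  rw [← hlap hz]
  have : (fun w => u ((θ.chart i).symm w)) = fun _ => u ((θ.chart i).symm z) :=
    funext fun w => hconst _ _
  rw [this]
  simp [lap]

/-- The equation ∂̄s = 0 makes the entries holomorphic, and the weight k is the one by which the
diagonal gauge scales the chosen entry. The indicator supplies the value 0 that `sections` requires
outside the coordinate domain. -/
theorem entry_mem_sections (hH : IsHarmonicMetric θ t H)
    {k : ℤ} {a b : Fin 3}
    (htrans : ∀ i j x, x ∈ (θ.chart i).source → x ∈ (θ.chart j).source →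
      cyclicRatio H i x a b = θ.trans i j x ^ k * cyclicRatio H j x a b) :
    (fun i => (θ.chart i).source.indicator fun x => cyclicRatio H i x a b) ∈ θ.sections k := by
  refine ⟨fun i z hz => ?_, fun i j x hi hj => ?_, fun i x hx => Set.indicator_of_notMem hx _⟩
  · refine DifferentiableAt.differentiableWithinAt ?_
    have hd : DifferentiableAt ℂ (fun z => cyclicRatio H i ((θ.chart i).symm z) a b) z := by
      refine differentiableAt_complex_iff_differentiableAt_real.2
        ⟨(hH.contDiffAt_cyclicRatio hz a b).differentiableAt (by simp), ?_⟩
      have h := congrFun (congrFun (hH.cyclicRatio_holomorphic hz).1 a) b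
      change dZbar (fun z => cyclicRatio H i ((θ.chart i).symm z) a b) z = 0 at h
      unfold dZbar at h
      rw [smul_eq_mul]
      linear_combination (-2 * Complex.I) * h + (fderiv ℝ (fun z =>
        cyclicRatio H i ((θ.chart i).symm z) a b) z Complex.I) * Complex.I_sq
    refine hd.congr_of_eventuallyEq ?_
    filter_upwards [(θ.chart i).open_target.mem_nhds hz] with w hw
    exact Set.indicator_of_mem ((θ.chart i).map_target hw) _
  · simp only [Set.indicator_of_mem hi, Set.indicator_of_mem hj]
    exact htrans i j x hi hj

variable [IsManifold 𝓘(ℂ) ω X]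

/-- The comparison endomorphism of a harmonic metric is diagonal. -/
theorem cyclicRatio_diagonal (hH : IsHarmonicMetric θ t H)
    (hgenus : 2 ≤ θ.genus) {i : ι} {x : X}
    (hx : x ∈ (θ.chart i).source) {a b : Fin 3} (hab : a ≠ b) : cyclicRatio H i x a b = 0 := by
  have hval : ∀ {a b : Fin 3} {k : ℤ}, (k = -1 ∨ k = -2) →
      (∀ i j x, x ∈ (θ.chart i).source → x ∈ (θ.chart j).source →
        cyclicRatio H i x a b = θ.trans i j x ^ k * cyclicRatio H j x a b) →
      cyclicRatio H i x a b = 0 := by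
    intro a b k hk htrans
    have hmem := hH.entry_mem_sections htrans
    have h0 : (fun i => (θ.chart i).source.indicator fun x => cyclicRatio H i x a b) = 0 := by
      rcases hk with rfl | rfl
      · exact θ.sections_neg_one_eq_zero hgenus hmem
      · exact θ.sections_neg_two_eq_zero hgenus hmem
    have := congrFun (congrFun h0 i) x
    simpa [Set.indicator_of_mem hx] using this
  -- The entries below the diagonal are those of negative weight: −1, −1 and −2.
  have h10 : cyclicRatio H i x 1 0 = 0 := hval (.inl rfl) fun i j x hi hj => by
    rw [hH.cyclicRatio_trans_apply hi hj]; simp; ring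
  have h21 : cyclicRatio H i x 2 1 = 0 := hval (.inl rfl) fun i j x hi hj => by
    rw [hH.cyclicRatio_trans_apply hi hj]; simp
  have h20 : cyclicRatio H i x 2 0 = 0 := hval (.inr rfl) fun i j x hi hj => by
    rw [hH.cyclicRatio_trans_apply hi hj, show (-2 : ℤ) = -(2 : ℕ) by rfl, zpow_neg, zpow_natCast]
    simp; ring
  -- The entry 1 of the Higgs field, given by τ, carries the vanishing from below the diagonal to
  -- above it, whatever the value of t.
  have hcomm := (hH.cyclicRatio_holomorphic ((θ.chart i).map_source hx)).2
  rw [(θ.chart i).left_inv hx] at hcomm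
  have e10 := congrFun (congrFun hcomm 1) 0
  have e00 := congrFun (congrFun hcomm 0) 0
  have e21 := congrFun (congrFun hcomm 2) 1
  have h12 : cyclicRatio H i x 1 2 = 0 := by
    simpa [Matrix.mul_apply, Fin.sum_univ_three, higgs, h20] using e10
  have h02 : cyclicRatio H i x 0 2 = 0 := by
    simpa [Matrix.mul_apply, Fin.sum_univ_three, higgs, h10] using e00
  have h01 : cyclicRatio H i x 0 1 = 0 := by
    simpa [Matrix.mul_apply, Fin.sum_univ_three, higgs, h20] using e21.symm
  fin_cases a <;> fin_cases b
  · exact absurd rfl hab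
  · exact h01
  · exact h02
  · exact h10
  · exact absurd rfl hab
  · exact h12
  · exact h20
  · exact h21
  · exact absurd rfl hab

/-- H and R*HR have the same nonzero diagonal entries, so the diagonal comparison endomorphism is
the identity and H = R*HR. Off-diagonal entries are then equal to their multiples by nontrivial cube
roots of unity, so they vanish; compatibility with B fixes the diagonal up to h₁. -/
theorem eq_diagonal (hH : IsHarmonicMetric θ t H)
    (hgenus : 2 ≤ θ.genus) {i : ι} {x : X} (hx : x ∈ (θ.chart i).source) :
    H i x = Matrix.diagonal ![(h₁ H i x : ℂ), 1, (h₁ H i x : ℂ)⁻¹] := by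
  have hpos := hH.posDef i x hx
  have hs : H i x * cyclicRatio H i x = rotationᴴ * H i x * rotation :=
    Matrix.mul_nonsing_inv_cancel_left _ _ (posDef_isUnit_det hpos)
  have hsd : cyclicRatio H i x = Matrix.diagonal fun a => cyclicRatio H i x a a := by
    ext a b
    by_cases hab : a = b
    · subst hab; simp
    · rw [Matrix.diagonal_apply_ne _ hab, hH.cyclicRatio_diagonal hgenus hx hab]
  have hentry : ∀ a b, H i x a b * cyclicRatio H i x b b =
      ![1, cubeRoot ^ 2, cubeRoot] a * H i x a b * ![1, cubeRoot, cubeRoot ^ 2] b := by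
    intro a b
    have := congrFun (congrFun hs a) b
    rw [hsd, Matrix.mul_diagonal, rotation_conjTranspose, rotation, Matrix.mul_diagonal,
      Matrix.diagonal_mul] at this
    exact this
  have hdne : ∀ a, H i x a a ≠ 0 := fun a => (hpos.diag_pos (i := a)).ne'
  have hone : ∀ a, cyclicRatio H i x a a = 1 := by
    intro a
    have h := hentry a a
    apply mul_left_cancel₀ (hdne a)
    rw [h]
    fin_cases a
    · simp
    · simp; linear_combination (H i x 1 1) * cubeRoot_pow
    · simp; linear_combination (H i x 2 2) * cubeRoot_pow
  have w1 := sub_ne_zero.2 cubeRoot_ne_one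
  have w2 := sub_ne_zero.2 cubeRoot_sq_ne_one
  have w4 : cubeRoot ^ 2 * cubeRoot ^ 2 = cubeRoot := by linear_combination cubeRoot * cubeRoot_pow
  have hoff : ∀ a b, a ≠ b → H i x a b = 0 := by
    intro a b hab
    have h := hentry a b
    rw [hone b, mul_one] at h
    fin_cases a <;> fin_cases b <;> simp at hab h ⊢
    · exact (mul_eq_zero.1 (show (cubeRoot - 1) * H i x 0 1 = 0 by
        linear_combination -h)).resolve_left w1
    · exact (mul_eq_zero.1 (show (cubeRoot ^ 2 - 1) * H i x 0 2 = 0 by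
        linear_combination -h)).resolve_left w2
    · exact (mul_eq_zero.1 (show (cubeRoot ^ 2 - 1) * H i x 1 0 = 0 by
        linear_combination -h)).resolve_left w2
    · exact (mul_eq_zero.1 (show (cubeRoot - 1) * H i x 1 2 = 0 by
        linear_combination -h - H i x 1 2 * w4)).resolve_left w1
    · exact (mul_eq_zero.1 (show (cubeRoot - 1) * H i x 2 0 = 0 by
        linear_combination -h)).resolve_left w1
    · exact (mul_eq_zero.1 (show (cubeRoot ^ 2 - 1) * H i x 2 1 = 0 by
        linear_combination -h)).resolve_left w2
  have hHd : H i x = Matrix.diagonal fun a => H i x a a := by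
    ext a b
    by_cases hab : a = b
    · subst hab; simp
    · rw [Matrix.diagonal_apply_ne _ hab, hoff a b hab]
  have hre : ∀ a, H i x a a = ((H i x a a).re : ℂ) := fun a =>
    (Complex.conj_eq_iff_re.1 (hpos.isHermitian.apply a a)).symm
  have hrepos : ∀ a, 0 < (H i x a a).re := fun a => (Complex.pos_iff.1 hpos.diag_pos).1
  have hinv : (H i x)⁻¹ = Matrix.diagonal fun a => (H i x a a)⁻¹ := by
    refine Matrix.inv_eq_right_inv ?_
    conv_lhs => rw [hHd]
    rw [Matrix.diagonal_mul_diagonal, ← Matrix.diagonal_one]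
    congr 1
    ext a
    simp [hdne a]
  have hcomp := hH.compatible i x hx
  rw [hinv] at hcomp
  have c0 := congrFun (congrFun hcomp 0) 0
  have c1 := congrFun (congrFun hcomp 1) 1
  simp [Matrix.mul_apply, Fin.sum_univ_three, pairing, Matrix.diagonal_apply] at c0 c1
  have hcc : ∀ a, conj (H i x a a) = H i x a a := fun a => hpos.isHermitian.apply a a
  rw [hcc] at c0 c1
  -- Compatibility gives only that the square is 1; positivity of H selects the root.
  have d1 : H i x 1 1 = 1 := by
    rw [hre 1] at c1 ⊢
    have h1 : ((H i x 1 1).re)⁻¹ * ((H i x 1 1).re)⁻¹ = 1 := by exact_mod_cast c1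
    have h2 : (H i x 1 1).re * (H i x 1 1).re = 1 := by
      rw [← mul_inv] at h1; exact inv_eq_one.1 h1
    have h3 : (H i x 1 1).re = 1 := by nlinarith [hrepos 1]
    rw [h3]; simp
  have d2 : H i x 2 2 = (H i x 0 0)⁻¹ := by
    rw [← mul_inv, inv_eq_one] at c0
    exact eq_inv_of_mul_eq_one_right c0
  have d0 : (h₁ H i x : ℂ) = H i x 0 0 := (hre 0).symm
  rw [d0]
  conv_lhs => rw [hHd]
  congr 1
  ext a
  fin_cases a
  · rfl
  · exact d1
  · exact d2

end IsHarmonicMetric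

end Diagonal

/-! ### The harmonic map and the bundle map -/

section ComplexifiedMatrices

/-- The complexification of a real matrix. -/
def cplx (A : Mat ℝ) : Mat ℂ := A.map Complex.ofReal

theorem cplx_injective : Function.Injective cplx := fun A B h => by
  ext a b
  exact Complex.ofReal_injective (congrFun (congrFun h a) b)

theorem cplx_mul (A B : Mat ℝ) : cplx (A * B) = cplx A * cplx B :=
  Matrix.map_mul (f := Complex.ofRealHom)

theorem cplx_add (A B : Mat ℝ) : cplx (A + B) = cplx A + cplx B := by
  ext a b; simp [cplx]

theorem cplx_neg (A : Mat ℝ) : cplx (-A) = -cplx A := by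
  ext a b; simp [cplx]

theorem cplx_smul (c : ℝ) (A : Mat ℝ) : cplx (c • A) = (c : ℂ) • cplx A := by
  ext a b; simp [cplx]

theorem cplx_conjTranspose (A : Mat ℝ) : (cplx A)ᴴ = cplx Aᵀ := by
  ext a b; simp [cplx]

theorem cplx_det (A : Mat ℝ) : (cplx A).det = (A.det : ℂ) :=
  (RingHom.map_det Complex.ofRealHom A).symm

theorem cplx_trace (A : Mat ℝ) : (cplx A).trace = (A.trace : ℂ) := by
  simp [cplx, Matrix.trace, Fin.sum_univ_three]

theorem cplx_inv (A : Mat ℝ) (hA : IsUnit A.det) : cplx A⁻¹ = (cplx A)⁻¹ := by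
  refine (Matrix.inv_eq_right_inv ?_).symm
  rw [← cplx_mul, Matrix.mul_nonsing_inv _ hA]
  ext a b
  simp [cplx, Matrix.one_apply]
  split_ifs <;> simp

/-- A complex matrix fixed by conjugation is the complexification of its real part. -/
theorem cplx_map_re {A : Mat ℂ} (hA : A.map conj = A) : cplx (A.map Complex.re) = A := by
  ext a b
  have := congrFun (congrFun hA a) b
  exact Complex.conj_eq_iff_re.1 this

theorem map_re_cplx (A : Mat ℝ) : (cplx A).map Complex.re = A := by
  ext a b; simp [cplx]

theorem map_conj_mul (A B : Mat ℂ) : (A * B).map conj = A.map conj * B.map conj :=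
  Matrix.map_mul (f := starRingEnd ℂ)

theorem posDef_of_cplx {q : Mat ℝ} (h : (cplx q).PosDef) : q.PosDef := by
  refine Matrix.PosDef.of_dotProduct_mulVec_pos ?_ fun x hx => ?_
  · have := h.isHermitian
    rw [Matrix.IsHermitian, cplx_conjTranspose] at this
    rw [Matrix.IsHermitian, Matrix.conjTranspose_eq_transpose_of_trivial]
    exact cplx_injective this
  · have hx' : (fun k => (x k : ℂ)) ≠ 0 := fun h0 => hx <| funext fun k =>
      Complex.ofReal_injective (congrFun h0 k)
    have h1 := h.dotProduct_mulVec_pos hx'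
    have h2 : star (fun k => (x k : ℂ)) ⬝ᵥ (cplx q *ᵥ fun k => (x k : ℂ)) =
        ((star x ⬝ᵥ (q *ᵥ x) : ℝ) : ℂ) := by
      simp [dotProduct, Matrix.mulVec, Fin.sum_univ_three, cplx]
    rw [h2] at h1
    exact_mod_cast h1

end ComplexifiedMatrices

/-! ### The Gram matrix of the flat frame and the matrix of V(v) in it. -/

section Frame

/-- The Hermitian form `H (Φ₀ + Φ₀*)(v)` in the frame of index `i`, for `ξ = dz_i (v)` and
`H = diag (h, 1, h⁻¹)`. -/
def formMat (h : ℝ) (ξ : ℂ) : Mat ℂ := !![0, 0, conj ξ / h; 0, 0, 0; ξ / h, 0, 0]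

theorem formMat_add (h : ℝ) (ξ η : ℂ) : formMat h (ξ + η) = formMat h ξ + formMat h η := by
  ext a b
  fin_cases a <;> fin_cases b <;> simp [formMat, add_div]

theorem formMat_smul (h c : ℝ) (ξ : ℂ) : formMat h (c * ξ) = (c : ℂ) • formMat h ξ := by
  ext a b
  fin_cases a <;> fin_cases b <;> simp [formMat, mul_div_assoc]

theorem formMat_conjTranspose (h : ℝ) (ξ : ℂ) : (formMat h ξ)ᴴ = formMat h ξ := by
  ext a b
  fin_cases a <;> fin_cases b <;> simp [formMat]

variable {ι X S : Type*} [TopologicalSpace X] [ChartedSpace ℂ X] {θ : SqrtCanonical ι X}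
  {t : ι → X → ℂ} {H : ι → X → Mat ℂ}

/-- The metric has the diagonal form `diag (h₁, 1, h₁⁻¹)` in the frames `(e_i, 1, e_i⁻¹)`. -/
def IsDiagonalMetric (θ : SqrtCanonical ι X) (H : ι → X → Mat ℂ) : Prop :=
  ∀ i x, x ∈ (θ.chart i).source → 0 < h₁ H i x ∧
    H i x = Matrix.diagonal ![(h₁ H i x : ℂ), 1, (h₁ H i x : ℂ)⁻¹]

theorem inv_diagonal_metric {h : ℂ} (h0 : h ≠ 0) :
    (Matrix.diagonal ![h, 1, h⁻¹])⁻¹ = Matrix.diagonal ![h⁻¹, 1, h] := by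
  refine Matrix.inv_eq_right_inv ?_
  rw [Matrix.diagonal_mul_diagonal, ← Matrix.diagonal_one]
  congr 1
  ext k
  fin_cases k <;> simp [h0]

theorem diagonal_mul_psi {h : ℝ} (h0 : 0 < h) (ξ : ℂ) :
    Matrix.diagonal ![(h : ℂ), 1, (h : ℂ)⁻¹] *
      (ξ • higgs₀ + conj ξ • adj (Matrix.diagonal ![(h : ℂ), 1, (h : ℂ)⁻¹]) higgs₀) =
      formMat h ξ := by
  have h0' : (h : ℂ) ≠ 0 := by exact_mod_cast h0.ne'
  unfold adj
  rw [inv_diagonal_metric h0']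
  ext a b
  rw [Matrix.diagonal_mul, Matrix.add_apply, Matrix.smul_apply, Matrix.smul_apply,
    Matrix.mul_diagonal, Matrix.diagonal_mul]
  fin_cases a <;> fin_cases b <;> simp [formMat, higgs₀] <;> field_simp

theorem pairing_mul_pairing : pairing * pairing = 1 := by
  ext a b
  fin_cases a <;> fin_cases b <;> simp [pairing, Matrix.mul_apply, Fin.sum_univ_three]

theorem pairing_transpose : pairingᵀ = pairing := by
  ext a b
  fin_cases a <;> fin_cases b <;> simp [pairing]

/-- Together with `diagonal_mul_psi`, this says that (Φ₀ + Φ₀*)(v) commutes with the antilinear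
involution σ, so that its matrix in a real frame is real. -/
theorem pairing_conj_psi {h : ℝ} (h0 : 0 < h) (ξ : ℂ) :
    pairing * (ξ • higgs₀ + conj ξ • adj (Matrix.diagonal ![(h : ℂ), 1, (h : ℂ)⁻¹]) higgs₀).map conj
      * pairing * Matrix.diagonal ![(h : ℂ), 1, (h : ℂ)⁻¹] = formMat h ξ := by
  have h0' : (h : ℂ) ≠ 0 := by exact_mod_cast h0.ne'
  have e : ξ • higgs₀ + conj ξ • adj (Matrix.diagonal ![(h : ℂ), 1, (h : ℂ)⁻¹]) higgs₀ =
      !![0, 0, conj ξ / h ^ 2; 0, 0, 0; ξ, 0, 0] := by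
    unfold adj
    rw [inv_diagonal_metric h0']
    ext a b
    rw [Matrix.add_apply, Matrix.smul_apply, Matrix.smul_apply,
      Matrix.mul_diagonal, Matrix.diagonal_mul]
    fin_cases a <;> fin_cases b <;> simp [higgs₀] <;> field_simp
  have e' : (!![0, 0, conj ξ / (h : ℂ) ^ 2; 0, 0, 0; ξ, 0, 0] : Mat ℂ).map conj =
      !![0, 0, ξ / (h : ℂ) ^ 2; 0, 0, 0; conj ξ, 0, 0] := by
    ext a b
    fin_cases a <;> fin_cases b <;> simp
  have e'' : pairing * !![0, 0, ξ / (h : ℂ) ^ 2; 0, 0, 0; conj ξ, 0, 0] * pairing =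
      !![0, 0, conj ξ; 0, 0, 0; ξ / (h : ℂ) ^ 2, 0, 0] := by
    ext a b
    fin_cases a <;> fin_cases b <;>
      simp [pairing, Matrix.mul_apply, Fin.sum_univ_three]
  rw [e, e', e'']
  ext a b
  rw [Matrix.mul_diagonal]
  fin_cases a <;> fin_cases b <;> simp [formMat, div_eq_mul_inv] <;> field_simp

theorem IsHarmonicMetric.h₁_trans (hH : IsHarmonicMetric θ t H) {i j : ι} {x : X}
    (hi : x ∈ (θ.chart i).source) (hj : x ∈ (θ.chart j).source) :
    (h₁ H j x : ℂ) = conj (θ.trans i j x) * θ.trans i j x * h₁ H i x := by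
  have hre : ∀ {i}, x ∈ (θ.chart i).source → H i x 0 0 = (h₁ H i x : ℂ) := fun {i} hi =>
    (Complex.conj_eq_iff_re.1 ((hH.posDef i x hi).isHermitian.apply 0 0)).symm
  have h := congrFun (congrFun (hH.transition i j x hi hj) 0) 0
  rw [SqrtCanonical.gauge, Matrix.diagonal_conjTranspose, Matrix.mul_diagonal,
    Matrix.diagonal_mul] at h
  rw [← hre hi, ← hre hj, h]
  simp
  ring

variable {p : S → X} {P : ι → S → Mat ℂ}

/-- The Gram matrix of the frame `P`. -/
def gram (H : ι → X → Mat ℂ) (p : S → X) (P : ι → S → Mat ℂ) (i : ι) (y : S) : Mat ℂ :=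
  (P i y)ᴴ * H i (p y) * P i y

theorem gram_conjTranspose (hH : IsHarmonicMetric θ t H) {i : ι}
    {y : S} (hi : p y ∈ (θ.chart i).source) : (gram H p P i y)ᴴ = gram H p P i y := by
  have h1 : (H i (p y))ᴴ = H i (p y) := (hH.posDef i _ hi).isHermitian
  unfold gram
  simp only [Matrix.conjTranspose_mul, Matrix.conjTranspose_conjTranspose, h1, Matrix.mul_assoc]

variable [TopologicalSpace S] [ChartedSpace ℂ S]

theorem contMDiffAt_mul {f g : S → ℂ} {y : S} (hf : ContMDiffAt 𝓘(ℝ, ℂ) 𝓘(ℝ, ℂ) ∞ f y)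
    (hg : ContMDiffAt 𝓘(ℝ, ℂ) 𝓘(ℝ, ℂ) ∞ g y) :
    ContMDiffAt 𝓘(ℝ, ℂ) 𝓘(ℝ, ℂ) ∞ (fun x => f x * g x) y :=
  (contDiff_mul (𝕜 := ℝ) (𝔸 := ℂ)).contMDiff.contMDiffAt.comp y (hf.prodMk_space hg)

namespace IsFlatRealFrame

theorem isUnit_det (hP : IsFlatRealFrame θ t H p P) {i : ι} {y : S}
    (hy : p y ∈ (θ.chart i).source) : IsUnit (P i y).det := by
  refine isUnit_iff_ne_zero.2 fun h => ?_
  have := hP.volume i y hy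
  rw [h, norm_zero] at this
  exact zero_ne_one this

theorem gram_eq_gram (hH : IsHarmonicMetric θ t H) (hP : IsFlatRealFrame θ t H p P) {i j : ι}
    {y : S} (hi : p y ∈ (θ.chart i).source) (hj : p y ∈ (θ.chart j).source) :
    gram H p P j y = gram H p P i y := by
  unfold gram
  rw [hH.transition i j _ hi hj, hP.transition i j y hi hj, Matrix.conjTranspose_mul]
  simp only [Matrix.mul_assoc]

theorem mul_eq_pairing_mul (hH : IsHarmonicMetric θ t H) (hP : IsFlatRealFrame θ t H p P) {i : ι}
    {y : S} (hi : p y ∈ (θ.chart i).source) :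
    H i (p y) * P i y = pairing * (P i y).map conj := by
  conv_lhs => rw [← hP.real i y hi]
  rw [Matrix.mul_assoc, Matrix.mul_nonsing_inv_cancel_left _ _
    (posDef_isUnit_det (hH.posDef i _ hi))]

/-- For a real frame HP = BP̄, so the Gram matrix is P*BP̄, which is symmetric because B is. A
matrix that is both Hermitian and symmetric is real. -/
theorem gram_map_conj (hH : IsHarmonicMetric θ t H) (hP : IsFlatRealFrame θ t H p P) {i : ι}
    {y : S} (hi : p y ∈ (θ.chart i).source) : (gram H p P i y).map conj = gram H p P i y := by
  have h1 : (gram H p P i y)ᵀ = gram H p P i y := by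
    have : gram H p P i y = (P i y)ᴴ * (pairing * (P i y).map conj) := by
      rw [← hP.mul_eq_pairing_mul hH hi, gram, Matrix.mul_assoc]
    rw [this, Matrix.transpose_mul, Matrix.transpose_mul, pairing_transpose, Matrix.mul_assoc]
    rfl
  conv_rhs => rw [← gram_conjTranspose hH hi]
  rw [Matrix.conjTranspose, h1]
  rfl

theorem cplx_harmonicMap (hH : IsHarmonicMetric θ t H) (hP : IsFlatRealFrame θ t H p P) {i : ι}
    {y : S} (hi : p y ∈ (θ.chart i).source) :
    cplx (harmonicMap θ H p P y) = gram H p P i y := by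
  rw [← hP.gram_eq_gram hH hi (θ.mem_source (p y))]
  exact cplx_map_re (hP.gram_map_conj hH (θ.mem_source (p y)))

theorem harmonicMap_mem_symSpace (hH : IsHarmonicMetric θ t H) (hD : IsDiagonalMetric θ H)
    (hP : IsFlatRealFrame θ t H p P) (y : S) : harmonicMap θ H p P y ∈ symSpace := by
  set i := θ.idx (p y)
  have hi : p y ∈ (θ.chart i).source := θ.mem_source (p y)
  constructor
  · apply posDef_of_cplx
    rw [hP.cplx_harmonicMap hH hi]
    refine (hH.posDef i _ hi).conjTranspose_mul_mul_same ?_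
    exact Matrix.mulVec_injective_iff_isUnit.2 ((Matrix.isUnit_iff_isUnit_det _).2
      (hP.isUnit_det hi))
  · have h0 : (h₁ H i (p y) : ℂ) ≠ 0 := by exact_mod_cast (hD i _ hi).1.ne'
    have h1 : (cplx (harmonicMap θ H p P y)).det = 1 := by
      rw [hP.cplx_harmonicMap hH hi, gram, Matrix.det_mul, Matrix.det_mul,
        Matrix.det_conjTranspose, (hD i _ hi).2, Matrix.det_diagonal]
      -- The determinant of the frame is only known up to a phase, but it enters the Gram
      -- determinant together with its conjugate.
      have h2 : star (P i y).det * (P i y).det = 1 := by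
        have := Complex.normSq_eq_conj_mul_self (z := (P i y).det)
        rw [Complex.normSq_eq_norm_sq, hP.volume i y hi] at this
        simpa using this.symm
      simp only [Fin.prod_univ_three, Matrix.cons_val_zero, Matrix.cons_val_one, Matrix.cons_val]
      rw [mul_one, mul_inv_cancel₀ h0, mul_one, h2]
    rw [cplx_det] at h1
    exact_mod_cast h1

/-- The complexification of `V(v)`, in the frame of index `i`. -/
theorem cplx_bundleMap_idx (hH : IsHarmonicMetric θ t H) (hD : IsDiagonalMetric θ H)
    (hP : IsFlatRealFrame θ t H p P) (y : S) (v : TangentSpace 𝓘(ℝ, ℂ) y) :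
    cplx (bundleMap θ H p P y v) = (-2 : ℂ) • ((P (θ.idx (p y)) y)ᴴ *
      formMat (h₁ H (θ.idx (p y)) (p y)) (dz θ p (θ.idx (p y)) y v) * P (θ.idx (p y)) y) := by
  unfold bundleMap
  set i := θ.idx (p y) with hi_def
  have hi : p y ∈ (θ.chart i).source := θ.mem_source (p y)
  set ξ := dz θ p i y v with hξ
  set ψ := psi₀ θ H p y v with hψ
  set A := (P i y)⁻¹ * ψ * P i y with hA
  have hPu := hP.isUnit_det hi
  obtain ⟨h0, hdiag⟩ := hD i _ hi
  have hHψ : H i (p y) * ψ = formMat (h₁ H i (p y)) ξ := by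
    rw [hψ, psi₀, ← hi_def, ← hξ, hdiag]; exact diagonal_mul_psi h0 ξ
  have hψc : pairing * ψ.map conj * pairing * H i (p y) = formMat (h₁ H i (p y)) ξ := by
    rw [hψ, psi₀, ← hi_def, ← hξ, hdiag]; exact pairing_conj_psi h0 ξ
  have hPA : P i y * A = ψ * P i y := by
    rw [hA, Matrix.mul_assoc, Matrix.mul_nonsing_inv_cancel_left _ _ hPu]
  have hPc : (P i y).map conj = pairing * (H i (p y) * P i y) := by
    rw [hP.mul_eq_pairing_mul hH hi, ← Matrix.mul_assoc, pairing_mul_pairing, Matrix.one_mul]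
  -- The endomorphism ψ commutes with σ and the columns of P are fixed by σ, so `Complex.re` in the
  -- definition of V loses nothing.
  have hAreal : A.map conj = A := by
    have e1 := congrArg (fun B : Mat ℂ => B.map conj) hPA
    simp only [map_conj_mul, hPc] at e1
    have e2 : H i (p y) * P i y * A.map conj = H i (p y) * P i y * A := by
      calc H i (p y) * P i y * A.map conj
          = (pairing * pairing) * (H i (p y) * P i y) * A.map conj := by
            rw [pairing_mul_pairing, Matrix.one_mul]
        _ = pairing * (pairing * (H i (p y) * P i y) * A.map conj) := by
            simp only [Matrix.mul_assoc]
        _ = (pairing * ψ.map conj * pairing * H i (p y)) * P i y := by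
            rw [e1]; simp only [Matrix.mul_assoc]
        _ = H i (p y) * (ψ * P i y) := by rw [hψc, ← hHψ, Matrix.mul_assoc]
        _ = H i (p y) * P i y * A := by rw [← hPA, Matrix.mul_assoc]
    have hu : IsUnit (H i (p y) * P i y).det := by
      rw [Matrix.det_mul]; exact (posDef_isUnit_det (hH.posDef i _ hi)).mul hPu
    have e3 := congrArg (fun B => (H i (p y) * P i y)⁻¹ * B) e2
    simpa only [Matrix.nonsing_inv_mul_cancel_left _ _ hu] using e3
  have hqA : cplx (harmonicMap θ H p P y) * cplx (A.map Complex.re) =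
      (P i y)ᴴ * formMat (h₁ H i (p y)) ξ * P i y := by
    rw [cplx_map_re hAreal, hP.cplx_harmonicMap hH hi, gram, Matrix.mul_assoc, hPA, ← hHψ]
    simp only [Matrix.mul_assoc]
  have hqsymm : (cplx (harmonicMap θ H p P y))ᴴ = cplx (harmonicMap θ H p P y) := by
    rw [hP.cplx_harmonicMap hH hi]; exact gram_conjTranspose hH hi
  -- Since ψ is self-adjoint for H, the two terms of the infinitesimal action agree; this is the
  -- origin of the factor −2.
  have hAq : cplx (A.map Complex.re)ᵀ * cplx (harmonicMap θ H p P y) =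
      (P i y)ᴴ * formMat (h₁ H i (p y)) ξ * P i y := by
    have := congrArg Matrix.conjTranspose hqA
    rw [Matrix.conjTranspose_mul, hqsymm, cplx_conjTranspose] at this
    rw [this]
    simp only [Matrix.conjTranspose_mul, Matrix.conjTranspose_conjTranspose,
      formMat_conjTranspose, Matrix.mul_assoc]
  rw [infAction, cplx_neg, cplx_add, cplx_mul, cplx_mul, hqA, hAq, ← two_smul ℂ, neg_smul]

/-- The changes of h₁, of dz and of P between two frames compensate. This matters because the chosen
index `θ.idx` may jump from point to point, whereas differentiation requires a single coordinate
near y. -/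
theorem cplx_bundleMap (hH : IsHarmonicMetric θ t H) (hD : IsDiagonalMetric θ H)
    (hp : IsLocalDiffeomorph 𝓘(ℝ, ℂ) 𝓘(ℝ, ℂ) ∞ p)
    (hP : IsFlatRealFrame θ t H p P) {i : ι} {y : S} (hi : p y ∈ (θ.chart i).source)
    (v : TangentSpace 𝓘(ℝ, ℂ) y) :
    cplx (bundleMap θ H p P y v) = (-2 : ℂ) • ((P i y)ᴴ *
      formMat (h₁ H i (p y)) (dz θ p i y v) * P i y) := by
  rw [hP.cplx_bundleMap_idx hH hD]
  set j := θ.idx (p y)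
  have hj : p y ∈ (θ.chart j).source := θ.mem_source (p y)
  have h0 := θ.trans_ne_zero hi hj
  have hh : (h₁ H i (p y) : ℂ) ≠ 0 := by exact_mod_cast (hD i _ hi).1.ne'
  have key : formMat (h₁ H j (p y)) (dz θ p j y v) = (θ.gauge i j (p y))ᴴ *
      formMat (h₁ H i (p y)) (dz θ p i y v) * θ.gauge i j (p y) := by
    have h0' : conj (θ.trans i j (p y)) ≠ 0 := (map_ne_zero _).2 h0
    unfold formMat
    rw [hH.h₁_trans hi hj, θ.dz_trans hp hi hj, SqrtCanonical.gauge,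
      Matrix.diagonal_conjTranspose]
    ext a b
    rw [Matrix.mul_diagonal, Matrix.diagonal_mul]
    fin_cases a <;> fin_cases b <;> simp <;> field_simp
  rw [key, hP.transition i j y hi hj, Matrix.conjTranspose_mul]
  simp only [Matrix.mul_assoc]

theorem formMat_eq_of_cplx (hP : IsFlatRealFrame θ t H p P) {i : ι} {y : S}
    (hi : p y ∈ (θ.chart i).source) {A B : Mat ℂ}
    (h : (-2 : ℂ) • ((P i y)ᴴ * A * P i y) = (-2 : ℂ) • ((P i y)ᴴ * B * P i y)) : A = B := by
  have hPu := hP.isUnit_det hi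
  have hPu' : IsUnit ((P i y)ᴴ).det := by rw [Matrix.det_conjTranspose]; exact hPu.star
  have h1 := smul_right_injective (Mat ℂ) (by norm_num : (-2 : ℂ) ≠ 0) h
  have h2 := congrArg (fun C => ((P i y)ᴴ)⁻¹ * (C * (P i y)⁻¹)) h1
  simpa only [Matrix.mul_nonsing_inv_cancel_right _ _ hPu,
    Matrix.nonsing_inv_mul_cancel_left _ _ hPu'] using h2

theorem isLinearMap_bundleMap (hH : IsHarmonicMetric θ t H) (hD : IsDiagonalMetric θ H)
    (hP : IsFlatRealFrame θ t H p P) (y : S) : IsLinearMap ℝ (bundleMap θ H p P y) := by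
  constructor
  · intro v w
    apply cplx_injective
    rw [cplx_add, hP.cplx_bundleMap_idx hH hD, hP.cplx_bundleMap_idx hH hD,
      hP.cplx_bundleMap_idx hH hD, θ.dz_add, formMat_add, Matrix.mul_add, Matrix.add_mul, smul_add]
  · intro c v
    apply cplx_injective
    rw [cplx_smul, hP.cplx_bundleMap_idx hH hD, hP.cplx_bundleMap_idx hH hD, θ.dz_smul,
      formMat_smul, Matrix.mul_smul, Matrix.smul_mul, smul_comm]

theorem injective_bundleMap (hH : IsHarmonicMetric θ t H) (hD : IsDiagonalMetric θ H)
    (hp : IsLocalDiffeomorph 𝓘(ℝ, ℂ) 𝓘(ℝ, ℂ) ∞ p)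
    (hP : IsFlatRealFrame θ t H p P) (y : S) : Function.Injective (bundleMap θ H p P y) := by
  intro v w h
  have hi := θ.mem_source (p y)
  have h1 := congrArg cplx h
  rw [hP.cplx_bundleMap_idx hH hD, hP.cplx_bundleMap_idx hH hD] at h1
  have h2 := congrFun (congrFun (hP.formMat_eq_of_cplx hi h1) 2) 0
  have hh : (h₁ H (θ.idx (p y)) (p y) : ℂ) ≠ 0 := by exact_mod_cast (hD _ _ hi).1.ne'
  simp only [formMat, Matrix.cons_val', Matrix.cons_val_zero, Matrix.cons_val,
    Matrix.of_apply] at h2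
  exact (θ.dz_bijective hp hi).1 ((div_left_inj' hh).1 h2)

theorem bundleMap_mem_symTangent (hH : IsHarmonicMetric θ t H) (hD : IsDiagonalMetric θ H)
    (hP : IsFlatRealFrame θ t H p P) (y : S) (v : TangentSpace 𝓘(ℝ, ℂ) y) :
    bundleMap θ H p P y v ∈ symTangent (harmonicMap θ H p P y) := by
  set i := θ.idx (p y) with hi_def
  have hi : p y ∈ (θ.chart i).source := θ.mem_source (p y)
  constructor
  · apply cplx_injective
    rw [← cplx_conjTranspose, hP.cplx_bundleMap_idx hH hD, Matrix.conjTranspose_smul,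
      Matrix.conjTranspose_mul, Matrix.conjTranspose_mul, formMat_conjTranspose,
      Matrix.conjTranspose_conjTranspose]
    simp [Matrix.mul_assoc]
  · have hq := posDef_isUnit_det (hP.harmonicMap_mem_symSpace hH hD y).1
    -- This product is conjugate to −2H⁻¹M, where M is the matrix `formMat`, and H⁻¹M has zero
    -- diagonal.
    have h1 : (cplx ((harmonicMap θ H p P y)⁻¹ * bundleMap θ H p P y v)).trace = 0 := by
      have hPu := hP.isUnit_det hi
      have hPu' : IsUnit ((P i y)ᴴ).det := by rw [Matrix.det_conjTranspose]; exact hPu.star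
      obtain ⟨h0, hdiag⟩ := hD i _ hi
      have h0' : (h₁ H i (p y) : ℂ) ≠ 0 := by exact_mod_cast h0.ne'
      rw [cplx_mul, cplx_inv _ hq, hP.cplx_harmonicMap hH hi, hP.cplx_bundleMap_idx hH hD, gram,
        Matrix.mul_inv_rev, Matrix.mul_inv_rev, Matrix.mul_smul, Matrix.trace_smul]
      have : (P i y)⁻¹ * ((H i (p y))⁻¹ * ((P i y)ᴴ)⁻¹) * ((P i y)ᴴ *
          formMat (h₁ H i (p y)) (dz θ p i y v) * P i y) =
          (P i y)⁻¹ * ((H i (p y))⁻¹ * (((P i y)ᴴ)⁻¹ * ((P i y)ᴴ *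
          (formMat (h₁ H i (p y)) (dz θ p i y v) * P i y)))) := by
        simp only [Matrix.mul_assoc]
      rw [this, Matrix.nonsing_inv_mul_cancel_left _ _ hPu', Matrix.trace_mul_comm,
        ← Matrix.mul_assoc (H i (p y))⁻¹, Matrix.mul_nonsing_inv_cancel_right _ _ hPu, hdiag,
        inv_diagonal_metric h0']
      simp [Matrix.trace, Fin.sum_univ_three, Matrix.diagonal_mul, formMat]
    rw [cplx_trace] at h1
    exact_mod_cast h1

theorem contMDiffAt_gram (hH : IsHarmonicMetric θ t H)
    (hp : IsLocalDiffeomorph 𝓘(ℝ, ℂ) 𝓘(ℝ, ℂ) ∞ p) (hP : IsFlatRealFrame θ t H p P) {i : ι} {y : S}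
    (hi : p y ∈ (θ.chart i).source) (a b : Fin 3) :
    ContMDiffAt 𝓘(ℝ, ℂ) 𝓘(ℝ, ℂ) ∞ (fun x => gram H p P i x a b) y := by
  have hPs : ∀ a b, ContMDiffAt 𝓘(ℝ, ℂ) 𝓘(ℝ, ℂ) ∞ (fun x => P i x a b) y := fun a b =>
    (hP.smooth i a b).contMDiffAt (θ.eventually_mem_source hp hi)
  have hPc : ∀ a b, ContMDiffAt 𝓘(ℝ, ℂ) 𝓘(ℝ, ℂ) ∞ (fun x => (P i x)ᴴ a b) y := fun a b =>
    (Complex.conjCLE : ℂ →L[ℝ] ℂ).contMDiff.contMDiffAt.comp y (hPs b a)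
  have hHs : ∀ a b, ContMDiffAt 𝓘(ℝ, ℂ) 𝓘(ℝ, ℂ) ∞ (fun x => H i (p x) a b) y := fun a b => by
    have h1 := (hH.contDiffAt_chart ((θ.chart i).map_source hi) a b).contMDiffAt
    refine (h1.comp y (θ.contMDiffAt_coord hp hi)).congr_of_eventuallyEq ?_
    filter_upwards [θ.eventually_mem_source hp hi] with x hx
    simp [(θ.chart i).left_inv hx]
  unfold gram
  simp only [Matrix.mul_apply]
  exact contMDiffAt_finsetSum fun k _ => contMDiffAt_mul
    (contMDiffAt_finsetSum fun l _ => contMDiffAt_mul (hPc a l) (hHs l k)) (hPs k b)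

theorem contMDiff_harmonicMap (hH : IsHarmonicMetric θ t H)
    (hp : IsLocalDiffeomorph 𝓘(ℝ, ℂ) 𝓘(ℝ, ℂ) ∞ p) (hP : IsFlatRealFrame θ t H p P)
    (a b : Fin 3) : ContMDiff 𝓘(ℝ, ℂ) 𝓘(ℝ, ℝ) ∞ fun y => harmonicMap θ H p P y a b := by
  intro y
  have hi := θ.mem_source (p y)
  refine (Complex.reCLM.contMDiff.contMDiffAt.comp y
    (hP.contMDiffAt_gram hH hp hi a b)).congr_of_eventuallyEq ?_
  filter_upwards [θ.eventually_mem_source hp hi] with x hx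
  have := congrFun (congrFun (hP.cplx_harmonicMap hH hx) a) b
  simp only [Function.comp_apply, ← this]
  simp [cplx]

end IsFlatRealFrame

end Frame

/-! ### The Levi-Civita connection of the symmetric space -/

section SymmetricSpace

theorem symTangent_add {q Y Z : Mat ℝ} (hY : Y ∈ symTangent q) (hZ : Z ∈ symTangent q) :
    Y + Z ∈ symTangent q :=
  ⟨by rw [Matrix.transpose_add, hY.1, hZ.1],
    by rw [Matrix.mul_add, Matrix.trace_add, hY.2, hZ.2, add_zero]⟩

theorem symTangent_smul {q Y : Mat ℝ} (c : ℝ) (hY : Y ∈ symTangent q) :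
    c • Y ∈ symTangent q :=
  ⟨by rw [Matrix.transpose_smul, hY.1],
    by rw [Matrix.mul_smul, Matrix.trace_smul, hY.2, smul_zero]⟩

theorem symTangent_zero (q : Mat ℝ) : (0 : Mat ℝ) ∈ symTangent q := by
  simp [symTangent]

theorem symMetric_comm (q Y Z : Mat ℝ) : symMetric q Y Z = symMetric q Z Y := by
  unfold symMetric
  rw [Matrix.mul_assoc (q⁻¹ * Y), Matrix.trace_mul_comm, ← Matrix.mul_assoc]

theorem symMetric_add_left (q Y Y' Z : Mat ℝ) :
    symMetric q (Y + Y') Z = symMetric q Y Z + symMetric q Y' Z := by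
  simp [symMetric, Matrix.mul_add, Matrix.add_mul]

theorem symMetric_smul_left (q Y Z : Mat ℝ) (c : ℝ) :
    symMetric q (c • Y) Z = c * symMetric q Y Z := by
  simp [symMetric]

theorem symMetric_add_right (q Y Z Z' : Mat ℝ) :
    symMetric q Y (Z + Z') = symMetric q Y Z + symMetric q Y Z' := by
  simp [symMetric, Matrix.mul_add]

theorem symMetric_smul_right (q Y Z : Mat ℝ) (c : ℝ) :
    symMetric q Y (c • Z) = c * symMetric q Y Z := by
  simp [symMetric]

theorem eq_zero_of_symMetric_self {q Y : Mat ℝ} (hq : q ∈ symSpace) (hY : Yᵀ = Y)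
    (h : symMetric q Y Y = 0) : Y = 0 := by
  refine (trace_weighted_nonneg hq.1.inv hq.1.inv Y).2 ?_
  rw [Matrix.conjTranspose_eq_transpose_of_trivial, hY, Matrix.trace_mul_comm]
  simpa [symMetric, Matrix.mul_assoc] using h

theorem congr_mem_symSpace {q g : Mat ℝ} (hq : q ∈ symSpace) (hg : g.det = 1) :
    gᵀ * q * g ∈ symSpace := by
  constructor
  · have := hq.1.conjTranspose_mul_mul_same (B := g) (Matrix.mulVec_injective_iff_isUnit.2
      ((Matrix.isUnit_iff_isUnit_det _).2 (by simp [hg])))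
    rwa [Matrix.conjTranspose_eq_transpose_of_trivial] at this
  · simp [hg, hq.2]

theorem inv_congr_mul_congr {q g : Mat ℝ} (hg : g.det = 1) (Y : Mat ℝ) :
    (gᵀ * q * g)⁻¹ * (gᵀ * Y * g) = g⁻¹ * (q⁻¹ * Y) * g := by
  have hgt : IsUnit gᵀ.det := by simp [hg]
  rw [Matrix.mul_inv_rev, Matrix.mul_inv_rev]
  calc g⁻¹ * (q⁻¹ * gᵀ⁻¹) * (gᵀ * Y * g) = g⁻¹ * (q⁻¹ * (gᵀ⁻¹ * (gᵀ * (Y * g)))) := by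
        simp only [Matrix.mul_assoc]
    _ = g⁻¹ * (q⁻¹ * Y) * g := by
        rw [Matrix.nonsing_inv_mul_cancel_left _ _ hgt]; simp only [Matrix.mul_assoc]

theorem congr_mem_symTangent {q g Y : Mat ℝ} (hg : g.det = 1) (hY : Y ∈ symTangent q) :
    gᵀ * Y * g ∈ symTangent (gᵀ * q * g) := by
  constructor
  · simp [Matrix.mul_assoc, hY.1]
  · rw [inv_congr_mul_congr hg, Matrix.trace_mul_comm,
      Matrix.mul_nonsing_inv_cancel_left _ _ (by simp [hg]), hY.2]

theorem symMetric_congr {q g : Mat ℝ} (hg : g.det = 1) (Y Z : Mat ℝ) :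
    symMetric (gᵀ * q * g) (gᵀ * Y * g) (gᵀ * Z * g) = symMetric q Y Z := by
  have hg' : IsUnit g.det := by simp [hg]
  have : ∀ q Y Z : Mat ℝ, symMetric q Y Z = ((q⁻¹ * Y) * (q⁻¹ * Z)).trace := fun q Y Z => by
    simp only [symMetric, Matrix.mul_assoc]
  rw [this, this, inv_congr_mul_congr hg, inv_congr_mul_congr hg,
    show g⁻¹ * (q⁻¹ * Y) * g * (g⁻¹ * (q⁻¹ * Z) * g) =
      g⁻¹ * ((q⁻¹ * Y) * (g * (g⁻¹ * ((q⁻¹ * Z) * g)))) by simp only [Matrix.mul_assoc],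
    Matrix.mul_nonsing_inv_cancel_left _ _ hg', Matrix.trace_mul_comm,
    ← Matrix.mul_assoc, Matrix.mul_nonsing_inv_cancel_right _ _ hg']

/-- The orbit of the symmetric matrix `Y` under the one-parameter group generated by a nilpotent
`X` of order two. -/
def unipotentOrbit (X Y : Mat ℝ) (s : ℝ) : Mat ℝ := (1 + s • X)ᵀ * Y * (1 + s • X)

theorem unipotentOrbit_eq (X Y : Mat ℝ) (s : ℝ) :
    unipotentOrbit X Y s = Y + s • (Xᵀ * Y + Y * X) + s ^ 2 • (Xᵀ * Y * X) := by
  unfold unipotentOrbit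
  simp only [Matrix.transpose_add, Matrix.transpose_one, Matrix.transpose_smul, Matrix.add_mul,
    Matrix.mul_add, Matrix.one_mul, Matrix.mul_one, Matrix.smul_mul, Matrix.mul_smul, smul_add,
    smul_smul, pow_two]
  abel

theorem unipotentOrbit_zero (X Y : Mat ℝ) : unipotentOrbit X Y 0 = Y := by
  simp [unipotentOrbit]

theorem smoothCurve_unipotentOrbit (X Y : Mat ℝ) : SmoothCurve (unipotentOrbit X Y) := by
  intro a b
  simp only [unipotentOrbit_eq, Matrix.add_apply, Matrix.smul_apply, smul_eq_mul]
  fun_prop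

theorem curveD_unipotentOrbit (X Y : Mat ℝ) :
    curveD (unipotentOrbit X Y) 0 = Xᵀ * Y + Y * X := by
  ext a b
  simp only [curveD, Matrix.of_apply, unipotentOrbit_eq]
  generalize Xᵀ * Y + Y * X = W
  have h : HasDerivAt (fun s : ℝ => Y a b + s * W a b + s ^ 2 * (Xᵀ * Y * X) a b)
      (0 + 1 * W a b + ((2 : ℕ) * (0 : ℝ) ^ (2 - 1) * 1) * (Xᵀ * Y * X) a b) 0 :=
    (((hasDerivAt_const _ _).add ((hasDerivAt_id (0 : ℝ)).mul_const _))).add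
      (((hasDerivAt_id (0 : ℝ)).pow 2).mul_const _)
  simpa using h.deriv

/-- The infinitesimal action of `X` on the tangent bundle, corrected by `Γ`. -/
def invariantDefect (Γ : Mat ℝ → Mat ℝ →ₗ[ℝ] Mat ℝ →ₗ[ℝ] Mat ℝ) (q X Y : Mat ℝ) : Mat ℝ :=
  Xᵀ * Y + Y * X + Γ q (Xᵀ * q + q * X) Y

theorem invariantDefect_add (Γ : Mat ℝ → Mat ℝ →ₗ[ℝ] Mat ℝ →ₗ[ℝ] Mat ℝ) (q X X' Y : Mat ℝ) :
    invariantDefect Γ q (X + X') Y = invariantDefect Γ q X Y + invariantDefect Γ q X' Y := by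
  unfold invariantDefect
  rw [show (X + X')ᵀ * q + q * (X + X') = (Xᵀ * q + q * X) + (X'ᵀ * q + q * X') by
    simp only [Matrix.transpose_add, Matrix.add_mul, Matrix.mul_add]; abel, map_add,
    LinearMap.add_apply]
  simp only [Matrix.transpose_add, Matrix.add_mul, Matrix.mul_add]
  abel

theorem invariantDefect_smul (Γ : Mat ℝ → Mat ℝ →ₗ[ℝ] Mat ℝ →ₗ[ℝ] Mat ℝ) (c : ℝ) (q X Y : Mat ℝ) :
    invariantDefect Γ q (c • X) Y = c • invariantDefect Γ q X Y := by
  unfold invariantDefect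
  rw [show (c • X)ᵀ * q + q * (c • X) = c • (Xᵀ * q + q * X) by simp, map_smul,
    LinearMap.smul_apply]
  simp

variable {Γ : Mat ℝ → Mat ℝ →ₗ[ℝ] Mat ℝ →ₗ[ℝ] Mat ℝ} {q : Mat ℝ}

/-- The matrices whose infinitesimal action preserves tangency and the metric, as it
is seen by `Γ`. -/
def metricGenerators (Γ : Mat ℝ → Mat ℝ →ₗ[ℝ] Mat ℝ →ₗ[ℝ] Mat ℝ) (q : Mat ℝ) :
    Submodule ℝ (Mat ℝ) where
  carrier := {X | ∀ Y ∈ symTangent q, invariantDefect Γ q X Y ∈ symTangent q ∧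
    ∀ Z ∈ symTangent q,
      symMetric q (invariantDefect Γ q X Y) Z + symMetric q Y (invariantDefect Γ q X Z) = 0}
  add_mem' := by
    intro X X' hX hX' Y hY
    simp only [invariantDefect_add]
    refine ⟨symTangent_add (hX Y hY).1 (hX' Y hY).1, fun Z hZ => ?_⟩
    rw [symMetric_add_left, symMetric_add_right]
    linarith [(hX Y hY).2 Z hZ, (hX' Y hY).2 Z hZ]
  zero_mem' := by
    intro Y hY
    have h : ∀ Y, invariantDefect Γ q 0 Y = 0 := fun Y => by simp [invariantDefect]
    simp only [h]
    exact ⟨symTangent_zero q, fun Z hZ => by simp [symMetric]⟩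
  smul_mem' := by
    intro c X hX Y hY
    simp only [invariantDefect_smul]
    refine ⟨symTangent_smul c (hX Y hY).1, fun Z hZ => ?_⟩
    rw [symMetric_smul_left, symMetric_smul_right, ← mul_add, (hX Y hY).2 Z hZ, mul_zero]

/-- Since v · u = 0, the matrix X squares to zero and 1 + sX is a one-parameter group of determinant
one. It moves q, Y and Z along polynomial curves on which their inner product is constant, and the
axioms for Γ along these curves at s = 0 give the claim. No extension of tangent vectors to vector
fields is needed. -/
theorem vecMulVec_mem_metricGenerators (hΓ : IsSymLeviCivita Γ) (hq : q ∈ symSpace)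
    {u v : Fin 3 → ℝ} (huv : v ⬝ᵥ u = 0) : Matrix.vecMulVec u v ∈ metricGenerators Γ q := by
  set X := Matrix.vecMulVec u v with hX
  have hdet : ∀ s : ℝ, (1 + s • X).det = 1 := fun s => by
    have huv' : v 0 * u 0 + v 1 * u 1 + v 2 * u 2 = 0 := by
      simpa [dotProduct, Fin.sum_univ_three] using huv
    rw [Matrix.det_fin_three]
    simp [hX, Matrix.vecMulVec_apply]
    linear_combination s * huv'
  have hc : ∀ s, unipotentOrbit X q s ∈ symSpace := fun s => congr_mem_symSpace hq (hdet s)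
  have ht : ∀ Y ∈ symTangent q, ∀ s, unipotentOrbit X Y s ∈ symTangent (unipotentOrbit X q s) :=
    fun Y hY s => congr_mem_symTangent (hdet s) hY
  have hcov : ∀ Y, covCurve Γ (unipotentOrbit X q) (unipotentOrbit X Y) 0 =
      invariantDefect Γ q X Y := fun Y => by
    rw [covCurve, curveD_unipotentOrbit, curveD_unipotentOrbit, unipotentOrbit_zero,
      unipotentOrbit_zero, invariantDefect]
  intro Y hY
  constructor
  · have := hΓ.tangent _ _ (smoothCurve_unipotentOrbit X q) (smoothCurve_unipotentOrbit X Y) hc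
      (ht Y hY) 0
    rwa [hcov, unipotentOrbit_zero] at this
  · intro Z hZ
    have := hΓ.metric _ _ _ (smoothCurve_unipotentOrbit X q) (smoothCurve_unipotentOrbit X Y)
      (smoothCurve_unipotentOrbit X Z) hc (ht Y hY) (ht Z hZ) 0
    rw [hcov, hcov, unipotentOrbit_zero, unipotentOrbit_zero, unipotentOrbit_zero] at this
    rw [← this]
    have hconst : (fun r => symMetric (unipotentOrbit X q r) (unipotentOrbit X Y r)
        (unipotentOrbit X Z r)) = fun _ => symMetric q Y Z :=
      funext fun r => symMetric_congr (hdet r) Y Z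
    rw [hconst, deriv_const]

/-- The conditions are linear in X, and nilpotent matrices of rank one span sl(3, ℝ). -/
theorem mem_metricGenerators (hΓ : IsSymLeviCivita Γ) (hq : q ∈ symSpace) {X : Mat ℝ}
    (hX : X.trace = 0) : X ∈ metricGenerators Γ q := by
  -- The first two matrices produce the diagonal, by tracelessness; the six off-diagonal elementary
  -- matrices correct what they add elsewhere.
  have key : X =
      X 0 0 • Matrix.vecMulVec ![1, 1, 0] ![1, -1, 0] +
      X 2 2 • Matrix.vecMulVec ![0, 1, 1] ![0, -1, 1] +
      (X 0 1 + X 0 0) • Matrix.vecMulVec ![1, 0, 0] ![0, 1, 0] +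
      X 0 2 • Matrix.vecMulVec ![1, 0, 0] ![0, 0, 1] +
      (X 1 0 - X 0 0) • Matrix.vecMulVec ![0, 1, 0] ![1, 0, 0] +
      (X 1 2 - X 2 2) • Matrix.vecMulVec ![0, 1, 0] ![0, 0, 1] +
      X 2 0 • Matrix.vecMulVec ![0, 0, 1] ![1, 0, 0] +
      (X 2 1 + X 2 2) • Matrix.vecMulVec ![0, 0, 1] ![0, 1, 0] := by
    have hX' : X 0 0 + X 1 1 + X 2 2 = 0 := by
      simpa [Matrix.trace, Fin.sum_univ_three] using hX
    ext a b
    fin_cases a <;> fin_cases b <;> simp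
    linarith
  have hmem : ∀ u v : Fin 3 → ℝ, v ⬝ᵥ u = 0 → ∀ c : ℝ,
      c • Matrix.vecMulVec u v ∈ metricGenerators Γ q := fun u v h c =>
    Submodule.smul_mem _ c (vecMulVec_mem_metricGenerators hΓ hq h)
  rw [key]
  refine add_mem (add_mem (add_mem (add_mem (add_mem (add_mem (add_mem ?_ ?_) ?_) ?_) ?_) ?_) ?_) ?_
    <;> exact hmem _ _ (by simp [dotProduct, Fin.sum_univ_three]) _

/-- The Christoffel symbol of the symmetric space. -/
theorem IsSymLeviCivita.eq (hΓ : IsSymLeviCivita Γ) (hq : q ∈ symSpace) {W Y : Mat ℝ}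
    (hW : W ∈ symTangent q) (hY : Y ∈ symTangent q) :
    Γ q W Y = -((1 / 2 : ℝ) • (W * q⁻¹ * Y + Y * q⁻¹ * W)) := by
  have hqu := posDef_isUnit_det hq.1
  have hqt : q⁻¹ᵀ = q⁻¹ := by
    have := hq.1.inv.isHermitian
    rwa [Matrix.IsHermitian, Matrix.conjTranspose_eq_transpose_of_trivial] at this
  -- N is the discrepancy with the claimed formula. It is symmetric because Γ is torsion-free, and
  -- skew for the metric because q⁻¹W/2 is a traceless generator of the tangent vector W. As in the
  -- Koszul formula, a tensor with both properties is zero.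
  set N : Mat ℝ → Mat ℝ → Mat ℝ := fun W Y =>
    (1 / 2 : ℝ) • (W * q⁻¹ * Y + Y * q⁻¹ * W) + Γ q W Y with hN
  have hdefect : ∀ W ∈ symTangent q, ∀ Y,
      invariantDefect Γ q ((1 / 2 : ℝ) • (q⁻¹ * W)) Y = N W Y := by
    intro W hW Y
    have h1 : ((1 / 2 : ℝ) • (q⁻¹ * W))ᵀ = (1 / 2 : ℝ) • (W * q⁻¹) := by
      rw [Matrix.transpose_smul, Matrix.transpose_mul, hW.1, hqt]
    have h2 : ((1 / 2 : ℝ) • (q⁻¹ * W))ᵀ * q + q * ((1 / 2 : ℝ) • (q⁻¹ * W)) = W := by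
      rw [h1, Matrix.smul_mul, Matrix.mul_smul, Matrix.nonsing_inv_mul_cancel_right _ _ hqu,
        Matrix.mul_nonsing_inv_cancel_left _ _ hqu, ← add_smul]
      norm_num
    rw [invariantDefect, h2, h1, hN]
    simp only [Matrix.smul_mul, Matrix.mul_smul, smul_add, Matrix.mul_assoc]
  have hmem : ∀ W ∈ symTangent q, (1 / 2 : ℝ) • (q⁻¹ * W) ∈ metricGenerators Γ q :=
    fun W hW => mem_metricGenerators hΓ hq (by rw [Matrix.trace_smul, hW.2, smul_zero])
  have htan : ∀ W ∈ symTangent q, ∀ Y ∈ symTangent q, N W Y ∈ symTangent q := fun W hW Y hY => by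
    rw [← hdefect W hW]; exact (hmem W hW Y hY).1
  have hskew : ∀ W ∈ symTangent q, ∀ Y ∈ symTangent q, ∀ Z ∈ symTangent q,
      symMetric q (N W Y) Z = -symMetric q (N W Z) Y := fun W hW Y hY Z hZ => by
    have := (hmem W hW Y hY).2 Z hZ
    rw [hdefect W hW, hdefect W hW, symMetric_comm q Y] at this
    linarith
  have hsymm : ∀ W ∈ symTangent q, ∀ Y ∈ symTangent q, N W Y = N Y W := fun W hW Y hY => by
    simp only [hN]
    rw [hΓ.torsion_free q hq W hW Y hY, add_comm (W * q⁻¹ * Y)]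
  have hzero : N W Y = 0 := by
    refine eq_zero_of_symMetric_self hq (htan W hW Y hY).1 ?_
    have hZ := htan W hW Y hY
    generalize hZdef : N W Y = Z at hZ
    rw [← hZdef]
    have e1 := hskew W hW Y hY (N W Y) (hZdef ▸ hZ)
    rw [hZdef] at e1 ⊢
    have e2 := hskew Z hZ W hW Y hY
    have e3 := hskew Y hY Z hZ W hW
    rw [hsymm W hW Z hZ] at e1
    rw [hsymm Z hZ Y hY] at e2
    rw [hsymm Y hY W hW, hZdef] at e3
    linarith
  exact eq_neg_of_add_eq_zero_right hzero

end SymmetricSpace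

/-! ### Coordinates on the surface -/

section SurfaceConnection

variable {ι X S : Type*} [TopologicalSpace X] [ChartedSpace ℂ X] {θ : SqrtCanonical ι X}
  {t : ι → X → ℂ} {H : ι → X → Mat ℂ} [TopologicalSpace S] [ChartedSpace ℂ S] {p : S → X}

/-- The coefficient of `dz_i` in `∂ log h₁`. -/
def logCoeff (θ : SqrtCanonical ι X) (H : ι → X → Mat ℂ) (i : ι) (x : X) : ℂ :=
  chernForm θ H i (θ.chart i x) 0 0

/-- The definition of the Chern form A gives ∂H = HA, and ∂̄H is its adjoint because H is Hermitian.
-/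
theorem IsHarmonicMetric.hasMatDeriv_comp (hH : IsHarmonicMetric θ t H)
    (hp : IsLocalDiffeomorph 𝓘(ℝ, ℂ) 𝓘(ℝ, ℂ) ∞ p) {i : ι} {y : S} (hi : p y ∈ (θ.chart i).source)
    (u : TangentSpace 𝓘(ℝ, ℂ) y) :
    HasMatDeriv (fun x => H i (p x)) y u
      (dz θ p i y u • (H i (p y) * chernForm θ H i (θ.chart i (p y))) +
        conj (dz θ p i y u) • ((chernForm θ H i (θ.chart i (p y)))ᴴ * H i (p y))) := by
  set F : ℂ → Mat ℂ := fun w => H i ((θ.chart i).symm w) with hF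
  set z := θ.chart i (p y) with hz
  have hzt : z ∈ (θ.chart i).target := (θ.chart i).map_source hi
  have hd : ∀ a b, DifferentiableAt ℝ (fun w => F w a b) z := fun a b =>
    (hH.contDiffAt_chart hzt a b).differentiableAt (by simp)
  have hFz : F z = H i (p y) := by simp [hF, hz, (θ.chart i).left_inv hi]
  have h1 : matDZ F z = H i (p y) * chernForm θ H i z := by
    rw [← hFz]; exact matDZ_eq_mul_connForm (hH.posDef_chart hzt)
  have h2 : matDZbar F z = (chernForm θ H i z)ᴴ * H i (p y) := by
    have e : matDZbar (fun w => (F w)ᴴ) z = matDZbar F z := (matDZ_congr (by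
      filter_upwards [(θ.chart i).open_target.mem_nhds hzt] with w hw
      exact (hH.posDef_chart hw).isHermitian)).2
    rw [← e, (matDZ_conjTranspose hd).2, h1, Matrix.conjTranspose_mul,
      (hH.posDef i _ hi).isHermitian]
  have h3 : HasMatDeriv (fun x => F (θ.chart i (p x))) y u
      (dz θ p i y u • matDZ F z + conj (dz θ p i y u) • matDZbar F z) := by
    intro a b
    have := HasDirDeriv.comp_fderiv (v := u) (hd a b) (θ.mdifferentiableAt_coord hp hi)
    exact ⟨this.1, this.2.trans (fderiv_apply_eq_dZ (fun w => F w a b) z (dz θ p i y u))⟩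
  rw [h1, h2] at h3
  refine h3.congr ?_
  filter_upwards [θ.eventually_mem_source hp hi] with x hx
  simp [hF, (θ.chart i).left_inv hx]

/-- The Chern connection of a diagonal metric is diagonal. -/
theorem chernForm_eq_diagonal (hH : IsHarmonicMetric θ t H) (hD : IsDiagonalMetric θ H) {i : ι}
    {x : X} (hi : x ∈ (θ.chart i).source) :
    chernForm θ H i (θ.chart i x) = Matrix.diagonal ![logCoeff θ H i x, 0, -logCoeff θ H i x] := by
  set F : ℂ → Mat ℂ := fun w => H i ((θ.chart i).symm w) with hF
  set z := θ.chart i x with hz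
  have hzt : z ∈ (θ.chart i).target := (θ.chart i).map_source hi
  have hd : ∀ a b, DifferentiableAt ℝ (fun w => F w a b) z := fun a b =>
    (hH.contDiffAt_chart hzt a b).differentiableAt (by simp)
  have hx : (θ.chart i).symm z = x := by rw [hz, (θ.chart i).left_inv hi]
  obtain ⟨h0, hdiag⟩ := hD i x hi
  set c : ℂ := (h₁ H i x : ℂ) with hc
  have hc0 : c ≠ 0 := Complex.ofReal_ne_zero.2 h0.ne'
  set k : ℂ := dZ (fun w => F w 0 0) z with hk
  have hF00 : F z 0 0 = c := by
    simp only [hF, hx]; rw [hdiag]; simp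
  have hder : matDZ F z = Matrix.diagonal ![k, 0, -(k / c ^ 2)] := by
    have e1 : ∀ᶠ w in 𝓝 z, F w = Matrix.diagonal ![F w 0 0, 1, (F w 0 0)⁻¹] := by
      filter_upwards [(θ.chart i).open_target.mem_nhds hzt] with w hw
      have e := (hD i _ ((θ.chart i).map_target hw)).2
      have e' : F w 0 0 = (h₁ H i ((θ.chart i).symm w) : ℂ) := by
        simp only [hF]; rw [e]; simp
      rw [e']; exact e
    have e2 : matDZ (fun w => Matrix.diagonal ![F w 0 0, 1, (F w 0 0)⁻¹]) z =
        Matrix.diagonal ![k, 0, -(k / c ^ 2)] := by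
      refine (HasMatDeriv.matDZ_eq (B := Matrix.diagonal ![dZbar (fun w => F w 0 0) z, 0,
        -(dZbar (fun w => F w 0 0) z / c ^ 2)]) fun ζ => ?_).1
      have e00 : HasDirDeriv (fun w => F w 0 0) z (ζ : TangentSpace 𝓘(ℝ, ℂ) z)
        (ζ * k + conj ζ * dZbar (fun w => F w 0 0) z) := hasMatDeriv_matDZ hd ζ 0 0
      have e22 := e00.inv (by rw [hF00]; exact hc0)
      rw [hF00] at e22
      intro a b
      fin_cases a <;> fin_cases b <;> simp
      any_goals exact hasDirDeriv_const _
      · exact e00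
      · convert e22 using 1
        ring
    rw [(matDZ_congr e1).1, e2]
  have hA : chernForm θ H i z = Matrix.diagonal ![c⁻¹ * k, 0, -(c⁻¹ * k)] := by
    unfold chernForm
    rw [hder, hx, hdiag, inv_diagonal_metric hc0, Matrix.diagonal_mul_diagonal]
    congr 1
    ext j
    fin_cases j <;> simp
    field_simp
  have ha : logCoeff θ H i x = c⁻¹ * k := by
    unfold logCoeff
    rw [← hz, hA]; simp
  rw [hA, ha]

theorem hasDirDeriv_h₁ (hH : IsHarmonicMetric θ t H) (hD : IsDiagonalMetric θ H)
    (hp : IsLocalDiffeomorph 𝓘(ℝ, ℂ) 𝓘(ℝ, ℂ) ∞ p) {i : ι} {y : S} (hi : p y ∈ (θ.chart i).source)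
    (u : TangentSpace 𝓘(ℝ, ℂ) y) :
    HasDirDeriv (fun x => h₁ H i (p x)) y u
      (2 * h₁ H i (p y) * (dz θ p i y u * logCoeff θ H i (p y)).re) := by
  have h := (hH.hasMatDeriv_comp hp hi u 0 0).re
  refine ⟨h.1, Eq.trans (α := ℝ) h.2 ?_⟩
  rw [chernForm_eq_diagonal hH hD hi, (hD i _ hi).2, Matrix.diagonal_conjTranspose]
  generalize dz θ p i y u = ξ
  simp
  ring

/-- The vector field with constant coordinate `c` in the coordinate `z_i`. -/
def coordField (θ : SqrtCanonical ι X) (p : S → X) (i : ι) (c : ℂ) :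
    ∀ y : S, TangentSpace 𝓘(ℝ, ℂ) y :=
  VectorField.mpullback 𝓘(ℝ, ℂ) 𝓘(ℝ, ℂ) (fun x => θ.chart i (p x)) fun _ => c

theorem dz_coordField (hp : IsLocalDiffeomorph 𝓘(ℝ, ℂ) 𝓘(ℝ, ℂ) ∞ p) {i : ι} {y : S}
    (hi : p y ∈ (θ.chart i).source) (c : ℂ) : dz θ p i y (coordField θ p i c y) = c :=
  (θ.isInvertible_mfderiv_coord hp hi).self_apply_inverse c

theorem mdifferentiableAt_constField (c z : ℂ) :
    MDifferentiableAt 𝓘(ℝ, ℂ) (𝓘(ℝ, ℂ).prod 𝓘(ℝ, ℂ))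
      (fun x => (Bundle.TotalSpace.mk' ℂ x c : TangentBundle 𝓘(ℝ, ℂ) ℂ)) z :=
  (contMDiffAt_vectorSpace_iff_contDiffAt (n := 1).2 contDiffAt_const).mdifferentiableAt one_ne_zero

variable [IsManifold 𝓘(ℝ, ℂ) ∞ S]

theorem SecDiffAt.mdifferentiableAt_dz {v : ∀ y : S, TangentSpace 𝓘(ℝ, ℂ) y} {y : S}
    (hv : SecDiffAt v y) (hp : IsLocalDiffeomorph 𝓘(ℝ, ℂ) 𝓘(ℝ, ℂ) ∞ p) {i : ι}
    (hi : p y ∈ (θ.chart i).source) :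
    MDifferentiableAt 𝓘(ℝ, ℂ) 𝓘(ℝ, ℂ) (fun x => dz θ p i x (v x)) y := by
  have hf := θ.contMDiffAt_coord hp hi
  have h1 := ContMDiffAt.mfderiv_const (m := 1) hf (by norm_cast)
  have h2 := MDifferentiableAt.clm_apply_of_inCoordinates (h1.mdifferentiableAt one_ne_zero) hv
    (hf.mdifferentiableAt (by simp))
  exact ((contMDiff_snd_tangentBundle_modelSpace ℂ 𝓘(ℝ, ℂ)).contMDiffAt.mdifferentiableAt
    (n := 1) one_ne_zero).comp y h2

theorem secDiffAt_coordField (hp : IsLocalDiffeomorph 𝓘(ℝ, ℂ) 𝓘(ℝ, ℂ) ∞ p) {i : ι} {y : S}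
    (hi : p y ∈ (θ.chart i).source) (c : ℂ) : SecDiffAt (coordField θ p i c) y :=
  MDifferentiableAt.mpullback_vectorField (mdifferentiableAt_constField c _)
    (θ.contMDiffAt_coord hp hi) (θ.isInvertible_mfderiv_coord hp hi) (by norm_cast)

theorem mlieBracket_constField (c d z : ℂ) :
    VectorField.mlieBracket 𝓘(ℝ, ℂ) (fun x : ℂ => (c : TangentSpace 𝓘(ℝ, ℂ) x))
      (fun x : ℂ => (d : TangentSpace 𝓘(ℝ, ℂ) x)) z = 0 := by
  have h := congrFun (VectorField.mlieBracketWithin_eq_lieBracketWithin (𝕜 := ℝ)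
    (V := fun x : ℂ => (c : TangentSpace 𝓘(ℝ, ℂ) x))
    (W := fun x : ℂ => (d : TangentSpace 𝓘(ℝ, ℂ) x)) (s := Set.univ)) z
  refine (congrFun VectorField.mlieBracketWithin_univ.symm z).trans (h.trans ?_)
  have h0 : ∀ a : ℂ, fderivWithin ℝ (fun _ : ℂ => a) Set.univ z = 0 := fun a => by simp
  refine (congrArg₂ (· - ·) (congrArg (· c) (h0 d)) (congrArg (· d) (h0 c))).trans ?_
  exact sub_self (0 : ℂ)

/-- The Lie bracket is natural under pull-back by the local diffeomorphism z_i ∘ p, and constant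
fields on ℂ commute. -/
theorem mlieBracket_coordField (hp : IsLocalDiffeomorph 𝓘(ℝ, ℂ) 𝓘(ℝ, ℂ) ∞ p) {i : ι} {y : S}
    (hi : p y ∈ (θ.chart i).source) (c d : ℂ) :
    VectorField.mlieBracket 𝓘(ℝ, ℂ) (coordField θ p i c) (coordField θ p i d) y = 0 := by
  have : IsManifold 𝓘(ℝ, ℂ) (minSmoothness ℝ 2) S := by
    rw [minSmoothness_of_isRCLikeNormedField]; infer_instance
  have : IsManifold 𝓘(ℝ, ℂ) (minSmoothness ℝ 2) ℂ := by
    rw [minSmoothness_of_isRCLikeNormedField]; infer_instance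
  have h := VectorField.mpullback_mlieBracket (mdifferentiableAt_constField c _)
    (mdifferentiableAt_constField d _) (θ.contMDiffAt_coord hp hi) (by simp; norm_cast)
  refine h.symm.trans ?_
  rw [VectorField.mpullback_apply]
  exact (congrArg _ (mlieBracket_constField c d _)).trans (map_zero _)

end SurfaceConnection

/-! ### The Levi-Civita connection of the conformal metric -/

section LeviCivita

variable {ι X S : Type*} [TopologicalSpace X] [ChartedSpace ℂ X] {θ : SqrtCanonical ι X}
  {t : ι → X → ℂ} {H : ι → X → Mat ℂ} [TopologicalSpace S] [ChartedSpace ℂ S] {p : S → X}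

/-- With τ the transition function, h₁ scales by |τ|² and dz by τ², so the factors |τ|⁴ cancel. The
chosen index `θ.idx` can thus be replaced by a fixed coordinate. -/
theorem IsHarmonicMetric.surfaceMetric_eq (hH : IsHarmonicMetric θ t H) (hD : IsDiagonalMetric θ H)
    (hp : IsLocalDiffeomorph 𝓘(ℝ, ℂ) 𝓘(ℝ, ℂ) ∞ p) {i : ι} {y : S} (hi : p y ∈ (θ.chart i).source)
    (u v : TangentSpace 𝓘(ℝ, ℂ) y) :
    surfaceMetric θ H p y u v =
      (h₁ H i (p y) ^ 2)⁻¹ * (dz θ p i y u * conj (dz θ p i y v)).re := by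
  unfold surfaceMetric
  have hj := θ.mem_source (p y)
  generalize θ.idx (p y) = j at hj
  have hτ : θ.trans i j (p y) ≠ 0 := θ.trans_ne_zero hi hj
  have hh := hH.h₁_trans hi hj
  have h0 : h₁ H i (p y) ≠ 0 := (hD i _ hi).1.ne'
  rw [θ.dz_trans hp hi hj, θ.dz_trans hp hi hj]
  generalize dz θ p i y u = ζ
  generalize dz θ p i y v = η
  generalize θ.trans i j (p y) = τ at hτ hh
  have hn : conj τ * τ = (Complex.normSq τ : ℂ) := by
    rw [mul_comm, Complex.mul_conj]
  have hn0 : Complex.normSq τ ≠ 0 := by simpa using hτ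
  rw [hn] at hh
  have hh' : h₁ H j (p y) = Complex.normSq τ * h₁ H i (p y) := by exact_mod_cast hh
  have e : τ ^ 2 * ζ * conj (τ ^ 2 * η) = ((Complex.normSq τ ^ 2 : ℝ) : ℂ) * (ζ * conj η) := by
    push_cast
    rw [← hn, map_mul, map_pow]
    ring
  rw [e, Complex.re_ofReal_mul, hh']
  field_simp

theorem eventually_eq_coordField (hp : IsLocalDiffeomorph 𝓘(ℝ, ℂ) 𝓘(ℝ, ℂ) ∞ p) {i : ι} {y : S}
    (hi : p y ∈ (θ.chart i).source) (v : ∀ y : S, TangentSpace 𝓘(ℝ, ℂ) y) :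
    ∀ᶠ x in 𝓝 y, v x = (dz θ p i x (v x)).re • coordField θ p i 1 x +
      (dz θ p i x (v x)).im • coordField θ p i Complex.I x := by
  filter_upwards [θ.eventually_mem_source hp hi] with x hx
  apply (θ.dz_bijective hp hx).1
  rw [θ.dz_add, θ.dz_smul, θ.dz_smul, dz_coordField hp hx, dz_coordField hp hx, mul_one,
    Complex.re_add_im]

variable [IsManifold 𝓘(ℝ, ℂ) ∞ S]

theorem SecDiffAt.congr {v w : ∀ y : S, TangentSpace 𝓘(ℝ, ℂ) y} {y : S} (hw : SecDiffAt w y)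
    (h : ∀ᶠ x in 𝓝 y, v x = w x) : SecDiffAt v y :=
  MDifferentiableAt.congr_of_eventuallyEq hw (h.mono fun x hx => by
    show Bundle.TotalSpace.mk' ℂ x (v x) = Bundle.TotalSpace.mk' ℂ x (w x)
    rw [hx])

theorem SecDiffAt.add {v w : ∀ y : S, TangentSpace 𝓘(ℝ, ℂ) y} {y : S} (hv : SecDiffAt v y)
    (hw : SecDiffAt w y) : SecDiffAt (v + w) y :=
  mdifferentiableAt_add_section hv hw

theorem SecDiffAt.smul {v : ∀ y : S, TangentSpace 𝓘(ℝ, ℂ) y} {y : S} {f : S → ℝ}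
    (hf : MDifferentiableAt 𝓘(ℝ, ℂ) 𝓘(ℝ, ℝ) f y) (hv : SecDiffAt v y) : SecDiffAt (f • v) y :=
  MDifferentiableAt.smul_section hf hv

/-- A vector field is differentiable if its coordinate is. -/
theorem secDiffAt_of_mdifferentiableAt_dz (hp : IsLocalDiffeomorph 𝓘(ℝ, ℂ) 𝓘(ℝ, ℂ) ∞ p) {i : ι}
    {y : S} (hi : p y ∈ (θ.chart i).source) {v : ∀ y : S, TangentSpace 𝓘(ℝ, ℂ) y}
    (hv : MDifferentiableAt 𝓘(ℝ, ℂ) 𝓘(ℝ, ℂ) (fun x => dz θ p i x (v x)) y) : SecDiffAt v y := by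
  have h (u : TangentSpace 𝓘(ℝ, ℂ) y) := hasDirDeriv_of_mdifferentiableAt (v := u) hv
  exact (((secDiffAt_coordField hp hi 1).smul (h 0).re.1).add
    ((secDiffAt_coordField hp hi Complex.I).smul (h 0).im.1)).congr
      (eventually_eq_coordField hp hi v)

variable {cov : CovariantDerivative 𝓘(ℝ, ℂ) ℂ (TangentSpace 𝓘(ℝ, ℂ) : S → Type _)}

/-- The Christoffel symbol of the conformal metric `h₁⁻²`. -/
theorem dz_cov_coordField (hH : IsHarmonicMetric θ t H) (hD : IsDiagonalMetric θ H)
    (hp : IsLocalDiffeomorph 𝓘(ℝ, ℂ) 𝓘(ℝ, ℂ) ∞ p)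
    (hcov : IsSurfaceLeviCivita (surfaceMetric θ H p) cov) {i : ι} {y : S}
    (hi : p y ∈ (θ.chart i).source) (u : TangentSpace 𝓘(ℝ, ℂ) y) (c : ℂ) :
    dz θ p i y (cov (coordField θ p i c) y u) =
      -(2 * logCoeff θ H i (p y) * dz θ p i y u * c) := by
  set a := logCoeff θ H i (p y) with ha
  set e : ℂ → ∀ y : S, TangentSpace 𝓘(ℝ, ℂ) y := coordField θ p i with he
  -- This is again a Koszul argument: N is symmetric because coordinate fields commute and the
  -- torsion vanishes, skew for the real inner product Re(c d̄) by compatibility with the metric,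
  -- and hence zero.
  set N : ℂ → ℂ → ℂ := fun c d => dz θ p i y (cov (e d) y (e c y)) + 2 * a * c * d with hN
  have hsymm : ∀ c d, N c d = N d c := by
    intro c d
    have h := cov.torsion_eq_zero_iff.1 hcov.torsion_free
      (secDiffAt_coordField hp hi c) (secDiffAt_coordField hp hi d)
    rw [mlieBracket_coordField hp hi, sub_eq_zero] at h
    simp only [hN, he]
    rw [h]
    ring
  have h0 := (hD i _ hi).1
  have hskew : ∀ c d f, (N c d * conj f).re + (N c f * conj d).re = 0 := by
    intro c d f
    have h := hcov.metric y (e c y) (e d) (e f) (secDiffAt_coordField hp hi d)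
      (secDiffAt_coordField hp hi f)
    have hder : HasDirDeriv (fun x => surfaceMetric θ H p x (e d x) (e f x)) y (e c y)
        (-(4 * (h₁ H i (p y) ^ 2)⁻¹ * (c * a).re) * (d * conj f).re) := by
      have h1 := hasDirDeriv_h₁ hH hD hp hi (e c y)
      rw [dz_coordField hp hi] at h1
      have h2 := ((h1.mul h1).inv (by positivity)).mul (hasDirDeriv_const (d * conj f).re)
      refine (HasDirDeriv.congr (f := fun x => (h₁ H i (p x) * h₁ H i (p x))⁻¹ * (d * conj f).re)
        ?_ ?_)
      · convert h2 using 1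
        rw [← ha]
        field_simp
        ring
      · filter_upwards [θ.eventually_mem_source hp hi] with x hx
        rw [hH.surfaceMetric_eq hD hp hx, dz_coordField hp hx, dz_coordField hp hx, pow_two]
    rw [hH.surfaceMetric_eq hD hp hi (cov (e d) y (e c y)) (e f y),
      hH.surfaceMetric_eq hD hp hi (e d y) (cov (e f) y (e c y)), dz_coordField hp hi,
      dz_coordField hp hi] at h
    have h' := hder.2.symm.trans h
    simp only [hN]
    generalize dz θ p i y (cov (e d) y (e c y)) = A at h' ⊢
    generalize dz θ p i y (cov (e f) y (e c y)) = B at h' ⊢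
    have h3 : (A * conj f).re + (d * conj B).re = -(4 * (c * a).re) * (d * conj f).re := by
      have hne : (h₁ H i (p y) ^ 2)⁻¹ ≠ 0 := by positivity
      apply mul_left_cancel₀ hne
      linear_combination -h'
    simp only [Complex.mul_re, Complex.mul_im, Complex.add_re, Complex.add_im, Complex.conj_re,
      Complex.conj_im, Complex.re_ofNat, Complex.im_ofNat] at h3 ⊢
    linear_combination h3
  have hzero : ∀ c d, N c d = 0 := by
    intro c d
    have key : ∀ f, (N c d * conj f).re = 0 := by
      intro f
      have e1 := hskew c d f
      have e2 := hskew f c d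
      have e3 := hskew d f c
      rw [hsymm c f] at e1
      rw [hsymm f d] at e2
      rw [hsymm d c] at e3
      linarith
    have := key (N c d)
    rw [Complex.mul_conj] at this
    exact Complex.normSq_eq_zero.1 (by exact_mod_cast this)
  have hu : u = e (dz θ p i y u) y := (θ.dz_bijective hp hi).1 (dz_coordField hp hi _).symm
  have h := hzero (dz θ p i y u) c
  simp only [hN] at h
  rw [← hu] at h
  linear_combination h

/-- The Levi-Civita connection of the conformal metric `h₁⁻²` in a holomorphic coordinate. -/
theorem dz_cov (hH : IsHarmonicMetric θ t H) (hD : IsDiagonalMetric θ H)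
    (hp : IsLocalDiffeomorph 𝓘(ℝ, ℂ) 𝓘(ℝ, ℂ) ∞ p)
    (hcov : IsSurfaceLeviCivita (surfaceMetric θ H p) cov) {i : ι} {y : S}
    (hi : p y ∈ (θ.chart i).source) (u : TangentSpace 𝓘(ℝ, ℂ) y)
    {v : ∀ y : S, TangentSpace 𝓘(ℝ, ℂ) y} (hv : SecDiffAt v y) {ζ' : ℂ}
    (hζ : HasDirDeriv (fun x => dz θ p i x (v x)) y u ζ') :
    dz θ p i y (cov v y u) =
      ζ' - 2 * logCoeff θ H i (p y) * dz θ p i y u * dz θ p i y (v y) := by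
  set f : S → ℝ := fun x => (dz θ p i x (v x)).re with hf
  set g : S → ℝ := fun x => (dz θ p i x (v x)).im with hg
  have hs1 := secDiffAt_coordField hp hi 1
  have hs2 := secDiffAt_coordField hp hi Complex.I
  have hw1 := hs1.smul (f := f) hζ.re.1
  have hw2 := hs2.smul (f := g) hζ.im.1
  -- The connection depends only on the germ of v, which is a combination of the fields with
  -- coordinates 1 and i.
  have e1 := cov.isCovariantDerivativeOnUniv.congr_of_eventuallyEq hv (hw1.add hw2)
    Filter.univ_mem (eventually_eq_coordField hp hi v)
  rw [e1]
  have e2 := cov.isCovariantDerivativeOnUniv.add hw1 hw2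
  have e3 := cov.isCovariantDerivativeOnUniv.leibniz hs1 hζ.re.1
  have e4 := cov.isCovariantDerivativeOnUniv.leibniz hs2 hζ.im.1
  have d1 : mvfderiv 𝓘(ℝ, ℂ) f y u = ζ'.re := hζ.re.2
  have d2 : mvfderiv 𝓘(ℝ, ℂ) g y u = ζ'.im := hζ.im.2
  have e5 : cov (f • coordField θ p i 1 + g • coordField θ p i Complex.I) y u =
      (f y • cov (coordField θ p i 1) y u + ζ'.re • coordField θ p i 1 y) +
      (g y • cov (coordField θ p i Complex.I) y u + ζ'.im • coordField θ p i Complex.I y) := by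
    rw [← d1, ← d2]
    exact (congrArg (· u) e2).trans (congrArg₂ (· + ·) (congrArg (· u) e3) (congrArg (· u) e4))
  rw [e5]
  simp only [θ.dz_add, θ.dz_smul, dz_cov_coordField hH hD hp hcov hi, dz_coordField hp hi, hf, hg]
  generalize dz θ p i y (v y) = ζ
  generalize dz θ p i y u = ξ
  conv_rhs => rw [← Complex.re_add_im ζ, ← Complex.re_add_im ζ']
  ring

end LeviCivita

/-! ### The covariant derivative of the bundle map -/

section ParallelDistribution

variable {ι X S : Type*} [TopologicalSpace X] [ChartedSpace ℂ X] {θ : SqrtCanonical ι X}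
  {t : ι → X → ℂ} {H : ι → X → Mat ℂ} [TopologicalSpace S] [ChartedSpace ℂ S] {p : S → X}
  {P : ι → S → Mat ℂ}

theorem trace_higgs (c : ℂ) : (higgs c).trace = 0 := by
  simp [higgs, Matrix.trace, Fin.sum_univ_three]

/-- Derivatives are computed among complex matrices in the frames of E. This brings them back to
real matrices and records that nothing is lost by taking real parts. -/
theorem HasMatDeriv.of_cplx {F : S → Mat ℝ} {G : S → Mat ℂ} {y : S} {u : TangentSpace 𝓘(ℝ, ℂ) y}
    {D : Mat ℂ} (hG : HasMatDeriv G y u D) (h : ∀ᶠ x in 𝓝 y, cplx (F x) = G x) :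
    HasMatDeriv F y u (D.map Complex.re) ∧ cplx (D.map Complex.re) = D := by
  have h1 : HasMatDeriv F y u (D.map Complex.re) := hG.re.congr (h.mono fun x hx => by
    rw [← hx, map_re_cplx])
  refine ⟨h1, HasMatDeriv.unique (h1.ofReal.congr (h.mono fun x hx => hx.symm)) hG⟩

/-- The equation `D P = 0` as a formula for the differential of `P`. -/
theorem IsFlatRealFrame.hasMatDeriv (hP : IsFlatRealFrame θ t H p P)
    (hp : IsLocalDiffeomorph 𝓘(ℝ, ℂ) 𝓘(ℝ, ℂ) ∞ p) {i : ι} {y : S} (hi : p y ∈ (θ.chart i).source)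
    (u : TangentSpace 𝓘(ℝ, ℂ) y) :
    HasMatDeriv (P i) y u (-((dz θ p i y u • (chernForm θ H i (θ.chart i (p y)) +
      higgs (t i (p y))) + conj (dz θ p i y u) • adj (H i (p y)) (higgs (t i (p y)))) *
      P i y)) := by
  rw [← eq_neg_of_add_eq_zero_left (hP.flat i y hi u)]
  exact hasMatDeriv_matD u fun a b => ((hP.smooth i a b).contMDiffAt
    (θ.eventually_mem_source hp hi)).mdifferentiableAt (by simp)

/-- The Hermitian form `H (Φ + Φ*)(u)` in the frame of index `i`. -/
def higgsForm (θ : SqrtCanonical ι X) (t : ι → X → ℂ) (H : ι → X → Mat ℂ) (p : S → X) (i : ι)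
    (y : S) (u : TangentSpace 𝓘(ℝ, ℂ) y) : Mat ℂ :=
  dz θ p i y u • (H i (p y) * higgs (t i (p y))) +
    conj (dz θ p i y u) • ((higgs (t i (p y)))ᴴ * H i (p y))

theorem higgsForm_conjTranspose (hH : IsHarmonicMetric θ t H) {i : ι} {y : S}
    (hi : p y ∈ (θ.chart i).source) (u : TangentSpace 𝓘(ℝ, ℂ) y) :
    (higgsForm θ t H p i y u)ᴴ = higgsForm θ t H p i y u := by
  have h1 : (H i (p y))ᴴ = H i (p y) := (hH.posDef i _ hi).isHermitian
  unfold higgsForm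
  simp [h1, add_comm]

/-- A sesquilinear form on `E`, pulled back to the flat frame, is differentiated by the flat
connection. -/
theorem IsFlatRealFrame.hasMatDeriv_conj (hP : IsFlatRealFrame θ t H p P)
    (hp : IsLocalDiffeomorph 𝓘(ℝ, ℂ) 𝓘(ℝ, ℂ) ∞ p) {i : ι} {y : S} (hi : p y ∈ (θ.chart i).source)
    (u : TangentSpace 𝓘(ℝ, ℂ) y) {M : S → Mat ℂ} {M' : Mat ℂ} (hM : HasMatDeriv M y u M') :
    HasMatDeriv (fun x => (P i x)ᴴ * M x * P i x) y u ((P i y)ᴴ *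
      (M' - (dz θ p i y u • (chernForm θ H i (θ.chart i (p y)) + higgs (t i (p y))) +
          conj (dz θ p i y u) • adj (H i (p y)) (higgs (t i (p y))))ᴴ * M y
        - M y * (dz θ p i y u • (chernForm θ H i (θ.chart i (p y)) + higgs (t i (p y))) +
          conj (dz θ p i y u) • adj (H i (p y)) (higgs (t i (p y))))) * P i y) := by
  have hd := hP.hasMatDeriv hp hi u
  have h := (hd.conjTranspose.mul hM).mul hd
  convert h using 1
  generalize (dz θ p i y u • (chernForm θ H i (θ.chart i (p y)) + higgs (t i (p y))) +
          conj (dz θ p i y u) • adj (H i (p y)) (higgs (t i (p y)))) = B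
  rw [Matrix.conjTranspose_neg, Matrix.conjTranspose_mul]
  noncomm_ring

theorem mul_adj {K A : Mat ℂ} (hK : K.PosDef) : K * adj K A = Aᴴ * K := by
  unfold adj
  rw [Matrix.mul_assoc, Matrix.mul_nonsing_inv_cancel_left _ _ (posDef_isUnit_det hK)]

theorem adj_conjTranspose_mul {K A : Mat ℂ} (hK : K.PosDef) : (adj K A)ᴴ * K = K * A := by
  have := congrArg Matrix.conjTranspose (mul_adj (A := A) hK)
  rwa [Matrix.conjTranspose_mul, Matrix.conjTranspose_mul, Matrix.conjTranspose_conjTranspose,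
    hK.isHermitian] at this

/-- The differential of the harmonic map is `Φ + Φ*`. -/
theorem IsFlatRealFrame.hasMatDeriv_gram (hH : IsHarmonicMetric θ t H)
    (hP : IsFlatRealFrame θ t H p P) (hp : IsLocalDiffeomorph 𝓘(ℝ, ℂ) 𝓘(ℝ, ℂ) ∞ p)
    {i : ι} {y : S} (hi : p y ∈ (θ.chart i).source) (u : TangentSpace 𝓘(ℝ, ℂ) y) :
    HasMatDeriv (gram H p P i) y u
      ((-2 : ℂ) • ((P i y)ᴴ * higgsForm θ t H p i y u * P i y)) := by
  have h := hP.hasMatDeriv_conj hp hi u (hH.hasMatDeriv_comp hp hi u)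
  have hK := hH.posDef i _ hi
  show HasMatDeriv (fun x => (P i x)ᴴ * H i (p x) * P i x) y u _
  convert h using 1
  rw [← Matrix.smul_mul, ← Matrix.mul_smul]
  congr 2
  -- The Chern terms of dH and of dP cancel, the Chern connection being metric. What is left is Φ +
  -- Φ*, twice because it is self-adjoint for H.
  simp only [higgsForm, Matrix.conjTranspose_add, Matrix.conjTranspose_smul, Matrix.add_mul,
    Matrix.mul_add, Matrix.smul_mul, Matrix.mul_smul, mul_adj hK, adj_conjTranspose_mul hK,
    smul_add]
  simp only [RCLike.star_def, Complex.conj_conj]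
  module

theorem IsFlatRealFrame.hasMatDeriv_harmonicMap (hH : IsHarmonicMetric θ t H)
    (hP : IsFlatRealFrame θ t H p P) (hp : IsLocalDiffeomorph 𝓘(ℝ, ℂ) 𝓘(ℝ, ℂ) ∞ p)
    {i : ι} {y : S} (hi : p y ∈ (θ.chart i).source) (u : TangentSpace 𝓘(ℝ, ℂ) y) :
    HasMatDeriv (harmonicMap θ H p P) y u (matD (harmonicMap θ H p P) y u) ∧
    cplx (matD (harmonicMap θ H p P) y u) =
      (-2 : ℂ) • ((P i y)ᴴ * higgsForm θ t H p i y u * P i y) := by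
  obtain ⟨h1, h2⟩ := (hP.hasMatDeriv_gram hH hp hi u).of_cplx
    (F := harmonicMap θ H p P) (by
      filter_upwards [θ.eventually_mem_source hp hi] with x hx
      exact hP.cplx_harmonicMap hH hx)
  rw [h1.matD_eq]
  exact ⟨h1, h2⟩

theorem IsFlatRealFrame.isUnit_conjTranspose_det (hP : IsFlatRealFrame θ t H p P) {i : ι} {y : S}
    (hi : p y ∈ (θ.chart i).source) : IsUnit ((P i y)ᴴ).det := by
  rw [Matrix.det_conjTranspose]; exact (hP.isUnit_det hi).star

/-- Composition of Hermitian forms on the flat frame through the inverse of the Gram matrix. -/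
theorem IsFlatRealFrame.mul_inv_gram_mul (hP : IsFlatRealFrame θ t H p P) {i : ι} {y : S}
    (hi : p y ∈ (θ.chart i).source) (M N : Mat ℂ) :
    ((P i y)ᴴ * M * P i y) * (gram H p P i y)⁻¹ * ((P i y)ᴴ * N * P i y) =
      (P i y)ᴴ * (M * (H i (p y))⁻¹ * N) * P i y := by
  rw [gram, Matrix.mul_inv_rev, Matrix.mul_inv_rev]
  calc _ = (P i y)ᴴ * M * (P i y * ((P i y)⁻¹ * ((H i (p y))⁻¹ * (((P i y)ᴴ)⁻¹ *
        ((P i y)ᴴ * (N * P i y)))))) := by simp only [Matrix.mul_assoc]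
    _ = _ := by
      rw [Matrix.mul_nonsing_inv_cancel_left _ _ (hP.isUnit_det hi),
        Matrix.nonsing_inv_mul_cancel_left _ _ (hP.isUnit_conjTranspose_det hi)]
      simp only [Matrix.mul_assoc]

theorem IsFlatRealFrame.matD_harmonicMap_mem_symTangent (hH : IsHarmonicMetric θ t H)
    (hD : IsDiagonalMetric θ H)
    (hP : IsFlatRealFrame θ t H p P) (hp : IsLocalDiffeomorph 𝓘(ℝ, ℂ) 𝓘(ℝ, ℂ) ∞ p) (y : S)
    (u : TangentSpace 𝓘(ℝ, ℂ) y) :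
    matD (harmonicMap θ H p P) y u ∈ symTangent (harmonicMap θ H p P y) := by
  set i := θ.idx (p y)
  have hi : p y ∈ (θ.chart i).source := θ.mem_source (p y)
  have hW := (hP.hasMatDeriv_harmonicMap hH hp hi u).2
  have hK := hH.posDef i _ hi
  constructor
  · apply cplx_injective
    rw [← cplx_conjTranspose, hW, Matrix.conjTranspose_smul, Matrix.conjTranspose_mul,
      Matrix.conjTranspose_mul, Matrix.conjTranspose_conjTranspose, higgsForm_conjTranspose hH hi]
    simp [Matrix.mul_assoc]
  · have hq := posDef_isUnit_det (hP.harmonicMap_mem_symSpace hH hD y).1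
    have h1 : (cplx ((harmonicMap θ H p P y)⁻¹ * matD (harmonicMap θ H p P) y u)).trace = 0 := by
      rw [cplx_mul, cplx_inv _ hq, hP.cplx_harmonicMap hH hi, hW, gram,
        Matrix.mul_inv_rev, Matrix.mul_inv_rev, Matrix.mul_smul, Matrix.trace_smul]
      have : (P i y)⁻¹ * ((H i (p y))⁻¹ * ((P i y)ᴴ)⁻¹) * ((P i y)ᴴ *
          higgsForm θ t H p i y u * P i y) =
          (P i y)⁻¹ * ((H i (p y))⁻¹ * (((P i y)ᴴ)⁻¹ * ((P i y)ᴴ *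
          (higgsForm θ t H p i y u * P i y)))) := by
        simp only [Matrix.mul_assoc]
      rw [this, Matrix.nonsing_inv_mul_cancel_left _ _ (hP.isUnit_conjTranspose_det hi),
        Matrix.trace_mul_comm, ← Matrix.mul_assoc (H i (p y))⁻¹,
        Matrix.mul_nonsing_inv_cancel_right _ _ (hP.isUnit_det hi), higgsForm, Matrix.mul_add,
        Matrix.mul_smul, Matrix.mul_smul,
        Matrix.nonsing_inv_mul_cancel_left _ _ (posDef_isUnit_det hK), Matrix.trace_add,
        Matrix.trace_smul, Matrix.trace_smul, Matrix.trace_mul_comm (H i (p y))⁻¹,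
        Matrix.mul_nonsing_inv_cancel_right _ _ (posDef_isUnit_det hK),
        Matrix.trace_conjTranspose, trace_higgs]
      simp
    rw [cplx_trace] at h1
    exact_mod_cast h1

/-- The correction is the logarithmic derivative of h₁, by which ζ and its conjugate are divided in
the two nonzero entries. It is real, so both entries keep being conjugate to each other. -/
theorem hasMatDeriv_formMat (hH : IsHarmonicMetric θ t H) (hD : IsDiagonalMetric θ H)
    (hp : IsLocalDiffeomorph 𝓘(ℝ, ℂ) 𝓘(ℝ, ℂ) ∞ p) {i : ι} {y : S} (hi : p y ∈ (θ.chart i).source)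
    (u : TangentSpace 𝓘(ℝ, ℂ) y) {ζ : S → ℂ} {ζ' : ℂ} (hζ : HasDirDeriv ζ y u ζ') :
    HasMatDeriv (fun x => formMat (h₁ H i (p x)) (ζ x)) y u
      (formMat (h₁ H i (p y))
        (ζ' - (dz θ p i y u * logCoeff θ H i (p y) +
          conj (dz θ p i y u * logCoeff θ H i (p y))) * ζ y)) := by
  have h0 : (h₁ H i (p y) : ℂ) ≠ 0 := Complex.ofReal_ne_zero.2 (hD i _ hi).1.ne'
  have hh := (hasDirDeriv_h₁ hH hD hp hi u).ofReal
  have hre : ∀ w : ℂ, w + conj w = ((2 * w.re : ℝ) : ℂ) := Complex.add_conj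
  rw [hre]
  generalize dz θ p i y u * logCoeff θ H i (p y) = w at hh ⊢
  have h1 := hζ.mul (hh.inv h0)
  have h2 := hζ.conj.mul (hh.inv h0)
  intro a b
  fin_cases a <;> fin_cases b <;> simp [formMat, map_ofNat]
  any_goals exact hasDirDeriv_const _
  · simp only [div_eq_mul_inv]
    convert h2 using 1
    push_cast
    field_simp
    ring
  · simp only [div_eq_mul_inv]
    convert h1 using 1
    push_cast
    field_simp
    ring

/-- In the entry (2, 0), the antiholomorphic term coming from d(1/h₁) cancels against the adjoint of
the Chern form, and the two holomorphic terms add up to 2a, as in the Christoffel symbol of h₁⁻².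
The shape of `formMat` survives because the Chern form is diagonal. -/
theorem formMat_covariant {h : ℝ} (ζ η ζ' a : ℂ) :
    formMat h (ζ' - (ζ * a + conj (ζ * a)) * η)
      - conj ζ • ((Matrix.diagonal ![a, 0, -a])ᴴ * formMat h η)
      - ζ • (formMat h η * Matrix.diagonal ![a, 0, -a]) =
      formMat h (ζ' - 2 * a * ζ * η) := by
  rw [Matrix.diagonal_conjTranspose]
  ext j k
  rw [Matrix.sub_apply, Matrix.sub_apply, Matrix.smul_apply, Matrix.smul_apply,
    Matrix.diagonal_mul, Matrix.mul_diagonal]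
  fin_cases j <;> fin_cases k <;> simp [formMat, map_ofNat] <;> ring

variable [IsManifold 𝓘(ℝ, ℂ) ∞ S]
  {cov : CovariantDerivative 𝓘(ℝ, ℂ) ℂ (TangentSpace 𝓘(ℝ, ℂ) : S → Type _)}
  {Γ : Mat ℝ → Mat ℝ →ₗ[ℝ] Mat ℝ →ₗ[ℝ] Mat ℝ}

theorem IsFlatRealFrame.matDiffAt_bundleMap (hH : IsHarmonicMetric θ t H)
    (hD : IsDiagonalMetric θ H) (hP : IsFlatRealFrame θ t H p P)
    (hp : IsLocalDiffeomorph 𝓘(ℝ, ℂ) 𝓘(ℝ, ℂ) ∞ p)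
    {v : ∀ y : S, TangentSpace 𝓘(ℝ, ℂ) y} {y : S} (hv : SecDiffAt v y) :
    MatDiffAt (fun x => bundleMap θ H p P x (v x)) y := by
  have hi := θ.mem_source (p y)
  have hζ := hasDirDeriv_of_mdifferentiableAt (v := 0) (hv.mdifferentiableAt_dz hp hi)
  obtain ⟨h1, -⟩ := ((hP.hasMatDeriv_conj hp hi 0
    (hasMatDeriv_formMat hH hD hp hi 0 hζ)).const_smul (-2 : ℂ)).of_cplx
    (F := fun x => bundleMap θ H p P x (v x)) (by
      filter_upwards [θ.eventually_mem_source hp hi] with x hx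
      exact hP.cplx_bundleMap hH hD hp hx (v x))
  exact fun a b => (h1 a b).1

/-- `∇ V(v) = V(∇ v)`. -/
theorem IsFlatRealFrame.covAlong_bundleMap (hH : IsHarmonicMetric θ t H)
    (hD : IsDiagonalMetric θ H) (hP : IsFlatRealFrame θ t H p P)
    (hp : IsLocalDiffeomorph 𝓘(ℝ, ℂ) 𝓘(ℝ, ℂ) ∞ p) (hΓ : IsSymLeviCivita Γ)
    (hcov : IsSurfaceLeviCivita (surfaceMetric θ H p) cov)
    {v : ∀ y : S, TangentSpace 𝓘(ℝ, ℂ) y} {y : S} (hv : SecDiffAt v y)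
    (u : TangentSpace 𝓘(ℝ, ℂ) y) :
    covAlong Γ (harmonicMap θ H p P) (fun x => bundleMap θ H p P x (v x)) y u =
      bundleMap θ H p P y (cov v y u) := by
  set i := θ.idx (p y) with hi_def
  have hi : p y ∈ (θ.chart i).source := θ.mem_source (p y)
  obtain ⟨ζ', hζ⟩ : ∃ ζ' : ℂ, HasDirDeriv (fun x => dz θ p i x (v x)) y u ζ' :=
    ⟨_, hasDirDeriv_of_mdifferentiableAt (hv.mdifferentiableAt_dz hp hi)⟩
  obtain ⟨h1, h2⟩ := ((hP.hasMatDeriv_conj hp hi u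
    (hasMatDeriv_formMat hH hD hp hi u hζ)).const_smul (-2 : ℂ)).of_cplx
    (F := fun x => bundleMap θ H p P x (v x)) (by
      filter_upwards [θ.eventually_mem_source hp hi] with x hx
      exact hP.cplx_bundleMap hH hD hp hx (v x))
  have hq := hP.harmonicMap_mem_symSpace hH hD y
  have hK := hH.posDef i _ hi
  unfold covAlong
  rw [hΓ.eq hq (hP.matD_harmonicMap_mem_symTangent hH hD hp y u)
    (hP.bundleMap_mem_symTangent hH hD y (v y)), h1.matD_eq]
  apply cplx_injective
  -- Each term becomes a multiple of P*(·)P, so the claim reduces to an identity between matrices in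
  -- the frame of index i.
  rw [cplx_add, cplx_neg, cplx_smul, cplx_add, cplx_mul, cplx_mul, cplx_mul, cplx_mul,
    cplx_inv _ (posDef_isUnit_det hq.1), h2, hP.cplx_harmonicMap hH hi,
    (hP.hasMatDeriv_harmonicMap hH hp hi u).2, hP.cplx_bundleMap hH hD hp hi,
    hP.cplx_bundleMap hH hD hp hi, dz_cov hH hD hp hcov hi u hv hζ,
    ← formMat_covariant, ← chernForm_eq_diagonal hH hD hi]
  simp only [Matrix.smul_mul, Matrix.mul_smul, hP.mul_inv_gram_mul hi]
  set M := formMat (h₁ H i (p y)) (dz θ p i y (v y))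
  set A := chernForm θ H i (θ.chart i (p y))
  have e1 : higgsForm θ t H p i y u * (H i (p y))⁻¹ * M =
      (dz θ p i y u • (adj (H i (p y)) (higgs (t i (p y))))ᴴ +
        conj (dz θ p i y u) • (higgs (t i (p y)))ᴴ) * M := by
    rw [higgsForm, ← adj_conjTranspose_mul hK, ← Matrix.smul_mul, ← Matrix.smul_mul,
      ← Matrix.add_mul, Matrix.mul_nonsing_inv_cancel_right _ _ (posDef_isUnit_det hK)]
  have e2 : M * (H i (p y))⁻¹ * higgsForm θ t H p i y u =
      M * (dz θ p i y u • higgs (t i (p y)) +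
        conj (dz θ p i y u) • adj (H i (p y)) (higgs (t i (p y)))) := by
    rw [higgsForm, ← mul_adj hK, ← Matrix.mul_smul, ← Matrix.mul_smul, ← Matrix.mul_add,
      Matrix.mul_assoc, Matrix.nonsing_inv_mul_cancel_left _ _ (posDef_isUnit_det hK)]
  -- The part Φ + Φ* of the derivative of the frame cancels against the Christoffel term, in the
  -- form given by `e1` and `e2`; only the Chern derivative of M remains.
  have e3 : formMat (h₁ H i (p y)) (ζ' - (dz θ p i y u * logCoeff θ H i (p y) +
          conj (dz θ p i y u * logCoeff θ H i (p y))) * dz θ p i y (v y))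
        - conj (dz θ p i y u) • (Aᴴ * M) - dz θ p i y u • (M * A) =
      (formMat (h₁ H i (p y)) (ζ' - (dz θ p i y u * logCoeff θ H i (p y) +
          conj (dz θ p i y u * logCoeff θ H i (p y))) * dz θ p i y (v y))
        - (dz θ p i y u • (A + higgs (t i (p y))) +
          conj (dz θ p i y u) • adj (H i (p y)) (higgs (t i (p y))))ᴴ * M
        - M * (dz θ p i y u • (A + higgs (t i (p y))) +
          conj (dz θ p i y u) • adj (H i (p y)) (higgs (t i (p y)))))
      + higgsForm θ t H p i y u * (H i (p y))⁻¹ * M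
      + M * (H i (p y))⁻¹ * higgsForm θ t H p i y u := by
    rw [e1, e2]
    simp only [Matrix.conjTranspose_add, Matrix.conjTranspose_smul, Matrix.add_mul, Matrix.mul_add,
      Matrix.smul_mul, Matrix.mul_smul, smul_add, RCLike.star_def, Complex.conj_conj]
    module
  rw [e3]
  simp only [Matrix.mul_add ((P i y)ᴴ), Matrix.add_mul _ _ (P i y)]
  push_cast
  module

end ParallelDistribution

/-! ### Parallel sections -/

section ParallelTransport

variable {ι X S : Type*} [TopologicalSpace X] [ChartedSpace ℂ X] {θ : SqrtCanonical ι X}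
  {t : ι → X → ℂ} {H : ι → X → Mat ℂ} [TopologicalSpace S] [ChartedSpace ℂ S] {p : S → X}
  {P : ι → S → Mat ℂ}

/-- The adjugate stands in for the inverse of the frame because its entries are polynomial; as |det
P| = 1, the extra scalars cancel in `adjugate_conj`. -/
theorem mdifferentiableAt_adjugate {F : S → Mat ℂ} {y : S}
    (hF : ∀ a b, MDifferentiableAt 𝓘(ℝ, ℂ) 𝓘(ℝ, ℂ) (fun x => F x a b) y) (a b : Fin 3) :
    MDifferentiableAt 𝓘(ℝ, ℂ) 𝓘(ℝ, ℂ) (fun x => (F x).adjugate a b) y := by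
  have h : ∀ a b, HasDirDeriv (fun x => F x a b) y (0 : TangentSpace 𝓘(ℝ, ℂ) y) _ := fun a b =>
    hasDirDeriv_of_mdifferentiableAt (hF a b)
  have hsub : ∀ a b c d a' b' c' d' : Fin 3, MDifferentiableAt 𝓘(ℝ, ℂ) 𝓘(ℝ, ℂ)
      (fun x => F x a b * F x c d - F x a' b' * F x c' d') y := fun a b c d a' b' c' d' => by
    simpa [sub_eq_add_neg] using
      (((h a b).mul (h c d)).add (((h a' b').mul (h c' d')).const_mul (-1))).1
  have hadd : ∀ a b c d a' b' c' d' : Fin 3, MDifferentiableAt 𝓘(ℝ, ℂ) 𝓘(ℝ, ℂ)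
      (fun x => -(F x a b * F x c d) + F x a' b' * F x c' d') y := fun a b c d a' b' c' d' => by
    simpa [neg_add_eq_sub] using hsub a' b' c' d' a b c d
  simp only [Matrix.adjugate_fin_three]
  fin_cases a <;> fin_cases b <;> first | exact hsub .. | exact hadd ..

theorem IsFlatRealFrame.adjugate_conj (hP : IsFlatRealFrame θ t H p P) {i : ι} {y : S}
    (hi : p y ∈ (θ.chart i).source) (M : Mat ℂ) :
    (P i y).adjugateᴴ * ((P i y)ᴴ * M * P i y) * (P i y).adjugate = M := by
  have hdet : star (P i y).det * (P i y).det = 1 := by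
    have := Complex.normSq_eq_conj_mul_self (z := (P i y).det)
    rw [Complex.normSq_eq_norm_sq, hP.volume i y hi] at this
    simpa using this.symm
  calc (P i y).adjugateᴴ * ((P i y)ᴴ * M * P i y) * (P i y).adjugate
      = (P i y * (P i y).adjugate)ᴴ * M * (P i y * (P i y).adjugate) := by
        simp only [Matrix.conjTranspose_mul, Matrix.mul_assoc]
    _ = M := by
        rw [Matrix.mul_adjugate, Matrix.conjTranspose_smul, Matrix.conjTranspose_one]
        simp [smul_smul, mul_comm (P i y).det]
        rw [show conj (P i y).det * (P i y).det = 1 from hdet, one_smul]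

variable [IsManifold 𝓘(ℝ, ℂ) ∞ S]
  {cov : CovariantDerivative 𝓘(ℝ, ℂ) ℂ (TangentSpace 𝓘(ℝ, ℂ) : S → Type _)}
  {Γ : Mat ℝ → Mat ℝ →ₗ[ℝ] Mat ℝ →ₗ[ℝ] Mat ℝ}

/-- A vector field is differentiable if its image by `V` is. -/
theorem IsFlatRealFrame.secDiffAt_of_matDiffAt (hH : IsHarmonicMetric θ t H)
    (hD : IsDiagonalMetric θ H) (hP : IsFlatRealFrame θ t H p P)
    (hp : IsLocalDiffeomorph 𝓘(ℝ, ℂ) 𝓘(ℝ, ℂ) ∞ p)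
    {v : ∀ y : S, TangentSpace 𝓘(ℝ, ℂ) y} {y : S}
    (hv : MatDiffAt (fun x => bundleMap θ H p P x (v x)) y) : SecDiffAt v y := by
  set i := θ.idx (p y) with hi_def
  have hi : p y ∈ (θ.chart i).source := θ.mem_source (p y)
  refine secDiffAt_of_mdifferentiableAt_dz hp hi ?_
  have hadj := hasMatDeriv_matD (0 : TangentSpace 𝓘(ℝ, ℂ) y)
    (mdifferentiableAt_adjugate fun a b => (hP.hasMatDeriv hp hi 0 a b).1)
  have hY := (hasMatDeriv_matD (0 : TangentSpace 𝓘(ℝ, ℂ) y) hv).ofReal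
  have hM := ((hadj.conjTranspose.mul hY).mul hadj) 2 0
  have hh := (hasDirDeriv_h₁ hH hD hp hi 0).ofReal
  -- The entry in `hM` is −2 dz(v)/h₁, so multiplication by −h₁/2 recovers the coordinate of v.
  refine ((hM.mul hh).const_mul (-1 / 2 : ℂ)).1.congr_of_eventuallyEq ?_
  filter_upwards [θ.eventually_mem_source hp hi] with x hx
  have h0 : (h₁ H i (p x) : ℂ) ≠ 0 := Complex.ofReal_ne_zero.2 (hD i _ hx).1.ne'
  have e : (bundleMap θ H p P x (v x)).map Complex.ofReal = _ := hP.cplx_bundleMap hH hD hp hx (v x)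
  rw [e, Matrix.mul_smul, Matrix.smul_mul, hP.adjugate_conj hx]
  simp [formMat]
  field_simp

/-- A field with values in the planes is V(v) for a pointwise choice of v. This v is automatically
differentiable by `secDiffAt_of_matDiffAt`, so the formula for ∇V(v) applies. -/
theorem IsFlatRealFrame.covAlong_mem_range (hH : IsHarmonicMetric θ t H)
    (hD : IsDiagonalMetric θ H) (hP : IsFlatRealFrame θ t H p P)
    (hp : IsLocalDiffeomorph 𝓘(ℝ, ℂ) 𝓘(ℝ, ℂ) ∞ p) (hΓ : IsSymLeviCivita Γ)
    (hcov : IsSurfaceLeviCivita (surfaceMetric θ H p) cov) {Y : S → Mat ℝ} {y : S}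
    (hY : ∀ x, Y x ∈ Set.range (bundleMap θ H p P x)) (hYd : MatDiffAt Y y)
    (u : TangentSpace 𝓘(ℝ, ℂ) y) :
    covAlong Γ (harmonicMap θ H p P) Y y u ∈ Set.range (bundleMap θ H p P y) := by
  choose v hv using hY
  obtain rfl : (fun x => bundleMap θ H p P x (v x)) = Y := funext hv
  exact ⟨_, (hP.covAlong_bundleMap hH hD hp hΓ hcov
    (hP.secDiffAt_of_matDiffAt hH hD hp hYd) u).symm⟩

/-- Near time s the section is a combination of fields on the surface, for which ∇V = V∇ is known at
γ(s). Since V is linear on fibres, the Leibniz rule carries the formula over to the curve. -/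
theorem IsFlatRealFrame.covCurve_bundleMap (hH : IsHarmonicMetric θ t H)
    (hD : IsDiagonalMetric θ H) (hP : IsFlatRealFrame θ t H p P)
    (hp : IsLocalDiffeomorph 𝓘(ℝ, ℂ) 𝓘(ℝ, ℂ) ∞ p) (hΓ : IsSymLeviCivita Γ)
    (hcov : IsSurfaceLeviCivita (surfaceMetric θ H p) cov) {γ : ℝ → S} {s : ℝ}
    {v : ∀ s, TangentSpace 𝓘(ℝ, ℂ) (γ s)} {w : TangentSpace 𝓘(ℝ, ℂ) (γ s)}
    (hγ : MDifferentiableAt 𝓘(ℝ, ℝ) 𝓘(ℝ, ℂ) γ s) (hv : HasCovDerivAlong cov γ v s w) :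
    (∀ a b, DifferentiableAt ℝ (fun r => bundleMap θ H p P (γ r) (v r) a b) s) ∧
      covCurve Γ (fun r => harmonicMap θ H p P (γ r))
        (fun r => bundleMap θ H p P (γ r) (v r)) s = bundleMap θ H p P (γ s) w := by
  obtain ⟨e, f, he, hf, hve, hw⟩ := hv
  set γ' : TangentSpace 𝓘(ℝ, ℂ) (γ s) := mfderiv 𝓘(ℝ, ℝ) 𝓘(ℝ, ℂ) γ s (1 : ℝ) with hγ'
  have hlin := fun x => hP.isLinearMap_bundleMap hH hD x
  set V : ∀ x, TangentSpace 𝓘(ℝ, ℂ) x →ₗ[ℝ] Mat ℝ := fun x => IsLinearMap.mk' _ (hlin x) with hV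
  have hVe : ∀ x w, bundleMap θ H p P x w = V x w := fun x w => rfl
  have hd : ∀ k a b, HasDerivAt (fun r => V (γ r) (e k (γ r)) a b)
      (matD (fun x => V x (e k x)) (γ s) γ' a b) s := fun k a b =>
    (hasMatDeriv_matD γ' (hP.matDiffAt_bundleMap hH hD hp (he k))).comp_curve hγ a b
  have hq : curveD (fun r => harmonicMap θ H p P (γ r)) s =
      matD (harmonicMap θ H p P) (γ s) γ' := by
    ext a b
    exact ((hP.hasMatDeriv_harmonicMap hH hp (θ.mem_source _) γ').1.comp_curve hγ a b).deriv
  have hder : ∀ a b, HasDerivAt (fun r => bundleMap θ H p P (γ r) (v r) a b)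
      ((∑ k, (deriv (f k) s • V (γ s) (e k (γ s)) +
        f k s • matD (fun x => V x (e k x)) (γ s) γ')) a b) s := fun a b => by
    have h1 := HasDerivAt.fun_sum (u := Finset.univ)
      fun k _ => (hf k).hasDerivAt.mul (hd k a b)
    refine (h1.congr_of_eventuallyEq ?_).congr_deriv ?_
    · filter_upwards [hve] with r hr
      rw [hr, hVe, map_sum, Matrix.sum_apply]
      simp
    · rw [Matrix.sum_apply]
      simp
  refine ⟨fun a b => (hder a b).differentiableAt, ?_⟩
  have hc : curveD (fun r => bundleMap θ H p P (γ r) (v r)) s =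
      ∑ k, (deriv (f k) s • V (γ s) (e k (γ s)) +
        f k s • matD (fun x => V x (e k x)) (γ s) γ') := by
    ext a b
    exact (hder a b).deriv
  have hcovk : ∀ k, matD (fun x => V x (e k x)) (γ s) γ' +
      Γ (harmonicMap θ H p P (γ s)) (matD (harmonicMap θ H p P) (γ s) γ') (V (γ s) (e k (γ s))) =
      V (γ s) (cov (e k) (γ s) γ') := fun k =>
    hP.covAlong_bundleMap hH hD hp hΓ hcov (he k) γ'
  unfold covCurve
  rw [hc, hq]
  show _ + Γ (harmonicMap θ H p P (γ s)) _ (bundleMap θ H p P (γ s) (v s)) = _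
  rw [hve.self_of_nhds, hVe, hVe, hw, map_sum, map_sum, map_sum, ← Finset.sum_add_distrib]
  refine Finset.sum_congr rfl fun k _ => ?_
  rw [map_add, map_smul, map_smul, map_smul, map_smul, ← hcovk k, smul_add, add_assoc]

end ParallelTransport

end HiggsSlice

end


open HiggsSlice in
theorem proposition4p1 {ι X S : Type*}
    -- `X` is a closed Riemann surface of genus at least two, with a square root of `K`
    [TopologicalSpace X] [T2Space X] [CompactSpace X] [ConnectedSpace X]
    [ChartedSpace ℂ X] [IsManifold 𝓘(ℂ) ω X]
    (θ : SqrtCanonical ι X) (hgenus : 2 ≤ θ.genus)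
    -- a holomorphic section `t` of `K^{3/2}` and a harmonic metric for the Higgs field
    (t : ι → X → ℂ) (ht : t ∈ θ.sections 3)
    (H : ι → X → Mat ℂ) (hH : IsHarmonicMetric θ t H)
    -- `p : S → X` is the universal cover
    [TopologicalSpace S] [SimplyConnectedSpace S] [ChartedSpace ℂ S] [IsManifold 𝓘(ℝ, ℂ) ∞ S]
    (p : S → X) (hp : IsCoveringMap p) (hp' : IsLocalDiffeomorph 𝓘(ℝ, ℂ) 𝓘(ℝ, ℂ) ∞ p)
    -- a flat real frame over the universal cover, which defines `h` and `V`
    (P : ι → S → Mat ℂ) (hP : IsFlatRealFrame θ t H p P)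
    -- the Levi-Civita connections of the symmetric space and of the metric `h₁⁻²`
    (Γ : Mat ℝ → Mat ℝ →ₗ[ℝ] Mat ℝ →ₗ[ℝ] Mat ℝ) (hΓ : IsSymLeviCivita Γ)
    (cov : CovariantDerivative 𝓘(ℝ, ℂ) ℂ (TangentSpace 𝓘(ℝ, ℂ) : S → Type _))
    (hcov : IsSurfaceLeviCivita (surfaceMetric θ H p) cov) :
    -- `H = diag (h₁, 1, h₁⁻¹)`
    (∀ i x, x ∈ (θ.chart i).source →
      H i x = Matrix.diagonal ![(h₁ H i x : ℂ), 1, (h₁ H i x : ℂ)⁻¹]) ∧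
    -- `h` is a smooth map to the symmetric space
    (∀ y, harmonicMap θ H p P y ∈ symSpace) ∧
    (∀ a b, ContMDiff 𝓘(ℝ, ℂ) 𝓘(ℝ, ℝ) ∞ fun y => harmonicMap θ H p P y a b) ∧
    -- `V` is a bundle map over `h` whose image is a distribution of planes
    (∀ y, IsLinearMap ℝ (bundleMap θ H p P y) ∧ Function.Injective (bundleMap θ H p P y) ∧
      ∀ v, bundleMap θ H p P y v ∈ symTangent (harmonicMap θ H p P y)) ∧
    -- the distribution of planes is parallel
    (∀ (Y : S → Mat ℝ) (y : S), (∀ x, Y x ∈ Set.range (bundleMap θ H p P x)) → MatDiffAt Y y →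
      ∀ u, covAlong Γ (harmonicMap θ H p P) Y y u ∈ Set.range (bundleMap θ H p P y)) ∧
    -- `∇ V(v) = V(∇ v)`
    (∀ (v : ∀ y : S, TangentSpace 𝓘(ℝ, ℂ) y) (y : S), SecDiffAt v y →
      MatDiffAt (fun x => bundleMap θ H p P x (v x)) y ∧
      ∀ u, covAlong Γ (harmonicMap θ H p P) (fun x => bundleMap θ H p P x (v x)) y u =
        bundleMap θ H p P y (cov v y u)) ∧
    -- `V` maps parallel sections over a curve to parallel sections
    (∀ (γ : ℝ → S) (J : Set ℝ) (v : ∀ s, TangentSpace 𝓘(ℝ, ℂ) (γ s)),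
      (∀ s ∈ J, MDifferentiableAt 𝓘(ℝ, ℝ) 𝓘(ℝ, ℂ) γ s) →
      (∀ s ∈ J, HasCovDerivAlong cov γ v s 0) →
      ∀ s ∈ J, (∀ a b, DifferentiableAt ℝ (fun r => bundleMap θ H p P (γ r) (v r) a b) s) ∧
        covCurve Γ (fun r => harmonicMap θ H p P (γ r))
          (fun r => bundleMap θ H p P (γ r) (v r)) s = 0) := by
  -- Hitchin's equation, compactness and the genus bound serve only to diagonalise H; the remaining
  -- claims are deduced from the diagonal form.
  have hdiag := fun i x hx => hH.eq_diagonal hgenus (i := i) (x := x) hx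
  have hD : IsDiagonalMetric θ H := fun i x hx => ⟨hH.h₁_pos hx, hdiag i x hx⟩
  refine ⟨hdiag, hP.harmonicMap_mem_symSpace hH hD, hP.contMDiff_harmonicMap hH hp',
    fun y => ⟨hP.isLinearMap_bundleMap hH hD y, hP.injective_bundleMap hH hD hp' y,
      hP.bundleMap_mem_symTangent hH hD y⟩,
    fun Y y hY hYd u => hP.covAlong_mem_range hH hD hp' hΓ hcov hY hYd u,
    fun v y hv => ⟨hP.matDiffAt_bundleMap hH hD hp' hv,
      hP.covAlong_bundleMap hH hD hp' hΓ hcov hv⟩,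
    fun γ J v hγ hv s hs => ?_⟩
  obtain ⟨h1, h2⟩ := hP.covCurve_bundleMap hH hD hp' hΓ hcov (hγ s hs) (hv s hs)
  exact ⟨h1, h2.trans (hP.isLinearMap_bundleMap hH hD (γ s)).map_zero⟩
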